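/- Let $S=\{1,2,3\}$ index the simple transpositions $s_i=(i,i+1)$ of $W=\mathfrak S_4$, and let $\ell$ be the length function. For $I\subseteq S$ let $W_I=\langle s_i\mid i\in I\rangle$ and $\pi(I)=\sum_{w\in W_I}q^{\ell(w)}$. Let $H_q$ be the Hecke algebra of $\mathfrak S_4$ over $\mathbb Z[q]$, with generators $T_i=T_{s_i}$ subject to $T_i^2=(q-1)T_i+q$ and the braid relations, and with the elements $T_w$ $(w\in W)$ given by reduced expressions. Put $x_I=\sum_{w\in W_I}T_w$ and $$E_q(\mathfrak S_4)=\mathrm{End}_{H_q}\Big(\bigoplus_{I\subseteq S}x_IH_q\Big)\qquad(\text{endomorphisms of right }H_q\text{-modules}).$$ Write $I\sqsubset J$ if $I\subset J$ and $|I|=|J|-1$. Let $\mathcal Q$ be the quiver with vertices the subsets of $S$ and, for all $I\sqsubset J$, an arrow $\upsilon_{I,J}$ from $J$ to $I$ and an arrow $\delta_{J,I}$ from $I$ to $J$. Let $\mathcal Q_q=\mathbb Z[q]\mathcal Q$ be its path algebra, in which $\alpha\beta$ means "first $\beta$, then $\alpha$" (and is $0$ if $\alpha$ does not start where $\beta$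 ends), let $e_K$ be the trivial path at $K$, and let $\chi_s=\upsilon_{\emptyset,\{s\}}\delta_{\{s\},\emptyset}$ for $s\in S$. **Theorem.** There is a unique $\mathbb Z[q]$-algebra homomorphism $\Phi:\mathcal Q_q\to E_q(\mathfrak S_4)$ that sends $e_K$ to the identity of $x_KH_q$ and, for $I\sqsubset J$, sends $\upsilon_{I,J}$ to the inclusion $x_JH_q\to x_IH_q$ and $\delta_{J,I}$ to the map $x_IH_q\to x_JH_q$ given by left multiplication with $h_{J,I}=\sum_w T_w$, where $w$ runs over the elements of $W_J$ that are shortest in their coset $wW_I$ (so $h_{J,I}x_I=x_J$); all these maps are extended by $0$ to the other summands. The homomorphism $\Phi$ is surjective, and its kernel $\mathcal K$ is the two-sided ideal of $\mathcal Q_q$ generated by the following relations. * Quasi-idempotent relations: $\delta_{J,I}\upsilon_{I,J}=\frac{\pi(J)}{\pi(I)}e_J$ for all $I\sqsubset J$. * Sandwich relations: $\upsilon_{I,J}\upsilon_{J,K}=\upsilon_{I,J'}\upsilon_{J',K}$ and $\delta_{K,J}\delta_{J,I}=\delta_{K,J'}\delta_{J',I}$ for all $I\sqsubset J\sqsubset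 K$ and $I\sqsubset J'\sqsubset K$. * Torsion relations: * (T1) $\delta_{\{s\},\emptyset}\,\chi_t\,\upsilon_{\emptyset,\{s\}}=\upsilon_{\{s\},\{s,t\}}\delta_{\{s,t\},\{s\}}+q\,e_{\{s\}}$ for $(s,t)\in\{(1,2),(2,1),(2,3),(3,2)\}$; * and, for $(a,b,c)\in\{(1,2,3),(3,2,1)\}$, * (T2) $\delta_{\{a\},\emptyset}\upsilon_{\emptyset,\{c\}}=\upsilon_{\{a\},\{a,c\}}\delta_{\{a,c\},\{c\}}$; * (T3) $\delta_{\{a,b\},\{a\}}\upsilon_{\{a\},\{a,c\}}\delta_{\{a,c\},\{a\}}\upsilon_{\{a\},\{a,b\}}=\upsilon_{\{a,b\},S}\delta_{S,\{a,b\}}+q(q+1)e_{\{a,b\}}$; * (T4) $\delta_{\{a,b\},\{b\}}\upsilon_{\{b\},\{b,c\}}\delta_{\{b,c\},\{c\}}\upsilon_{\{c\},\{a,c\}}=\upsilon_{\{a,b\},S}\delta_{S,\{a,c\}}+q\,\delta_{\{a,b\},\{a\}}\upsilon_{\{a\},\{a,c\}}$, together with its image $\delta_{\{a,c\},\{c\}}\upsilon_{\{c\},\{b,c\}}\delta_{\{b,c\},\{b\}}\upsilon_{\{b\},\{a,b\}}=\upsilon_{\{a,c\},S}\delta_{S,\{a,b\}}+q\,\delta_{\{a,c\},\{a\}}\upsilon_{\{a\},\{a,b\}}$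 under the anti-involution that exchanges $\upsilon_{I,J}$ and $\delta_{J,I}$. Consequently $\Phi$ induces an isomorphism of $\mathbb Z[q]$-algebras from $\mathcal Q_q$ modulo these relations onto $E_q(\mathfrak S_4)$; that is, these relations give a presentation of $E_q(\mathfrak S_4)$ over $\mathbb Z[q]$. -/

import Mathlib

open Polynomial DirectSum

noncomputable section

/-! ## The path algebra of a quiver with finitely many vertices -/

namespace QuiverAlg

/-- All paths of a quiver. -/
abbrev Paths (V : Type) [Quiver.{0} V] : Type := Σ a b : V, Quiver.Path a b

/-- The path algebra `k V`: the free `k`-module on all paths. -/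
def PathAlg (k V : Type) [CommRing k] [Quiver.{0} V] : Type := Paths V →₀ k

variable {k V : Type} [CommRing k] [Quiver.{0} V]

instance : AddCommGroup (PathAlg k V) := inferInstanceAs (AddCommGroup (Paths V →₀ k))
instance : Module k (PathAlg k V) := inferInstanceAs (Module k (Paths V →₀ k))

/-- The basis element given by a path from `a` to `b`. -/
def ofPath {a b : V} (p : Quiver.Path a b) : PathAlg k V :=
  Finsupp.single (⟨a, b, p⟩ : Paths V) (1 : k)

open Classical in
/-- Product of two paths: `p q` is "first `q`, then `p`" when `p` starts where `q` ends,
and `0` otherwise. -/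
def pathMul (p q : Paths V) : PathAlg k V :=
  if h : q.2.1 = p.1 then ofPath (q.2.2.comp (p.2.2.cast h.symm rfl)) else 0

/-- The linear map with prescribed values on the basis of paths. -/
def liftLin {M : Type} [AddCommGroup M] [Module k M] (F : Paths V → M) : PathAlg k V →ₗ[k] M :=
  Finsupp.lift M k (Paths V) F

theorem liftLin_ofPath {M : Type} [AddCommGroup M] [Module k M] (F : Paths V → M) {a b : V}
    (p : Quiver.Path a b) : liftLin (k := k) F (ofPath p) = F ⟨a, b, p⟩ := by
  have : Finsupp.lift M k (Paths V) F (Finsupp.single (⟨a, b, p⟩ : Paths V) (1 : k)) =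
      F ⟨a, b, p⟩ := by
    rw [Finsupp.lift_apply, Finsupp.sum_single_index (by simp), one_smul]
  exact this

/-- The `k`-bilinear extension of the product of paths. -/
def mulHom : PathAlg k V →ₗ[k] PathAlg k V →ₗ[k] PathAlg k V :=
  liftLin fun p => liftLin fun q => pathMul p q

instance : Mul (PathAlg k V) := ⟨fun f g => mulHom f g⟩

/-- The unit is the sum of the trivial paths. -/
instance [Fintype V] : One (PathAlg k V) :=
  ⟨∑ v : V, ofPath (Quiver.Path.nil : Quiver.Path v v)⟩

theorem mul_def (f g : PathAlg k V) : f * g = mulHom f g := rfl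

theorem one_def [Fintype V] :
    (1 : PathAlg k V) = ∑ v : V, ofPath (Quiver.Path.nil : Quiver.Path v v) := rfl

theorem ofPath_mul_ofPath {a b c d : V} (p : Quiver.Path a b) (q : Quiver.Path c d) :
    (ofPath p * ofPath q : PathAlg k V) = pathMul ⟨a, b, p⟩ ⟨c, d, q⟩ := by
  rw [mul_def, mulHom, liftLin_ofPath, liftLin_ofPath]

theorem ofPath_mul_comp {a b c : V} (p : Quiver.Path b c) (q : Quiver.Path a b) :
    (ofPath p * ofPath q : PathAlg k V) = ofPath (q.comp p) := by
  rw [ofPath_mul_ofPath, pathMul]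
  simp

theorem ofPath_mul_ne {a b c d : V} (p : Quiver.Path a b) (q : Quiver.Path c d) (h : d ≠ a) :
    (ofPath p * ofPath q : PathAlg k V) = 0 := by
  rw [ofPath_mul_ofPath, pathMul]
  simp [h]

theorem induct {P : PathAlg k V → Prop} (f : PathAlg k V) (h0 : P 0)
    (hadd : ∀ f g, P f → P g → P (f + g))
    (hs : ∀ (c : k) (a b : V) (p : Quiver.Path a b), P (c • ofPath p)) : P f := by
  refine Finsupp.induction_linear (motive := P) f h0 hadd ?_
  rintro ⟨a, b, p⟩ c
  have h := hs c a b p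
  have e : c • (ofPath p : PathAlg k V) = Finsupp.single (⟨a, b, p⟩ : Paths V) c := by
    rw [ofPath]
    exact (Finsupp.smul_single c _ (1 : k)).trans (by simp)
  rwa [e] at h

theorem smul_mul' (c : k) (f g : PathAlg k V) : c • f * g = c • (f * g) := by
  simp [mul_def]

theorem mul_smul' (c : k) (f g : PathAlg k V) : f * c • g = c • (f * g) := by
  simp [mul_def]

theorem add_mul' (f g h : PathAlg k V) : (f + g) * h = f * h + g * h := by
  simp [mul_def]

theorem mul_add' (f g h : PathAlg k V) : f * (g + h) = f * g + f * h := by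
  simp [mul_def]

theorem zero_mul' (f : PathAlg k V) : 0 * f = 0 := by
  simp [mul_def]

theorem mul_zero' (f : PathAlg k V) : f * 0 = 0 := by
  simp [mul_def]

theorem mul_assoc' (f g h : PathAlg k V) : f * g * h = f * (g * h) := by
  refine induct (P := fun f => f * g * h = f * (g * h)) f ?_ ?_ ?_
  · simp only [zero_mul']
  · intro f₁ f₂ h₁ h₂
    simp only [add_mul', h₁, h₂]
  intro c a b p
  simp only [smul_mul']
  congr 1
  refine induct (P := fun g => ofPath p * g * h = ofPath p * (g * h)) g ?_ ?_ ?_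
  · simp only [zero_mul', mul_zero']
  · intro f₁ f₂ h₁ h₂
    simp only [add_mul', mul_add', h₁, h₂]
  intro c' a' b' p'
  simp only [smul_mul', mul_smul']
  congr 1
  refine induct (P := fun h => ofPath p * ofPath p' * h = ofPath p * (ofPath p' * h)) h ?_ ?_ ?_
  · simp only [mul_zero']
  · intro f₁ f₂ h₁ h₂
    simp only [mul_add', h₁, h₂]
  intro c'' a'' b'' p''
  simp only [mul_smul']
  congr 1
  by_cases h1 : b' = a
  · subst h1
    rw [ofPath_mul_comp]
    by_cases h2 : b'' = a'
    · subst h2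
      rw [ofPath_mul_comp, ofPath_mul_comp, ofPath_mul_comp, Quiver.Path.comp_assoc]
    · rw [ofPath_mul_ne _ _ h2, ofPath_mul_ne _ _ h2, mul_zero']
  · rw [ofPath_mul_ne _ _ h1, zero_mul']
    by_cases h2 : b'' = a'
    · subst h2
      rw [ofPath_mul_comp, ofPath_mul_ne _ _ h1]
    · rw [ofPath_mul_ne _ _ h2, mul_zero']

theorem one_mul' [Fintype V] (f : PathAlg k V) : 1 * f = f := by
  refine induct (P := fun f => 1 * f = f) f ?_ ?_ ?_
  · simp only [mul_zero']
  · intro f₁ f₂ h₁ h₂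
    simp only [mul_add', h₁, h₂]
  intro c a b p
  simp only [mul_smul']
  congr 1
  have : (1 * ofPath p : PathAlg k V) = ∑ v : V, ofPath (Quiver.Path.nil : Quiver.Path v v) * ofPath p := by
    rw [one_def, mul_def, map_sum, LinearMap.sum_apply]
    rfl
  rw [this, Finset.sum_eq_single b]
  · rw [ofPath_mul_comp]; rfl
  · intro v _ hv
    exact ofPath_mul_ne _ _ hv.symm
  · simp

theorem mul_one' [Fintype V] (f : PathAlg k V) : f * 1 = f := by
  refine induct (P := fun f => f * 1 = f) f ?_ ?_ ?_
  · simp only [zero_mul']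
  · intro f₁ f₂ h₁ h₂
    simp only [add_mul', h₁, h₂]
  intro c a b p
  simp only [smul_mul']
  congr 1
  have : (ofPath p * 1 : PathAlg k V) = ∑ v : V, ofPath p * ofPath (Quiver.Path.nil : Quiver.Path v v) := by
    rw [one_def, mul_def, map_sum]
    rfl
  rw [this, Finset.sum_eq_single a]
  · rw [ofPath_mul_comp, Quiver.Path.nil_comp]
  · intro v _ hv
    exact ofPath_mul_ne _ _ hv
  · simp

instance [Fintype V] : Ring (PathAlg k V) :=
  { (inferInstance : AddCommGroup (PathAlg k V)) with
    mul := (· * ·)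
    one := 1
    left_distrib := mul_add'
    right_distrib := add_mul'
    zero_mul := zero_mul'
    mul_zero := mul_zero'
    mul_assoc := mul_assoc'
    one_mul := one_mul'
    mul_one := mul_one' }

instance [Fintype V] : Algebra k (PathAlg k V) := Algebra.ofModule smul_mul' mul_smul'

end QuiverAlg

namespace HeckeS4

/-! ## The symmetric group `S₄` with its simple transpositions

The simple transpositions `s₁, s₂, s₃` are indexed by `0, 1, 2 : Fin 3`. -/

/-- The symmetric group on four letters. -/
abbrev W : Type := Equiv.Perm (Fin 4)

/-- The simple transposition interchanging `i` and `i + 1`. -/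
def simple (i : Fin 3) : W := Equiv.swap i.castSucc i.succ

/-- The product of the simple transpositions in a word. -/
def wordProd (l : List (Fin 3)) : W := (l.map simple).prod

/-- The Coxeter length: the least length of a word for `w`. -/
def len (w : W) : ℕ := sInf {n | ∃ l : List (Fin 3), l.length = n ∧ wordProd l = w}

theorem exists_word (w : W) : ∃ l : List (Fin 3), wordProd l = w := by
  have h : w ∈ Submonoid.closure (Set.range fun i : Fin 3 => (simple i : W)) := by
    have := Equiv.Perm.mclosure_swap_castSucc_succ 3
    simp only [simple]
    rw [this]
    trivial
  induction h using Submonoid.closure_induction with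
  | mem x hx =>
    obtain ⟨i, rfl⟩ := hx
    exact ⟨[i], by simp [wordProd]⟩
  | one => exact ⟨[], by simp [wordProd]⟩
  | mul x y _ _ hx hy =>
    obtain ⟨l, rfl⟩ := hx
    obtain ⟨m, rfl⟩ := hy
    exact ⟨l ++ m, by simp [wordProd]⟩

theorem exists_reduced (w : W) : ∃ l : List (Fin 3), l.length = len w ∧ wordProd l = w := by
  obtain ⟨l, hl⟩ := exists_word w
  exact Nat.sInf_mem (s := {n | ∃ l : List (Fin 3), l.length = n ∧ wordProd l = w})
    ⟨l.length, l, rfl, hl⟩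

/-- A fixed reduced word for `w`. -/
def redWord (w : W) : List (Fin 3) := (exists_reduced w).choose

/-- The parabolic subgroup `W_I` generated by the simple transpositions in `I`. -/
def parabolic (I : Finset (Fin 3)) : Subgroup W := Subgroup.closure (simple '' (I : Set (Fin 3)))

open Classical in
/-- The Poincaré polynomial `π(I) = ∑_{w ∈ W_I} q^{ℓ(w)}`. -/
def poincare (I : Finset (Fin 3)) : ℤ[X] :=
  ∑ w ∈ Finset.univ.filter (fun w : W => w ∈ parabolic I), X ^ len w

/-- The set `D_I` of shortest representatives of the right cosets `W_I d`. -/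
def shortestReps (I : Finset (Fin 3)) : Set W := {d | ∀ v ∈ parabolic I, len d ≤ len (v * d)}

/-! ## The Hecke algebra of `S₄` over `ℤ[q]`, and its endomorphism algebra -/

/-- The defining relations of the Hecke algebra: `T_s² = (q - 1) T_s + q` and the braid
relations. -/
inductive HeckeRel : FreeAlgebra ℤ[X] (Fin 3) → FreeAlgebra ℤ[X] (Fin 3) → Prop
  | quad (i : Fin 3) :
      HeckeRel (FreeAlgebra.ι ℤ[X] i * FreeAlgebra.ι ℤ[X] i)
        ((X - 1 : ℤ[X]) • FreeAlgebra.ι ℤ[X] i + algebraMap ℤ[X] _ X)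
  | comm :
      HeckeRel (FreeAlgebra.ι ℤ[X] 0 * FreeAlgebra.ι ℤ[X] 2)
        (FreeAlgebra.ι ℤ[X] 2 * FreeAlgebra.ι ℤ[X] 0)
  | braid₁ :
      HeckeRel (FreeAlgebra.ι ℤ[X] 0 * FreeAlgebra.ι ℤ[X] 1 * FreeAlgebra.ι ℤ[X] 0)
        (FreeAlgebra.ι ℤ[X] 1 * FreeAlgebra.ι ℤ[X] 0 * FreeAlgebra.ι ℤ[X] 1)
  | braid₂ :
      HeckeRel (FreeAlgebra.ι ℤ[X] 1 * FreeAlgebra.ι ℤ[X] 2 * FreeAlgebra.ι ℤ[X] 1)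
        (FreeAlgebra.ι ℤ[X] 2 * FreeAlgebra.ι ℤ[X] 1 * FreeAlgebra.ι ℤ[X] 2)

/-- The Hecke algebra `H_q` of `S₄` over `ℤ[q]`, where `q` is the variable `X`. -/
abbrev H : Type := RingQuot HeckeRel

/-- The generator `T_s` of the Hecke algebra. -/
def gen (i : Fin 3) : H := RingQuot.mkAlgHom ℤ[X] HeckeRel (FreeAlgebra.ι ℤ[X] i)

/-- The element `T_w`: the product of the generators along a reduced word of `w`. -/
def T (w : W) : H := ((redWord w).map gen).prod

open Classical in
/-- `x_I = ∑_{w ∈ W_I} T_w`. -/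
def x (I : Finset (Fin 3)) : H := ∑ w ∈ Finset.univ.filter (fun w : W => w ∈ parabolic I), T w

open Classical in
/-- `h_{J,I}`: the sum of the `T_w` with `w ∈ W_J` and `w⁻¹ ∈ D_I`. -/
def h (J I : Finset (Fin 3)) : H :=
  ∑ w ∈ Finset.univ.filter (fun w : W => w ∈ parabolic J ∧ w⁻¹ ∈ shortestReps I), T w

/-- The right `H_q`-module `x_I H_q`. -/
abbrev xH (I : Finset (Fin 3)) : Submodule Hᵐᵒᵖ H := Submodule.span Hᵐᵒᵖ {x I}

/-- The Hecke endomorphism algebra `E_q(S₄)`: the endomorphisms of the right `H_q`-module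
`⨁_I x_I H_q`, the sum being over all subsets `I` of the set of simple transpositions. -/
abbrev E : Type := Module.End Hᵐᵒᵖ (⨁ I : Finset (Fin 3), xH I)

/-! ## The Hasse quiver and its path algebra -/

/-- `I ⊏ J`: `I ⊂ J` and `|I| = |J| - 1`. -/
def Cov (I J : Finset (Fin 3)) : Prop := I ⊆ J ∧ J.card = I.card + 1

instance (I J : Finset (Fin 3)) : Decidable (Cov I J) :=
  inferInstanceAs (Decidable (I ⊆ J ∧ J.card = I.card + 1))

/-- The vertices of the Hasse quiver are the subsets of the set of simple transpositions. -/
structure Vertex : Type where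
  set : Finset (Fin 3)

def vertexEquiv : Finset (Fin 3) ≃ Vertex := ⟨Vertex.mk, Vertex.set, fun _ => rfl, fun _ => rfl⟩

instance : Fintype Vertex := Fintype.ofEquiv _ vertexEquiv

/-- The arrows of the Hasse quiver: for `I ⊏ J` one arrow `υ_{I,J}` from `J` to `I` and one
arrow `δ_{J,I}` from `I` to `J`. -/
inductive Arrow : Vertex → Vertex → Type
  | up {I J : Finset (Fin 3)} (hIJ : Cov I J) : Arrow ⟨J⟩ ⟨I⟩
  | de {I J : Finset (Fin 3)} (hIJ : Cov I J) : Arrow ⟨I⟩ ⟨J⟩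

instance : Quiver Vertex := ⟨Arrow⟩

/-- The path algebra of the Hasse quiver over `ℤ[q]`. -/
abbrev Qq : Type := QuiverAlg.PathAlg ℤ[X] Vertex

/-- The trivial path `e_I`. -/
def e (I : Finset (Fin 3)) : Qq := QuiverAlg.ofPath (Quiver.Path.nil : Quiver.Path (⟨I⟩ : Vertex) ⟨I⟩)

/-- The arrow `υ_{I,J}` from `J` to `I`, for `I ⊏ J` (not used for other pairs). -/
def υ (I J : Finset (Fin 3)) : Qq :=
  if hIJ : Cov I J then QuiverAlg.ofPath (Quiver.Hom.toPath (Arrow.up hIJ)) else 0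

/-- The arrow `δ_{J,I}` from `I` to `J`, for `I ⊏ J` (not used for other pairs). -/
def δ (J I : Finset (Fin 3)) : Qq :=
  if hIJ : Cov I J then QuiverAlg.ofPath (Quiver.Hom.toPath (Arrow.de hIJ)) else 0

/-- `χ_s = υ_{∅,{s}} δ_{{s},∅}`. -/
def χ (s : Fin 3) : Qq := υ ∅ {s} * δ {s} ∅

/-- The set `S` of all simple transpositions. -/
abbrev S : Finset (Fin 3) := Finset.univ

/-- `(a, b, c)` lists the nodes of the Dynkin diagram from one end to the other, i.e. it is
`(1, 2, 3)` or its image `(3, 2, 1)` under the graph automorphism. -/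
def IsLabelling (a b c : Fin 3) : Prop := (a = 0 ∧ b = 1 ∧ c = 2) ∨ (a = 2 ∧ b = 1 ∧ c = 0)

/-- The elements "left-hand side minus right-hand side" of the relations. Each torsion relation
stands for all of its images under the (sub)graph automorphisms and the anti-involution
exchanging `υ_{I,J}` and `δ_{J,I}`: there are four relations (T1), two relations (T2), two
relations (T3) and four relations (T4). -/
inductive Rel : Qq → Prop
  | quasiIdempotent (I J : Finset (Fin 3)) (hIJ : Cov I J) :
      Rel (δ J I * υ I J - (poincare J /ₘ poincare I) • e J)
  | sandwich_υ (I J J' K : Finset (Fin 3)) (h₁ : Cov I J) (h₂ : Cov J K)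
      (h₃ : Cov I J') (h₄ : Cov J' K) :
      Rel (υ I J * υ J K - υ I J' * υ J' K)
  | sandwich_δ (I J J' K : Finset (Fin 3)) (h₁ : Cov I J) (h₂ : Cov J K)
      (h₃ : Cov I J') (h₄ : Cov J' K) :
      Rel (δ K J * δ J I - δ K J' * δ J' I)
  /-- (T1) for `(s, t)` an ordered pair of adjacent nodes; invariant under the anti-involution. -/
  | T1 (s t : Fin 3) (hst : (s = 1 ∧ t ≠ 1) ∨ (s ≠ 1 ∧ t = 1)) :
      Rel (δ {s} ∅ * χ t * υ ∅ {s} - (υ {s} {s, t} * δ {s, t} {s} + (X : ℤ[X]) • e {s}))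
  /-- (T2); the anti-involution and the graph automorphism both interchange its two cases. -/
  | T2 (a b c : Fin 3) (habc : IsLabelling a b c) :
      Rel (δ {a} ∅ * υ ∅ {c} - υ {a} {a, c} * δ {a, c} {c})
  /-- (T3); invariant under the anti-involution. -/
  | T3 (a b c : Fin 3) (habc : IsLabelling a b c) :
      Rel (δ {a, b} {a} * υ {a} {a, c} * δ {a, c} {a} * υ {a} {a, b} -
        (υ {a, b} S * δ S {a, b} + (X * (X + 1) : ℤ[X]) • e {a, b}))
  /-- (T4) and its image under the graph automorphism. -/
  | T4 (a b c : Fin 3) (habc : IsLabelling a b c) :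
      Rel (δ {a, b} {b} * υ {b} {b, c} * δ {b, c} {c} * υ {c} {a, c} -
        (υ {a, b} S * δ S {a, c} + (X : ℤ[X]) • (δ {a, b} {a} * υ {a} {a, c})))
  /-- The images of (T4) under the anti-involution. -/
  | T4τ (a b c : Fin 3) (habc : IsLabelling a b c) :
      Rel (δ {a, c} {c} * υ {c} {b, c} * δ {b, c} {b} * υ {b} {a, b} -
        (υ {a, c} S * δ S {a, b} + (X : ℤ[X]) • (δ {a, c} {a} * υ {a} {a, b})))

/-- `Φ` is the canonical homomorphism `ℤ[q]𝒬 → E_q`: it sends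
* `e_K` to the identity map of `x_K H_q`,
* `υ_{I,J}` to the inclusion `x_J H_q → x_I H_q`,
* `δ_{J,I}` to the map `x_I H_q → x_J H_q` given by left multiplication with `h_{J,I}`,

each of these maps being extended by zero to the other summands. -/
structure IsCanonical (Φ : Qq →ₐ[ℤ[X]] E) : Prop where
  map_e : ∀ (K : Finset (Fin 3)) (z : ⨁ I : Finset (Fin 3), xH I) (L : Finset (Fin 3)),
    ((Φ (e K) z) L : H) = if L = K then (z K : H) else 0
  map_υ : ∀ (I J : Finset (Fin 3)), Cov I J → ∀ (z : ⨁ I : Finset (Fin 3), xH I)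
    (L : Finset (Fin 3)), ((Φ (υ I J) z) L : H) = if L = I then (z J : H) else 0
  map_δ : ∀ (I J : Finset (Fin 3)), Cov I J → ∀ (z : ⨁ I : Finset (Fin 3), xH I)
    (L : Finset (Fin 3)), ((Φ (δ J I) z) L : H) = if L = J then h J I * (z I : H) else 0

end HeckeS4

end

/-! Since the x_J generate the summands, an endomorphism of ⨁ x_I H is determined by the images of
the x_J (`E_ext_gener`). Its component at (I, J) is an element z of H with T_s z = q z for s ∈ I and
z T_s = q z for s ∈ J (`mem_xH_iff`, `rinv_apply_gener`). The relations hold for endomorphisms by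
direct computation (`torsion₁` to `torsion₄'`), so the presented algebra B has evaluation maps `ev I
J` from e_I B e_J to these spaces of two-sided invariants. The theorem amounts to their bijectivity
for all I and J (`Realization.bij`).

The comparison is split along the ideal B e_∅ B. By (T1), (T2) and the sandwich relations, the
elements χ_s − e_∅ satisfy the Hecke relations in the corner at ∅, which yields `theta` from H to B.
The torsion relations allow paths starting at ∅ to be rewritten so that e_I B e_∅ = D_I θ(H)
(`e_mul_mul_e_empty`). Hence e_I B e_∅ B e_J is the image of h ↦ D_I θ(h) U_J, and `ev` sends D_I
θ(h) U_J to x_I h x_J (`ev_cell`). A linear map on H that is q-equivariant on both sides kills every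
h with x_I h x_J = 0 (`map_eq_zero_of_x_mul_x`), so `ev` is injective on the ideal.

Modulo the ideal, 1 + q kills e_{s} and the relations collapse: certain components are spanned by
two elements y₁, y₂ (`e_mul_mul_e_single`, `e_mul_mul_e_compl_one`, `e_mul_mul_e_compl`). In these
components at most two double cosets W_I w W_J are not free. There the coordinates of x_I h x_J are
divisible by a Poincaré polynomial (`poincare_dvd_coord`), and the same multiple of y_i lies in the
ideal; invariants that vanish on these double cosets have the form x_I h x_J (`eq_x_mul_x`).
`bij_of_two` combines the two sides.

Components with I or J equal to ∅ or S are handled directly. Most others follow from the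
quasi-idempotent relations, which carry bijectivity from one component to another up to a factor 1 +
q or 1 + q + q². These factors are coprime (`Bij.of_coprime`), and (T1) gives a further passage
between singletons (`Bij.transfer`). The structure `HasseAlg` isolates the relations so that the
same arguments apply to B, to its opposite (exchanging rows and columns) and to its quotient by the
ideal of ∅. -/

noncomputable section
namespace HeckeS4

/-! ## Combinatorics of the symmetric group -/

/-- The number of inversions of a permutation. -/
def invs (w : W) : ℕ :=
  (if w 1 < w 0 then 1 else 0) + (if w 2 < w 0 then 1 else 0) + (if w 3 < w 0 then 1 else 0) +
  (if w 2 < w 1 then 1 else 0) + (if w 3 < w 1 then 1 else 0) + (if w 3 < w 2 then 1 else 0)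

theorem invs_one : invs 1 = 0 := by decide

theorem invs_inv : ∀ w : W, invs w⁻¹ = invs w := by decide +kernel

theorem invs_simple_mul : ∀ (i : Fin 3) (w : W),
    invs (simple i * w) = invs w + 1 ∨ invs w = invs (simple i * w) + 1 := by decide +kernel

theorem exists_descent : ∀ w : W, w ≠ 1 → ∃ i, invs (simple i * w) < invs w := by decide +kernel

theorem simple_mul_self (i : Fin 3) : simple i * simple i = 1 := Equiv.swap_mul_self _ _

theorem simple_inv (i : Fin 3) : (simple i)⁻¹ = simple i := Equiv.swap_inv _ _

theorem simple_mul_cancel (i : Fin 3) (w : W) : simple i * (simple i * w) = w := by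
  rw [← mul_assoc, simple_mul_self, one_mul]

/-- The exchange condition. It is needed for the minimal representatives of double cosets to be well
defined, in `mrep_mul_simple`. -/
theorem exchange : ∀ (w : W) (s t : Fin 3), invs w < invs (simple s * w) →
    invs (simple s * (w * simple t)) < invs (w * simple t) → simple s * w = w * simple t := by
  decide +kernel

theorem simple_comm : simple 0 * simple 2 = simple 2 * simple 0 := by decide
theorem simple_braid₁ : simple 0 * simple 1 * simple 0 = simple 1 * simple 0 * simple 1 := by decide
theorem simple_braid₂ : simple 1 * simple 2 * simple 1 = simple 2 * simple 1 * simple 2 := by decide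

/-- `v` preserves the initial segments that correspond to the nodes outside `I`. -/
def InPar (I : Finset (Fin 3)) (w : W) : Prop :=
  ∀ i : Fin 3, i ∉ I → ∀ k : Fin 4, k ≤ i.castSucc → w k ≤ i.castSucc

instance (I : Finset (Fin 3)) (w : W) : Decidable (InPar I w) :=
  inferInstanceAs (Decidable (∀ i : Fin 3, i ∉ I → ∀ k : Fin 4, k ≤ i.castSucc → w k ≤ i.castSucc))

theorem inPar_descent : ∀ (I : Finset (Fin 3)) (w : W), InPar I w → w ≠ 1 →
    ∃ i ∈ I, invs (simple i * w) < invs w ∧ InPar I (simple i * w) := by decide +kernel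

theorem inPar_simple : ∀ (I : Finset (Fin 3)) (i : Fin 3), i ∈ I → InPar I (simple i) := by
  decide +kernel

theorem invs_mul_of_min : ∀ (I : Finset (Fin 3)) (d : W), (∀ i ∈ I, invs d < invs (simple i * d)) →
    ∀ v : W, InPar I v → invs (v * d) = invs v + invs d := by decide +kernel

/-- If two nodes are left descents of w, the longest element of the parabolic subgroup they generate
splits off from w on the left; its length is 2 here and 3 in `two_descents_braid`. This feeds the
induction for Matsumoto's theorem in `genProd_eq_of_reduced`. -/
theorem two_descents_comm : ∀ w : W, invs (simple 0 * w) < invs w → invs (simple 2 * w) < invs w →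
    invs (simple 0 * (simple 2 * w)) + 2 = invs w := by decide +kernel

theorem two_descents_braid : ∀ (i : Fin 3) (w : W), i ≠ 1 → invs (simple i * w) < invs w →
    invs (simple 1 * w) < invs w →
    invs (simple i * (simple 1 * (simple i * w))) + 3 = invs w := by
  decide +kernel

/-! ### The length function, parabolic subgroups and shortest representatives -/

theorem wordProd_cons (i : Fin 3) (l : List (Fin 3)) : wordProd (i :: l) = simple i * wordProd l := by
  simp [wordProd]

theorem exists_word_invs (w : W) : ∃ l : List (Fin 3), l.length = invs w ∧ wordProd l = w := by
  induction h : invs w using Nat.strong_induction_on generalizing w with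
  | _ n ih =>
    by_cases hw : w = 1
    · subst hw
      exact ⟨[], by rw [← h, invs_one]; rfl, rfl⟩
    · obtain ⟨i, hi⟩ := exists_descent w hw
      obtain ⟨l, hl, hl'⟩ := ih _ (h ▸ hi) _ rfl
      refine ⟨i :: l, ?_, ?_⟩
      · have := invs_simple_mul i w
        rw [List.length_cons, hl]
        omega
      · rw [wordProd_cons, hl', simple_mul_cancel]

theorem invs_wordProd_le (l : List (Fin 3)) : invs (wordProd l) ≤ l.length := by
  induction l with
  | nil => exact invs_one.le
  | cons i l ih =>
    have := invs_simple_mul i (wordProd l)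
    rw [wordProd_cons, List.length_cons]
    omega

theorem invs_mul_le (u w : W) : invs (u * w) ≤ invs u + invs w := by
  obtain ⟨l, hl, rfl⟩ := exists_word_invs u
  obtain ⟨m, hm, rfl⟩ := exists_word_invs w
  have := invs_wordProd_le (l ++ m)
  rwa [wordProd, List.map_append, List.prod_append, List.length_append, hl, hm] at this

theorem len_eq (w : W) : len w = invs w := by
  apply le_antisymm
  · obtain ⟨l, hl, hw⟩ := exists_word_invs w
    exact Nat.sInf_le ⟨l, hl, hw⟩
  · obtain ⟨l, hl, hw⟩ := exists_reduced w
    rw [← hl]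
    conv_lhs => rw [← hw]
    exact invs_wordProd_le l

/-- Parabolic subgroups of S₄ are Young subgroups, that is, stabilizers of initial segments. For the
converse, descents in I are stripped from w until 1 is reached. The decidable form opens later coset
statements to finite checking. -/
theorem mem_parabolic_iff (I : Finset (Fin 3)) (w : W) : w ∈ parabolic I ↔ InPar I w := by
  constructor
  · intro h
    induction h using Subgroup.closure_induction'' with
    | mem x hx =>
      obtain ⟨i, hi, rfl⟩ := hx
      exact inPar_simple I i hi
    | inv_mem x hx =>
      obtain ⟨i, hi, rfl⟩ := hx
      rw [simple_inv]
      exact inPar_simple I i hi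
    | one => exact fun i _ k hk => hk
    | mul x y _ _ hx hy => exact fun i hi k hk => hx i hi _ (hy i hi k hk)
  · intro h
    induction hn : invs w using Nat.strong_induction_on generalizing w with
    | _ n ih =>
      by_cases hw : w = 1
      · exact hw ▸ one_mem _
      · obtain ⟨i, hi, hlt, hp⟩ := inPar_descent I w h hw
        have := mul_mem (Subgroup.subset_closure ⟨i, hi, rfl⟩ : simple i ∈ parabolic I)
          (ih _ (hn ▸ hlt) _ hp rfl)
        rwa [simple_mul_cancel] at this

theorem simple_mem_parabolic {I : Finset (Fin 3)} {i : Fin 3} (hi : i ∈ I) :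
    simple i ∈ parabolic I := Subgroup.subset_closure ⟨i, hi, rfl⟩

/-- `d` is of minimal length in `W_I d`. -/
def LMin (I : Finset (Fin 3)) (d : W) : Prop := ∀ i ∈ I, invs d < invs (simple i * d)

instance (I : Finset (Fin 3)) (d : W) : Decidable (LMin I d) :=
  inferInstanceAs (Decidable (∀ i ∈ I, invs d < invs (simple i * d)))

theorem LMin.invs_mul {I : Finset (Fin 3)} {d v : W} (hd : LMin I d) (hv : v ∈ parabolic I) :
    invs (v * d) = invs v + invs d :=
  invs_mul_of_min I d hd v ((mem_parabolic_iff I v).1 hv)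

theorem invs_eq_zero {w : W} (h : invs w = 0) : w = 1 := by
  by_contra hw
  obtain ⟨i, hi⟩ := exists_descent w hw
  omega

theorem mem_shortestReps_iff (I : Finset (Fin 3)) (d : W) : d ∈ shortestReps I ↔ LMin I d := by
  constructor
  · intro h i hi
    have h1 := h _ (simple_mem_parabolic hi)
    rw [len_eq, len_eq] at h1
    have := invs_simple_mul i d
    omega
  · intro h v hv
    rw [len_eq, len_eq, h.invs_mul hv]
    omega

/-- Lengths add both in v · d and in v⁻¹ · (v d), which forces ℓ(v) = 0. -/
theorem LMin.unique {I : Finset (Fin 3)} {d v : W} (hd : LMin I d) (hv : v ∈ parabolic I)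
    (hvd : LMin I (v * d)) : v = 1 := by
  have h1 := hd.invs_mul hv
  have h2 := hvd.invs_mul (inv_mem hv)
  rw [inv_mul_cancel_left] at h2
  exact invs_eq_zero (by omega)

/-- Descending to a minimal representative. -/
theorem exists_lMin (I : Finset (Fin 3)) (w : W) : ∃ v ∈ parabolic I, LMin I (v * w) := by
  induction hn : invs w using Nat.strong_induction_on generalizing w with
  | _ n ih =>
    by_cases hw : LMin I w
    · exact ⟨1, one_mem _, by rwa [one_mul]⟩
    · simp only [LMin, not_forall, not_lt] at hw
      obtain ⟨i, hi, hle⟩ := hw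
      have := invs_simple_mul i w
      obtain ⟨v, hv, hvw⟩ := ih _ (by omega) (simple i * w) rfl
      exact ⟨v * simple i, mul_mem hv (simple_mem_parabolic hi), by rwa [mul_assoc]⟩

/-- The minimal representative of `W_I w`. -/
def lrep (I : Finset (Fin 3)) (w : W) : W := (exists_lMin I w).choose * w

theorem lrep_min (I : Finset (Fin 3)) (w : W) : LMin I (lrep I w) := (exists_lMin I w).choose_spec.2

theorem lrep_spec (I : Finset (Fin 3)) (w : W) : ∃ v ∈ parabolic I, lrep I w = v * w :=
  ⟨_, (exists_lMin I w).choose_spec.1, rfl⟩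

theorem LMin.eq_of_coset {I : Finset (Fin 3)} {d d' v : W} (hd : LMin I d) (hd' : LMin I d')
    (hv : v ∈ parabolic I) (h : d' = v * d) : d' = d := by
  subst h
  rw [hd.unique hv hd', one_mul]

theorem lrep_mul {I : Finset (Fin 3)} {v : W} (hv : v ∈ parabolic I) (w : W) :
    lrep I (v * w) = lrep I w := by
  obtain ⟨a, ha, h1⟩ := lrep_spec I (v * w)
  obtain ⟨b, hb, h2⟩ := lrep_spec I w
  refine (lrep_min I w).eq_of_coset (lrep_min I (v * w))
    (mul_mem (mul_mem ha hv) (inv_mem hb)) ?_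
  rw [h1, h2]
  group

theorem LMin.lrep_eq {I : Finset (Fin 3)} {d : W} (hd : LMin I d) : lrep I d = d := by
  obtain ⟨v, hv, h⟩ := lrep_spec I d
  exact hd.eq_of_coset (lrep_min I d) hv h

/-- The minimal representative of `w W_J`. -/
def rrep (J : Finset (Fin 3)) (w : W) : W := (lrep J w⁻¹)⁻¹

theorem rrep_mul {J : Finset (Fin 3)} {v : W} (hv : v ∈ parabolic J) (w : W) :
    rrep J (w * v) = rrep J w := by
  rw [rrep, mul_inv_rev, lrep_mul (inv_mem hv), rrep]

/-- The minimal representative of `W_I w W_J`. -/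
def mrep (I J : Finset (Fin 3)) (w : W) : W := rrep J (lrep I w)

theorem mrep_simple_mul {I J : Finset (Fin 3)} {i : Fin 3} (hi : i ∈ I) (w : W) :
    mrep I J (simple i * w) = mrep I J w := by
  rw [mrep, lrep_mul (simple_mem_parabolic hi), mrep]

/-- Let d be minimal in W_I w. Either d s_j is again minimal in its coset, and it has the same
W_J-coset as d, or the exchange condition gives d s_j = s_i d with i ∈ I, which does not change W_I
d. -/
theorem mrep_mul_simple {I J : Finset (Fin 3)} {j : Fin 3} (hj : j ∈ J) (w : W) :
    mrep I J (w * simple j) = mrep I J w := by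
  obtain ⟨v, hv, h⟩ := lrep_spec I w
  have e : lrep I (w * simple j) = lrep I (lrep I w * simple j) := by
    rw [h, mul_assoc, lrep_mul hv]
  rw [mrep, e, mrep]
  have hm := lrep_min I w
  generalize lrep I w = d at hm
  by_cases hd : LMin I (d * simple j)
  · rw [hd.lrep_eq, rrep_mul (simple_mem_parabolic hj)]
  · simp only [LMin, not_forall, not_lt] at hd
    obtain ⟨i, hi, hle⟩ := hd
    have h1 := invs_simple_mul i (d * simple j)
    have h2 := exchange d i j (hm i hi) (by omega)
    rw [← h2, lrep_mul (simple_mem_parabolic hi), hm.lrep_eq]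

end HeckeS4
end

noncomputable section
namespace HeckeS4

/-! ## The standard basis of the Hecke algebra -/

theorem gen_sq (i : Fin 3) : gen i * gen i = (X - 1 : ℤ[X]) • gen i + (X : ℤ[X]) • (1 : H) := by
  have := RingQuot.mkAlgHom_rel ℤ[X] (HeckeRel.quad i)
  rw [map_mul, map_add, map_smul, AlgHom.commutes, Algebra.algebraMap_eq_smul_one] at this
  exact this

theorem gen_comm : gen 0 * gen 2 = gen 2 * gen 0 := by
  have := RingQuot.mkAlgHom_rel ℤ[X] HeckeRel.comm
  simp only [map_mul] at this
  exact this

theorem gen_braid₁ : gen 0 * gen 1 * gen 0 = gen 1 * gen 0 * gen 1 := by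
  have := RingQuot.mkAlgHom_rel ℤ[X] HeckeRel.braid₁
  simp only [map_mul] at this
  exact this

theorem gen_braid₂ : gen 1 * gen 2 * gen 1 = gen 2 * gen 1 * gen 2 := by
  have := RingQuot.mkAlgHom_rel ℤ[X] HeckeRel.braid₂
  simp only [map_mul] at this
  exact this

/-- The universal property of the Hecke algebra. -/
def Hlift {A : Type} [Ring A] [Algebra ℤ[X] A] (t : Fin 3 → A)
    (hq : ∀ i, t i * t i = (X - 1 : ℤ[X]) • t i + (X : ℤ[X]) • (1 : A))
    (hc : t 0 * t 2 = t 2 * t 0) (h1 : t 0 * t 1 * t 0 = t 1 * t 0 * t 1)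
    (h2 : t 1 * t 2 * t 1 = t 2 * t 1 * t 2) : H →ₐ[ℤ[X]] A :=
  RingQuot.liftAlgHom ℤ[X] ⟨FreeAlgebra.lift ℤ[X] t, by
    intro x y hxy
    cases hxy with
    | quad i => simp [hq, Algebra.algebraMap_eq_smul_one]
    | comm => simpa using hc
    | braid₁ => simpa using h1
    | braid₂ => simpa using h2⟩

theorem Hlift_gen {A : Type} [Ring A] [Algebra ℤ[X] A] (t : Fin 3 → A) (hq hc h1 h2) (i : Fin 3) :
    Hlift t hq hc h1 h2 (gen i) = t i := by
  rw [Hlift, gen, RingQuot.liftAlgHom_mkAlgHom_apply, FreeAlgebra.lift_ι_apply]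

theorem H_adjoin : Algebra.adjoin ℤ[X] (Set.range gen) = ⊤ := by
  have h := FreeAlgebra.adjoin_range_ι (R := ℤ[X]) (X := Fin 3)
  have h2 := congrArg (Subalgebra.map (RingQuot.mkAlgHom ℤ[X] HeckeRel)) h
  rw [AlgHom.map_adjoin, ← Set.range_comp, Algebra.map_top,
    (AlgHom.range_eq_top _).2 (RingQuot.mkAlgHom_surjective ℤ[X] HeckeRel)] at h2
  exact h2

theorem H_induction {P : H → Prop} (h : H) (hone : P 1) (hadd : ∀ a b, P a → P b → P (a + b))
    (hsmul : ∀ (c : ℤ[X]) a, P a → P (c • a)) (hgen : ∀ i a, P a → P (gen i * a)) : P h := by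
  let Q : Submodule ℤ[X] H :=
    { carrier := {a | P a}
      add_mem' := fun ha hb => hadd _ _ ha hb
      zero_mem' := by simpa using hsmul 0 1 hone
      smul_mem' := fun c a ha => hsmul c a ha }
  have key : ∀ a ∈ Algebra.adjoin ℤ[X] (Set.range gen), ∀ b, P b → P (a * b) := by
    intro a ha
    induction ha using Algebra.adjoin_induction with
    | mem x hx =>
      obtain ⟨i, rfl⟩ := hx
      exact hgen i
    | algebraMap r =>
      intro b hb
      rw [Algebra.algebraMap_eq_smul_one, smul_mul_assoc, one_mul]
      exact hsmul r b hb
    | add x y _ _ hx hy =>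
      intro b hb
      rw [add_mul]
      exact hadd _ _ (hx b hb) (hy b hb)
    | mul x y _ _ hx hy =>
      intro b hb
      rw [mul_assoc]
      exact hx _ (hy b hb)
  have := key h (by rw [H_adjoin]; trivial) 1 hone
  rwa [mul_one] at this

/-- The product of the generators along a word. -/
def genProd (l : List (Fin 3)) : H := (l.map gen).prod

theorem genProd_cons (i : Fin 3) (l : List (Fin 3)) : genProd (i :: l) = gen i * genProd l := by
  simp [genProd]

/-- Two reduced words of the same permutation give the same product of generators. -/
theorem genProd_eq_of_reduced (l l' : List (Fin 3)) (h : wordProd l = wordProd l')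
    (hl : l.length = invs (wordProd l)) (hl' : l'.length = invs (wordProd l')) :
    genProd l = genProd l' := by
  induction hn : l.length using Nat.strong_induction_on generalizing l l' with
  | _ n ih =>
    match l, l' with
    | [], [] => rfl
    | [], j :: l' => rw [← h, ← hl] at hl'; simp at hl'
    | i :: l, [] => rw [h, ← hl'] at hl; simp at hl
    | i :: l, j :: l' =>
      rw [List.length_cons] at hn hl hl'
      have e1 : wordProd l = simple i * wordProd (i :: l) := by
        rw [wordProd_cons, simple_mul_cancel]
      have e2 : wordProd l' = simple j * wordProd (i :: l) := by
        rw [h, wordProd_cons, simple_mul_cancel]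
      rw [← h] at hl'
      have b1 := invs_wordProd_le l
      have b2 := invs_wordProd_le l'
      rw [e1] at b1
      rw [e2] at b2
      have c1 := invs_simple_mul i (wordProd (i :: l))
      have c2 := invs_simple_mul j (wordProd (i :: l))
      set w := wordProd (i :: l) with hw
      have ll : l.length = invs (wordProd l) := by rw [e1]; omega
      have ll' : l'.length = invs (wordProd l') := by rw [e2]; omega
      rw [genProd_cons, genProd_cons]
      -- Matsumoto's argument: distinct initial letters i and j are both descents of w, so w also
      -- has a reduced word beginning with the longest element of ⟨s_i, s_j⟩. Both tails can be
      -- replaced by induction, and the relation between T_i and T_j closes the gap.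
      have comm : ∀ (i j : Fin 3) (l l' : List (Fin 3)), l.length + 1 = n → l'.length + 1 = n →
          l.length = invs (wordProd l) → l'.length = invs (wordProd l') →
          wordProd l = simple i * w → wordProd l' = simple j * w →
          simple i * simple j = simple j * simple i → gen i * gen j = gen j * gen i →
          invs (simple i * (simple j * w)) + 2 = invs w → n = invs w →
          gen i * genProd l = gen j * genProd l' := by
        intro i j l l' hl hl' rl rl' el el' hs hg hd hnw
        obtain ⟨m, hm, hm'⟩ := exists_word_invs (simple i * (simple j * w))
        have r1 : genProd l = genProd (j :: m) := by
          have em : wordProd (j :: m) = simple i * w := by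
            rw [wordProd_cons, hm', ← mul_assoc (simple i), hs, mul_assoc, simple_mul_cancel]
          have e : wordProd l = wordProd (j :: m) := by rw [em, el]
          refine ih _ (by omega) l (j :: m) e rl ?_ rfl
          rw [← e, ← rl, List.length_cons]
          omega
        have r2 : genProd l' = genProd (i :: m) := by
          have em : wordProd (i :: m) = simple j * w := by
            rw [wordProd_cons, hm', simple_mul_cancel]
          have e : wordProd l' = wordProd (i :: m) := by rw [em, el']
          refine ih _ (by omega) l' (i :: m) e rl' ?_ rfl
          rw [← e, ← rl', List.length_cons]
          omega
        rw [r1, r2, genProd_cons, genProd_cons, ← mul_assoc, ← mul_assoc, hg]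
      have braid : ∀ (i j : Fin 3) (l l' : List (Fin 3)), l.length + 1 = n → l'.length + 1 = n →
          l.length = invs (wordProd l) → l'.length = invs (wordProd l') →
          wordProd l = simple i * w → wordProd l' = simple j * w →
          simple i * simple j * simple i = simple j * simple i * simple j →
          gen i * gen j * gen i = gen j * gen i * gen j →
          invs (simple i * (simple j * (simple i * w))) + 3 = invs w → n = invs w →
          gen i * genProd l = gen j * genProd l' := by
        intro i j l l' hl hl' rl rl' el el' hs hg hd hnw
        obtain ⟨m, hm, hm'⟩ := exists_word_invs (simple i * (simple j * (simple i * w)))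
        have r1 : genProd l = genProd (j :: i :: m) := by
          have em : wordProd (j :: i :: m) = simple i * w := by
            rw [wordProd_cons, wordProd_cons, hm', simple_mul_cancel, simple_mul_cancel]
          have e : wordProd l = wordProd (j :: i :: m) := by rw [em, el]
          refine ih _ (by omega) l (j :: i :: m) e rl ?_ rfl
          rw [← e, ← rl, List.length_cons, List.length_cons]
          omega
        have r2 : genProd l' = genProd (i :: j :: m) := by
          have em : wordProd (i :: j :: m) = simple j * w := by
            rw [wordProd_cons, wordProd_cons, hm']
            have : simple i * (simple j * (simple i * w)) = simple j * (simple i * (simple j * w)) := by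
              rw [← mul_assoc, ← mul_assoc, hs]
              simp only [mul_assoc]
            rw [this, simple_mul_cancel, simple_mul_cancel]
          have e : wordProd l' = wordProd (i :: j :: m) := by rw [em, el']
          refine ih _ (by omega) l' (i :: j :: m) e rl' ?_ rfl
          rw [← e, ← rl', List.length_cons, List.length_cons]
          omega
        rw [r1, r2]
        simp only [genProd_cons, ← mul_assoc, hg]
      by_cases hij : i = j
      · subst hij
        rw [ih _ (by omega) l l' (by rw [e1, e2]) ll ll' rfl]
      have d1 : invs (simple i * w) < invs w := by omega
      have d2 : invs (simple j * w) < invs w := by omega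
      have n1 : l.length + 1 = n := hn
      have n2 : l'.length + 1 = n := by omega
      have n3 : n = invs w := by omega
      clear_value w
      clear hl hl' h b1 b2 c1 c2 ih hn
      by_cases hi : i = 1
      · subst hi
        have hb := two_descents_braid j w (Ne.symm hij) d2 d1
        symm
        refine braid _ _ l' l n2 n1 ll' ll e2 e1 ?_ ?_ hb n3
        · fin_cases j
          · exact simple_braid₁
          · exact absurd rfl hij
          · exact simple_braid₂.symm
        · fin_cases j
          · exact gen_braid₁
          · exact absurd rfl hij
          · exact gen_braid₂.symm
      by_cases hj : j = 1
      · subst hj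
        have hb := two_descents_braid i w hij d1 d2
        refine braid _ _ l l' n1 n2 ll ll' e1 e2 ?_ ?_ hb n3
        · fin_cases i
          · exact simple_braid₁
          · exact absurd rfl hij
          · exact simple_braid₂.symm
        · fin_cases i
          · exact gen_braid₁
          · exact absurd rfl hij
          · exact gen_braid₂.symm
      have h02 : (i = 0 ∧ j = 2) ∨ (i = 2 ∧ j = 0) := by
        clear e1 e2 d1 d2 hw
        revert i j; decide
      rcases h02 with ⟨rfl, rfl⟩ | ⟨rfl, rfl⟩
      · exact comm 0 2 l l' n1 n2 ll ll' e1 e2 simple_comm gen_comm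
          (two_descents_comm w d1 d2) n3
      · exact (comm 0 2 l' l n2 n1 ll' ll e2 e1 simple_comm gen_comm
          (two_descents_comm w d2 d1) n3).symm

theorem redWord_length (w : W) : (redWord w).length = invs w := by
  rw [← len_eq]
  exact (exists_reduced w).choose_spec.1

theorem wordProd_redWord (w : W) : wordProd (redWord w) = w := (exists_reduced w).choose_spec.2

theorem T_eq_genProd (l : List (Fin 3)) (h : l.length = invs (wordProd l)) :
    T (wordProd l) = genProd l :=
  genProd_eq_of_reduced _ _ (wordProd_redWord _)
    (by rw [redWord_length, wordProd_redWord]) h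

theorem T_one : T 1 = 1 := T_eq_genProd [] invs_one.symm

theorem T_simple_mul {i : Fin 3} {w : W} (h : invs w < invs (simple i * w)) :
    T (simple i * w) = gen i * T w := by
  have e : wordProd (i :: redWord w) = simple i * w := by rw [wordProd_cons, wordProd_redWord]
  have := invs_simple_mul i w
  rw [← e, T_eq_genProd, genProd_cons]
  · rfl
  · rw [e, List.length_cons, redWord_length]
    omega

theorem gen_mul_T_desc {i : Fin 3} {w : W} (h : invs (simple i * w) < invs w) :
    gen i * T w = (X - 1 : ℤ[X]) • T w + (X : ℤ[X]) • T (simple i * w) := by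
  have e : T w = gen i * T (simple i * w) := by
    rw [← T_simple_mul (by rwa [simple_mul_cancel]), simple_mul_cancel]
  rw [e, ← mul_assoc, gen_sq, add_mul, smul_mul_assoc, smul_mul_assoc, one_mul, ← e]

/-- Left multiplication by `T_i` in coordinates. -/
def Lop (i : Fin 3) : Module.End ℤ[X] (W → ℤ[X]) where
  toFun f w := if invs (simple i * w) < invs w then f (simple i * w) + (X - 1) * f w
    else X * f (simple i * w)
  map_add' f g := by
    ext1 w
    dsimp only [Pi.add_apply]
    split_ifs <;> ring
  map_smul' c f := by
    ext1 w
    dsimp only [Pi.smul_apply, smul_eq_mul, RingHom.id_apply]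
    split_ifs <;> ring

theorem Lop_apply (i : Fin 3) (f : W → ℤ[X]) (w : W) : Lop i f w =
    if invs (simple i * w) < invs w then f (simple i * w) + (X - 1) * f w
    else X * f (simple i * w) := rfl

theorem Lop_desc {i : Fin 3} {w : W} (h : invs (simple i * w) < invs w) (f : W → ℤ[X]) :
    Lop i f w = f (simple i * w) + (X - 1) * f w := if_pos h

theorem Lop_asc {i : Fin 3} {w : W} (h : ¬ invs (simple i * w) < invs w) (f : W → ℤ[X]) :
    Lop i f w = X * f (simple i * w) := if_neg h

theorem Lop_sq (i : Fin 3) :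
    Lop i * Lop i = (X - 1 : ℤ[X]) • Lop i + (X : ℤ[X]) • (1 : Module.End ℤ[X] (W → ℤ[X])) := by
  refine LinearMap.ext fun f => funext fun w => ?_
  change Lop i (Lop i f) w = (X - 1) * Lop i f w + X * f w
  have h := invs_simple_mul i w
  by_cases hd : invs (simple i * w) < invs w
  · rw [Lop_desc hd, Lop_asc (w := simple i * w) (by rw [simple_mul_cancel]; omega),
      simple_mul_cancel]
    ring
  · rw [Lop_asc hd, Lop_desc (w := simple i * w) (by rw [simple_mul_cancel]; omega),
      simple_mul_cancel, Lop_asc hd]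
    ring

/-- The possible positions of `w` in its coset of the subgroup generated by two simple
transpositions, recorded by the descents of the elements of the coset. -/
theorem descents_comm : ∀ w : W,
    (invs (simple 0 * w) < invs w ↔ invs (simple 0 * (simple 2 * w)) < invs (simple 2 * w)) ∧
    (invs (simple 2 * w) < invs w ↔ invs (simple 2 * (simple 0 * w)) < invs (simple 0 * w)) := by
  decide +kernel

theorem Lop_comm : Lop 0 * Lop 2 = Lop 2 * Lop 0 := by
  refine LinearMap.ext fun f => funext fun w => ?_
  change Lop 0 (Lop 2 f) w = Lop 2 (Lop 0 f) w
  obtain ⟨h1, h2⟩ := descents_comm w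
  have e : simple 2 * (simple 0 * w) = simple 0 * (simple 2 * w) := by
    rw [← mul_assoc, ← simple_comm, mul_assoc]
  rw [e] at h2
  by_cases a : invs (simple 0 * w) < invs w <;> by_cases b : invs (simple 2 * w) < invs w <;>
  · simp only [Lop_apply, ← h1, ← h2, a, b, if_true, if_false, e]
    try ring

/-- The coset of w under ⟨s_i, s_1⟩ has six elements, and each of the six possible positions of w in
it gives one pattern of descents. The braid relation for `Lop` thus becomes six polynomial
identities. -/
theorem descents_braid : ∀ (i : Fin 3), i ≠ 1 → ∀ w : W,
    [decide (invs (simple i * w) < invs w), decide (invs (simple 1 * w) < invs w),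
      decide (invs (simple i * (simple 1 * w)) < invs (simple 1 * w)),
      decide (invs (simple 1 * (simple i * w)) < invs (simple i * w)),
      decide (invs (simple i * (simple 1 * (simple i * w))) < invs (simple 1 * (simple i * w))),
      decide (invs (simple 1 * (simple i * (simple 1 * w))) < invs (simple i * (simple 1 * w)))] ∈
    [[false, false, false, false, false, false], [true, false, false, false, false, true],
      [false, true, false, false, true, false], [false, true, true, true, true, false],
      [true, false, true, true, false, true], [true, true, true, true, true, true]] := by
  decide +kernel

theorem invs_lt_iff_not (i : Fin 3) (w : W) :
    invs w < invs (simple i * w) ↔ ¬ invs (simple i * w) < invs w := by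
  have := invs_simple_mul i w
  omega

theorem Lop_braid (i : Fin 3) (hi : i ≠ 1) (hs : simple i * simple 1 * simple i =
    simple 1 * simple i * simple 1) : Lop i * Lop 1 * Lop i = Lop 1 * Lop i * Lop 1 := by
  refine LinearMap.ext fun f => funext fun w => ?_
  change Lop i (Lop 1 (Lop i f)) w = Lop 1 (Lop i (Lop 1 f)) w
  have e : simple 1 * (simple i * (simple 1 * w)) = simple i * (simple 1 * (simple i * w)) := by
    simp only [← mul_assoc, hs]
  have h := descents_braid i hi w
  simp only [List.mem_cons, List.not_mem_nil, or_false, List.cons.injEq, and_true,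
    decide_eq_true_eq, decide_eq_false_iff_not] at h
  rcases h with h | h | h | h | h | h <;> obtain ⟨h1, h2, h3, h4, h5, h6⟩ := h <;> rw [e] at h6 <;>
  · simp only [Lop_apply, simple_mul_cancel, invs_lt_iff_not, h1, h2, h3, h4, h5, h6, if_true,
      if_false, not_true, not_false_iff, e]
    try ring

/-- The left regular representation of the Hecke algebra in coordinates. -/
def lreg : H →ₐ[ℤ[X]] Module.End ℤ[X] (W → ℤ[X]) :=
  Hlift Lop Lop_sq Lop_comm (Lop_braid 0 (by decide) simple_braid₁)
    (Lop_braid 2 (by decide) simple_braid₂.symm).symm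

theorem lreg_gen (i : Fin 3) : lreg (gen i) = Lop i := Hlift_gen _ _ _ _ _ i

/-- The coordinates of an element of the Hecke algebra with respect to the `T_w`. -/
def coord : H →ₗ[ℤ[X]] (W → ℤ[X]) where
  toFun a := lreg a (Pi.single 1 1)
  map_add' a b := by rw [map_add, LinearMap.add_apply]
  map_smul' c a := by rw [map_smul, LinearMap.smul_apply, RingHom.id_apply]

theorem coord_gen_mul (i : Fin 3) (a : H) : coord (gen i * a) = Lop i (coord a) := by
  change lreg (gen i * a) _ = Lop i (lreg a _)
  rw [map_mul, lreg_gen]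
  rfl

theorem coord_one : coord 1 = Pi.single 1 1 := by
  change lreg 1 _ = _
  rw [map_one]
  rfl

theorem T_induction {P : W → Prop} (w : W) (hone : P 1)
    (hmul : ∀ i w, invs w < invs (simple i * w) → P w → P (simple i * w)) : P w := by
  induction hn : invs w using Nat.strong_induction_on generalizing w with
  | _ n ih =>
    by_cases hw : w = 1
    · rwa [hw]
    · obtain ⟨i, hi⟩ := exists_descent w hw
      have := hmul i (simple i * w) (by rwa [simple_mul_cancel]) (ih _ (hn ▸ hi) _ rfl)
      rwa [simple_mul_cancel] at this

theorem Lop_single {i : Fin 3} {w : W} (h : invs w < invs (simple i * w)) :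
    Lop i (Pi.single w 1) = Pi.single (simple i * w) 1 := by
  funext v
  by_cases hv : v = simple i * w
  · subst hv
    have hne : simple i * w ≠ w := by
      intro e
      rw [e] at h
      exact lt_irrefl _ h
    rw [Lop_desc (by rwa [simple_mul_cancel]), simple_mul_cancel, Pi.single_eq_same,
      Pi.single_eq_same, Pi.single_eq_of_ne hne, mul_zero, add_zero]
  · have hv' : simple i * v ≠ w := by
      rintro rfl
      exact hv (simple_mul_cancel i v).symm
    rw [Pi.single_eq_of_ne hv, Lop_apply, Pi.single_eq_of_ne hv', mul_zero]
    split_ifs with hd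
    · have : v ≠ w := by
        rintro rfl
        omega
      rw [Pi.single_eq_of_ne this, mul_zero, add_zero]
    · rfl

/-- Linear independence of the T_w; together with `sum_coord` it makes them a basis of the Hecke
algebra. -/
theorem coord_T (w : W) : coord (T w) = Pi.single w 1 := by
  induction w using T_induction with
  | hone => rw [T_one, coord_one]
  | hmul i w h ih => rw [T_simple_mul h, coord_gen_mul, ih, Lop_single h]

theorem sum_coord (a : H) : ∑ w, coord a w • T w = a := by
  suffices h : a ∈ Submodule.span ℤ[X] (Set.range T) by
    induction h using Submodule.span_induction with
    | mem x hx =>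
      obtain ⟨w, rfl⟩ := hx
      rw [coord_T, Finset.sum_eq_single w]
      · rw [Pi.single_eq_same, one_smul]
      · intro v _ hv
        rw [Pi.single_eq_of_ne hv, zero_smul]
      · simp
    | zero => simp
    | add x y _ _ hx hy =>
      simp only [map_add, Pi.add_apply, add_smul, Finset.sum_add_distrib, hx, hy]
    | smul c x _ hx =>
      simp only [map_smul, Pi.smul_apply, smul_assoc, ← Finset.smul_sum, hx]
  induction a using H_induction with
  | hone => exact Submodule.subset_span ⟨1, T_one⟩
  | hadd a b ha hb => exact add_mem ha hb
  | hsmul c a ha => exact Submodule.smul_mem _ c ha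
  | hgen i a ha =>
    induction ha using Submodule.span_induction with
    | mem x hx =>
      obtain ⟨w, rfl⟩ := hx
      by_cases h : invs (simple i * w) < invs w
      · rw [gen_mul_T_desc h]
        exact add_mem (Submodule.smul_mem _ _ (Submodule.subset_span ⟨_, rfl⟩))
          (Submodule.smul_mem _ _ (Submodule.subset_span ⟨_, rfl⟩))
      · rw [← T_simple_mul ((invs_lt_iff_not i w).2 h)]
        exact Submodule.subset_span ⟨_, rfl⟩
    | zero => rw [mul_zero]; exact zero_mem _
    | add x y _ _ hx hy => rw [mul_add]; exact add_mem hx hy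
    | smul c x _ hx => rw [mul_smul_comm]; exact Submodule.smul_mem _ c hx

theorem coord_injective {a b : H} (h : ∀ w, coord a w = coord b w) : a = b := by
  rw [← sum_coord a, ← sum_coord b]
  exact Finset.sum_congr rfl fun w _ => by rw [h]

/-- The element of the Hecke algebra with given coordinates. -/
def ofCoord (f : W → ℤ[X]) : H := ∑ w, f w • T w

theorem coord_ofCoord (f : W → ℤ[X]) : coord (ofCoord f) = f := by
  funext v
  simp only [ofCoord, map_sum, map_smul, coord_T, Finset.sum_apply, Pi.smul_apply, smul_eq_mul]
  rw [Finset.sum_eq_single v]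
  · rw [Pi.single_eq_same, mul_one]
  · intro w _ hw
    rw [Pi.single_eq_of_ne hw.symm, mul_zero]
  · simp

theorem T_mul_T {u w : W} (h : invs (u * w) = invs u + invs w) : T u * T w = T (u * w) := by
  induction u using T_induction with
  | hone => rw [T_one, one_mul, one_mul]
  | hmul i u hu ih =>
    have h1 := invs_simple_mul i u
    have h2 := invs_simple_mul i (u * w)
    rw [mul_assoc] at h
    have h3 := invs_mul_le u w
    rw [T_simple_mul hu, mul_assoc, ih (by omega), ← T_simple_mul (by omega), mul_assoc]

end HeckeS4
end

noncomputable section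
namespace HeckeS4

/-! ## The anti-involution and the augmentation -/

/-- The anti-involution `T_w ↦ T_{w⁻¹}`. -/
def ιop : H →ₐ[ℤ[X]] Hᵐᵒᵖ :=
  Hlift (fun i => MulOpposite.op (gen i))
    (fun i => by
      rw [← MulOpposite.op_mul, gen_sq]
      rfl)
    (by rw [← MulOpposite.op_mul, ← MulOpposite.op_mul, gen_comm])
    (by simp only [← MulOpposite.op_mul]; rw [← mul_assoc, gen_braid₁, mul_assoc])
    (by simp only [← MulOpposite.op_mul]; rw [← mul_assoc, gen_braid₂, mul_assoc])

/-- The anti-involution as a linear map. -/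
def flip : H →ₗ[ℤ[X]] H := (MulOpposite.opLinearEquiv ℤ[X]).symm.toLinearMap ∘ₗ ιop.toLinearMap

theorem flip_mul (a b : H) : flip (a * b) = flip b * flip a := by
  change MulOpposite.unop (ιop (a * b)) = _
  rw [map_mul, MulOpposite.unop_mul]
  rfl

theorem flip_one : flip 1 = 1 := by
  change MulOpposite.unop (ιop 1) = _
  rw [map_one, MulOpposite.unop_one]

theorem flip_gen (i : Fin 3) : flip (gen i) = gen i := by
  change MulOpposite.unop (ιop (gen i)) = _
  rw [ιop, Hlift_gen, MulOpposite.unop_op]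

theorem flip_flip (a : H) : flip (flip a) = a := by
  induction a using H_induction with
  | hone => rw [flip_one, flip_one]
  | hadd a b ha hb => rw [map_add, map_add, ha, hb]
  | hsmul c a ha => rw [map_smul, map_smul, ha]
  | hgen i a ha => rw [flip_mul, flip_mul, ha, flip_gen, flip_gen]

theorem flip_genProd (l : List (Fin 3)) : flip (genProd l) = genProd l.reverse := by
  induction l with
  | nil => exact flip_one
  | cons i l ih =>
    rw [genProd_cons, flip_mul, ih, flip_gen, List.reverse_cons]
    simp [genProd]

theorem wordProd_reverse (l : List (Fin 3)) : wordProd l.reverse = (wordProd l)⁻¹ := by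
  induction l with
  | nil => simp [wordProd]
  | cons i l ih =>
    rw [wordProd_cons, mul_inv_rev, ← ih, simple_inv, List.reverse_cons]
    simp [wordProd]

theorem flip_T (w : W) : flip (T w) = T w⁻¹ := by
  obtain ⟨l, hl, rfl⟩ := exists_word_invs w
  rw [T_eq_genProd l hl, flip_genProd, ← wordProd_reverse, T_eq_genProd]
  rw [wordProd_reverse, invs_inv, List.length_reverse, hl]

theorem coord_flip (a : H) (w : W) : coord (flip a) w = coord a w⁻¹ := by
  conv_lhs => rw [← sum_coord a]
  simp only [map_sum, map_smul, flip_T, coord_T, Finset.sum_apply, Pi.smul_apply, smul_eq_mul]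
  rw [Finset.sum_eq_single w⁻¹]
  · rw [inv_inv, Pi.single_eq_same, mul_one]
  · intro v _ hv
    rw [Pi.single_eq_of_ne, mul_zero]
    rintro rfl
    exact hv (inv_inv v).symm
  · simp

/-- The augmentation `T_w ↦ q^{ℓ(w)}`. -/
def aug : H →ₐ[ℤ[X]] ℤ[X] :=
  Hlift (fun _ => X) (fun _ => by simp only [smul_eq_mul]; ring) rfl rfl rfl

theorem aug_gen (i : Fin 3) : aug (gen i) = X := Hlift_gen _ _ _ _ _ i

theorem aug_T (w : W) : aug (T w) = X ^ invs w := by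
  induction w using T_induction with
  | hone => rw [T_one, map_one, invs_one, pow_zero]
  | hmul i w h ih =>
    have := invs_simple_mul i w
    rw [T_simple_mul h, map_mul, ih, aug_gen, ← pow_succ']
    congr 1
    omega

theorem aug_x (I : Finset (Fin 3)) : aug (x I) = poincare I := by
  rw [x, poincare, map_sum]
  exact Finset.sum_congr rfl fun w _ => by rw [aug_T, len_eq]

/-! ## Invariant elements -/

/-- The elements `a` with `T_s a = q a` for `s ∈ I`. -/
def LInv (I : Finset (Fin 3)) (a : H) : Prop := ∀ i ∈ I, gen i * a = (X : ℤ[X]) • a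

/-- The elements `a` with `a T_s = q a` for `s ∈ I`. -/
def RInv (I : Finset (Fin 3)) (a : H) : Prop := ∀ i ∈ I, a * gen i = (X : ℤ[X]) • a

theorem LInv.flip {I : Finset (Fin 3)} {a : H} (h : LInv I a) : RInv I (flip a) := by
  intro i hi
  rw [← flip_gen i, ← flip_mul, h i hi, map_smul]

theorem RInv.flip {I : Finset (Fin 3)} {a : H} (h : RInv I a) : LInv I (HeckeS4.flip a) := by
  intro i hi
  rw [← flip_gen i, ← flip_mul, h i hi, map_smul]

/-- At an ascent w the coordinate of T_i a is q times the coordinate of a at s_i w, and q can be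
cancelled; descents follow by exchanging w and s_i w. Invariance thereby becomes constancy of
coordinates on cosets. -/
theorem gen_mul_eq_iff (i : Fin 3) (a : H) :
    gen i * a = (X : ℤ[X]) • a ↔ ∀ w, coord a (simple i * w) = coord a w := by
  have key : gen i * a = (X : ℤ[X]) • a ↔ ∀ w, Lop i (coord a) w = X * coord a w := by
    constructor
    · intro h w
      rw [← coord_gen_mul, h, map_smul, Pi.smul_apply, smul_eq_mul]
    · intro h
      refine coord_injective fun w => ?_
      rw [coord_gen_mul, h, map_smul, Pi.smul_apply, smul_eq_mul]
  rw [key]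
  constructor
  · intro h
    have asc : ∀ w, ¬ invs (simple i * w) < invs w → coord a (simple i * w) = coord a w := by
      intro w hw
      have := h w
      rw [Lop_asc hw] at this
      exact mul_left_cancel₀ X_ne_zero this
    intro w
    by_cases hw : invs (simple i * w) < invs w
    · have := asc (simple i * w) (by rw [simple_mul_cancel]; omega)
      rw [simple_mul_cancel] at this
      exact this.symm
    · exact asc w hw
  · intro h w
    rw [Lop_apply, h]
    split_ifs <;> ring

theorem LInv.coord_mul {I : Finset (Fin 3)} {a : H} (h : LInv I a) {v : W} (hv : v ∈ parabolic I)
    (w : W) : coord a (v * w) = coord a w := by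
  induction hv using Subgroup.closure_induction'' generalizing w with
  | mem x hx =>
    obtain ⟨i, hi, rfl⟩ := hx
    exact (gen_mul_eq_iff i a).1 (h i hi) w
  | inv_mem x hx =>
    obtain ⟨i, hi, rfl⟩ := hx
    rw [simple_inv]
    exact (gen_mul_eq_iff i a).1 (h i hi) w
  | one => rw [one_mul]
  | mul x y _ _ hx hy => rw [mul_assoc, hx, hy]

theorem RInv.coord_mul {I : Finset (Fin 3)} {a : H} (h : RInv I a) {v : W} (hv : v ∈ parabolic I)
    (w : W) : coord a (w * v) = coord a w := by
  have := h.flip.coord_mul (inv_mem hv) w⁻¹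
  rwa [coord_flip, coord_flip, mul_inv_rev, inv_inv, inv_inv] at this

open Classical in
theorem coord_x (I : Finset (Fin 3)) (w : W) :
    coord (x I) w = if w ∈ parabolic I then 1 else 0 := by
  rw [x, map_sum, Finset.sum_apply]
  simp only [coord_T, Pi.single_apply]
  rw [Finset.sum_ite_eq]
  simp

theorem x_LInv (I : Finset (Fin 3)) : LInv I (x I) := by
  intro i hi
  rw [gen_mul_eq_iff]
  intro w
  rw [coord_x, coord_x]
  classical
  exact if_congr (Subgroup.mul_mem_cancel_left _ (simple_mem_parabolic hi)) rfl rfl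

theorem flip_x (I : Finset (Fin 3)) : flip (x I) = x I := by
  refine coord_injective fun w => ?_
  rw [coord_flip, coord_x, coord_x]
  classical
  exact if_congr inv_mem_iff rfl rfl

theorem x_RInv (I : Finset (Fin 3)) : RInv I (x I) := flip_x I ▸ (x_LInv I).flip

theorem LInv.mul_right {I : Finset (Fin 3)} {a : H} (h : LInv I a) (b : H) : LInv I (a * b) :=
  fun i hi => by rw [← mul_assoc, h i hi, smul_mul_assoc]

theorem RInv.mul_left {I : Finset (Fin 3)} {a : H} (h : RInv I a) (b : H) : RInv I (b * a) :=
  fun i hi => by rw [mul_assoc, h i hi, mul_smul_comm]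

theorem LInv.T_mul {I : Finset (Fin 3)} {a : H} (h : LInv I a) {v : W} (hv : v ∈ parabolic I) :
    T v * a = (X ^ invs v : ℤ[X]) • a := by
  rw [mem_parabolic_iff] at hv
  induction hn : invs v using Nat.strong_induction_on generalizing v with
  | _ n ih =>
    by_cases hw : v = 1
    · rw [← hn, hw, invs_one, T_one, one_mul, pow_zero, one_smul]
    · obtain ⟨i, hi, hlt, hp⟩ := inPar_descent I v hv hw
      have h1 := T_simple_mul (i := i) (w := simple i * v) (by rwa [simple_mul_cancel])
      rw [simple_mul_cancel] at h1
      have h2 := invs_simple_mul i v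
      rw [h1, mul_assoc, ih _ (hn ▸ hlt) hp rfl, mul_smul_comm, h i hi, smul_smul, ← pow_succ]
      congr 2
      omega

theorem LInv.x_mul {I : Finset (Fin 3)} {a : H} (h : LInv I a) : x I * a = poincare I • a := by
  classical
  rw [x, poincare, Finset.sum_mul, Finset.sum_smul]
  refine Finset.sum_congr rfl fun w hw => ?_
  rw [len_eq, h.T_mul (by simpa using hw)]

/-- The length condition makes each letter of a reduced word of u act at an ascent, where `Lop` has
a single term with factor q. -/
theorem coord_T_mul {u w : W} (h : invs (u⁻¹ * w) = invs u + invs w) (a : H) :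
    coord (T u * a) w = X ^ invs u * coord a (u⁻¹ * w) := by
  induction u using T_induction generalizing w with
  | hone => rw [T_one, one_mul, invs_one, pow_zero, one_mul, inv_one, one_mul]
  | hmul i u hu ih =>
    have h1 := invs_simple_mul i u
    have h2 := invs_simple_mul i w
    have e : (simple i * u)⁻¹ * w = u⁻¹ * (simple i * w) := by
      rw [mul_inv_rev, simple_inv, mul_assoc]
    rw [e] at h
    have h3 := invs_mul_le u⁻¹ (simple i * w)
    rw [invs_inv] at h3
    rw [T_simple_mul hu, mul_assoc, coord_gen_mul, Lop_asc (by omega), ih (by omega), e,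
      ← mul_assoc, ← pow_succ']
    congr 2
    omega

open Classical in
/-- Coordinates of `x_I a` at minimal representatives. -/
theorem coord_x_mul {I : Finset (Fin 3)} {d : W} (hd : LMin I d) (a : H) :
    coord (x I * a) d = ∑ u ∈ Finset.univ.filter (fun w : W => w ∈ parabolic I),
      X ^ invs u * coord a (u⁻¹ * d) := by
  rw [x, Finset.sum_mul, map_sum, Finset.sum_apply]
  refine Finset.sum_congr rfl fun u hu => coord_T_mul ?_ a
  rw [hd.invs_mul (inv_mem (by simpa using hu)), invs_inv]

theorem LInv.ext_of_min {I : Finset (Fin 3)} {a b : H} (ha : LInv I a) (hb : LInv I b)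
    (h : ∀ d, LMin I d → coord a d = coord b d) : a = b := by
  refine coord_injective fun w => ?_
  obtain ⟨v, hv, hw⟩ := lrep_spec I w
  rw [← ha.coord_mul hv, ← hb.coord_mul hv, ← hw, h _ (lrep_min I w)]

/-- A coset W_I d contains only one minimal element, so in the sum over u ∈ W_I just the term u = 1
survives. -/
theorem coord_x_mul_of_min {I : Finset (Fin 3)} {a : H} (ha : ∀ w, ¬ LMin I w → coord a w = 0)
    {d : W} (hd : LMin I d) : coord (x I * a) d = coord a d := by
  classical
  rw [coord_x_mul hd, Finset.sum_eq_single 1]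
  · rw [invs_one, pow_zero, one_mul, inv_one, one_mul]
  · intro u hu hu1
    rw [ha, mul_zero]
    intro hm
    exact hu1 (inv_eq_one.1 (hd.unique (inv_mem (by simpa using hu)) hm))
  · intro h
    exact absurd (Finset.mem_filter.2 ⟨Finset.mem_univ _, one_mem _⟩) h

/-- The part of `a` supported on a set. -/
def restr (p : W → Prop) [DecidablePred p] : H →ₗ[ℤ[X]] H where
  toFun a := ofCoord fun w => if p w then coord a w else 0
  map_add' a b := by
    refine coord_injective fun w => ?_
    simp only [coord_ofCoord, map_add, Pi.add_apply]
    split_ifs <;> simp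
  map_smul' c a := by
    refine coord_injective fun w => ?_
    simp only [coord_ofCoord, map_smul, Pi.smul_apply, smul_eq_mul, RingHom.id_apply]
    split_ifs <;> simp

theorem coord_restr (p : W → Prop) [DecidablePred p] (a : H) (w : W) :
    coord (restr p a) w = if p w then coord a w else 0 := by
  change coord (ofCoord fun w => if p w then coord a w else 0) w = _
  rw [coord_ofCoord]

/-- Both sides have coordinates constant on the cosets W_I w, so they need only be compared at
minimal representatives. Consequently the right ideal x_I H consists of all left I-invariants. -/
theorem LInv.eq_x_mul {I : Finset (Fin 3)} {a : H} (ha : LInv I a) :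
    a = x I * restr (LMin I) a := by
  refine ha.ext_of_min ((x_LInv I).mul_right _) fun d hd => ?_
  rw [coord_x_mul_of_min _ hd, coord_restr, if_pos hd]
  intro w hw
  rw [coord_restr, if_neg hw]

theorem RInv.eq_mul_x {I : Finset (Fin 3)} {a : H} (ha : RInv I a) :
    a = HeckeS4.flip (restr (LMin I) (HeckeS4.flip a)) * x I := by
  have := congrArg HeckeS4.flip ha.flip.eq_x_mul
  rwa [flip_flip, flip_mul, flip_x] at this

/-- x_J is right I-invariant, and h_{J,I} is precisely its part supported on the minimal elements of
the cosets w W_I; so this is an instance of `RInv.eq_mul_x`. -/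
theorem h_mul_x {I J : Finset (Fin 3)} (hIJ : I ⊆ J) : h J I * x I = x J := by
  have hR : RInv I (x J) := fun i hi => x_RInv J i (hIJ hi)
  conv_rhs => rw [hR.eq_mul_x]
  congr 1
  refine coord_injective fun w => ?_
  rw [coord_flip, coord_restr, coord_flip, inv_inv, coord_x, h, map_sum, Finset.sum_apply]
  simp only [coord_T, Pi.single_apply, ← mem_shortestReps_iff]
  rw [Finset.sum_ite_eq]
  by_cases h1 : w ∈ parabolic J <;> by_cases h2 : w⁻¹ ∈ shortestReps I <;> 
    simp [h1, h2, ← mem_shortestReps_iff]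

end HeckeS4
end

noncomputable section
namespace HeckeS4

/-! ## Double cosets -/

theorem par_induction {I : Finset (Fin 3)} {P : (v : W) → v ∈ parabolic I → Prop} {v : W}
    (hv : v ∈ parabolic I) (hone : P 1 (one_mem _))
    (hmul : ∀ i (hi : i ∈ I) w (hw : w ∈ parabolic I), invs w < invs (simple i * w) → P w hw →
      P (simple i * w) (mul_mem (simple_mem_parabolic hi) hw)) : P v hv := by
  induction hn : invs v using Nat.strong_induction_on generalizing v with
  | _ n ih =>
    by_cases hw : v = 1
    · subst hw
      exact hone
    · obtain ⟨i, hi, hlt, hp⟩ := inPar_descent I v ((mem_parabolic_iff I v).1 hv) hw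
      have := hmul i hi (simple i * v) ((mem_parabolic_iff I _).2 hp)
        (by rwa [simple_mul_cancel]) (ih _ (hn ▸ hlt) _ rfl)
      simpa only [simple_mul_cancel] using this

section Maps

variable {N : Type*} [AddCommGroup N] [Module ℤ[X] N]

theorem map_T_mul (G : H →ₗ[ℤ[X]] N) {I : Finset (Fin 3)}
    (hG : ∀ i ∈ I, ∀ a, G (gen i * a) = (X : ℤ[X]) • G a) {v : W} (hv : v ∈ parabolic I) (a : H) :
    G (T v * a) = (X ^ invs v : ℤ[X]) • G a := by
  induction hv using par_induction with
  | hone => rw [T_one, one_mul, invs_one, pow_zero, one_smul]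
  | hmul i hi w _ h ih =>
    have := invs_simple_mul i w
    rw [T_simple_mul h, mul_assoc, hG i hi, ih, smul_smul, ← pow_succ']
    congr 2
    omega

theorem map_T_lrep (G : H →ₗ[ℤ[X]] N) {I : Finset (Fin 3)}
    (hG : ∀ i ∈ I, ∀ a, G (gen i * a) = (X : ℤ[X]) • G a) (w : W) :
    ∃ k, invs w = k + invs (lrep I w) ∧ G (T w) = (X ^ k : ℤ[X]) • G (T (lrep I w)) := by
  obtain ⟨v, hv, h⟩ := lrep_spec I w
  have hw : w = v⁻¹ * lrep I w := by rw [h, inv_mul_cancel_left]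
  have hl := (lrep_min I w).invs_mul (inv_mem hv)
  rw [← hw] at hl
  refine ⟨_, hl, ?_⟩
  rw [← map_T_mul G hG (inv_mem hv), T_mul_T, ← hw]
  rw [← hw, hl]

/-- A two-sided q-equivariant map is determined on each double coset by its value at the minimal
representative, up to the power of q given by the difference of lengths. -/
theorem map_T_mrep (G : H →ₗ[ℤ[X]] N) {I J : Finset (Fin 3)}
    (hl : ∀ i ∈ I, ∀ a, G (gen i * a) = (X : ℤ[X]) • G a)
    (hr : ∀ j ∈ J, ∀ a, G (a * gen j) = (X : ℤ[X]) • G a) (w : W) :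
    ∃ k, invs w = k + invs (mrep I J w) ∧ G (T w) = (X ^ k : ℤ[X]) • G (T (mrep I J w)) := by
  obtain ⟨k, hk, h⟩ := map_T_lrep G hl w
  obtain ⟨k', hk', h'⟩ := map_T_lrep (G ∘ₗ flip) (I := J) (fun j hj a => by
    rw [LinearMap.comp_apply, flip_mul, flip_gen, hr j hj]; rfl) (lrep I w)⁻¹
  rw [LinearMap.comp_apply, LinearMap.comp_apply, flip_T, flip_T, inv_inv] at h'
  refine ⟨k + k', ?_, ?_⟩
  · rw [hk, ← invs_inv (lrep I w), hk', mrep, rrep, invs_inv]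
    ring
  · rw [h, h', smul_smul, ← pow_add]
    rfl

end Maps

theorem gen_mul_restr {p : W → Prop} [DecidablePred p] {i : Fin 3}
    (hp : ∀ w, p (simple i * w) ↔ p w) (a : H) : gen i * restr p a = restr p (gen i * a) := by
  refine coord_injective fun w => ?_
  rw [coord_gen_mul, coord_restr, coord_gen_mul, Lop_apply, Lop_apply, coord_restr, coord_restr]
  by_cases h : p w
  · simp [h, hp]
  · simp [h, hp]

theorem T_mul_restr {p : W → Prop} [DecidablePred p] {I : Finset (Fin 3)}
    (hp : ∀ i ∈ I, ∀ w, p (simple i * w) ↔ p w) {v : W} (hv : v ∈ parabolic I) (a : H) :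
    T v * restr p a = restr p (T v * a) := by
  induction hv using par_induction with
  | hone => rw [T_one, one_mul, one_mul]
  | hmul i hi w _ h ih => rw [T_simple_mul h, mul_assoc, mul_assoc, ih, gen_mul_restr (hp i hi)]

theorem x_mul_restr {p : W → Prop} [DecidablePred p] {I : Finset (Fin 3)}
    (hp : ∀ i ∈ I, ∀ w, p (simple i * w) ↔ p w) (a : H) : x I * restr p a = restr p (x I * a) := by
  classical
  rw [x, Finset.sum_mul, Finset.sum_mul, map_sum]
  exact Finset.sum_congr rfl fun v hv => T_mul_restr hp (by simpa using hv) a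

theorem flip_restr {p : W → Prop} [DecidablePred p] (a : H) :
    flip (restr p a) = restr (fun w => p w⁻¹) (flip a) := by
  refine coord_injective fun w => ?_
  rw [coord_flip, coord_restr, coord_restr, coord_flip]

theorem x_mul_restr_mul_x {p : W → Prop} [DecidablePred p] {I J : Finset (Fin 3)}
    (hl : ∀ i ∈ I, ∀ w, p (simple i * w) ↔ p w) (hr : ∀ j ∈ J, ∀ w, p (w * simple j) ↔ p w) (a : H) :
    x I * restr p a * x J = restr p (x I * a * x J) := by
  rw [x_mul_restr hl]
  rw [← flip_flip (restr p (x I * a) * x J), flip_mul, flip_x, flip_restr, x_mul_restr, flip_restr,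
    flip_mul, flip_flip, flip_x]
  · simp only [inv_inv]
  · intro j hj w
    rw [mul_inv_rev, simple_inv, hr j hj]

theorem poincare_ne_zero (I : Finset (Fin 3)) : poincare I ≠ 0 := by
  classical
  intro h
  have h1 := congrArg (eval 1) h
  rw [poincare, eval_finsetSum] at h1
  simp only [eval_pow, eval_X, one_pow, Finset.sum_const, eval_zero, nsmul_eq_mul, mul_one,
    Nat.cast_eq_zero, Finset.card_eq_zero] at h1
  have : (1 : W) ∈ (∅ : Finset W) := by
    rw [← h1]
    simp
  simp at this

/-- A linear map that is `q`-equivariant for `T_s` on both sides factors through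
`a ↦ x_I a x_J`. -/
theorem map_eq_zero_of_x_mul_x {N : Type*} [AddCommGroup N] [Module ℤ[X] N] (G : H →ₗ[ℤ[X]] N)
    {I J : Finset (Fin 3)} (hl : ∀ i ∈ I, ∀ a, G (gen i * a) = (X : ℤ[X]) • G a)
    (hr : ∀ j ∈ J, ∀ a, G (a * gen j) = (X : ℤ[X]) • G a) {a : H} (h : x I * a * x J = 0) :
    G a = 0 := by
  have hsum : a = ∑ d, restr (fun w => mrep I J w = d) a := by
    refine coord_injective fun w => ?_
    rw [map_sum, Finset.sum_apply]
    simp only [coord_restr]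
    rw [Finset.sum_ite_eq]
    simp
  rw [hsum, map_sum]
  refine Finset.sum_eq_zero fun d _ => ?_
  choose k hk hG using map_T_mrep G hl hr
  have h1 : x I * restr (fun w => mrep I J w = d) a * x J = 0 := by
    rw [x_mul_restr_mul_x, h, map_zero]
    · intro i hi w
      rw [mrep_simple_mul hi]
    · intro j hj w
      rw [mrep_mul_simple hj]
  -- On a single double coset, G and the augmentation are given by the same sum of coordinates times
  -- powers of q, multiplied by G(T_d) and by q^ℓ(d) respectively. The augmentation of x_I b x_J is
  -- π(I) π(J) times that of b, so the sum vanishes.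
  have h2 := congrArg aug h1
  rw [map_mul, map_mul, aug_x, aug_x, map_zero] at h2
  have h3 : aug (restr (fun w => mrep I J w = d) a) = 0 := by
    rcases mul_eq_zero.1 h2 with h2 | h2
    · exact (mul_eq_zero.1 h2).resolve_left (poincare_ne_zero I)
    · exact absurd h2 (poincare_ne_zero J)
  set b := restr (fun w => mrep I J w = d) a with hb
  have hb0 : ∀ w, mrep I J w ≠ d → coord b w = 0 := fun w hw => by
    rw [hb, coord_restr, if_neg hw]
  have e1 : aug b = (∑ w, coord b w * X ^ k w) * X ^ invs d := by
    conv_lhs => rw [← sum_coord b]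
    rw [map_sum, Finset.sum_mul]
    refine Finset.sum_congr rfl fun w _ => ?_
    rw [map_smul, aug_T, smul_eq_mul]
    by_cases hw : mrep I J w = d
    · rw [hk w, hw, pow_add, mul_assoc]
    · rw [hb0 w hw, zero_mul, zero_mul, zero_mul]
  have e2 : G b = (∑ w, coord b w * X ^ k w) • G (T d) := by
    conv_lhs => rw [← sum_coord b]
    rw [map_sum, Finset.sum_smul]
    refine Finset.sum_congr rfl fun w _ => ?_
    rw [map_smul, hG w]
    by_cases hw : mrep I J w = d
    · rw [hw, smul_smul]
    · rw [hb0 w hw, zero_mul, zero_smul, zero_smul]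
  rw [e2]
  rw [h3] at e1
  rw [(mul_eq_zero.1 e1.symm).resolve_right (pow_ne_zero _ X_ne_zero), zero_smul]

/-- `d` is of minimal length in `W_I d W_J`. -/
def BiMin (I J : Finset (Fin 3)) (d : W) : Prop := LMin I d ∧ LMin J d⁻¹

instance (I J : Finset (Fin 3)) (d : W) : Decidable (BiMin I J d) :=
  inferInstanceAs (Decidable (LMin I d ∧ LMin J d⁻¹))

theorem BiMin.mrep_eq {I J : Finset (Fin 3)} {d : W} (h : BiMin I J d) : mrep I J d = d := by
  rw [mrep, h.1.lrep_eq, rrep, h.2.lrep_eq, inv_inv]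

theorem mrep_spec (I J : Finset (Fin 3)) (w : W) :
    ∃ u ∈ parabolic I, ∃ v ∈ parabolic J, mrep I J w = u * w * v := by
  obtain ⟨u, hu, h⟩ := lrep_spec I w
  obtain ⟨v, hv, h'⟩ := lrep_spec J (lrep I w)⁻¹
  refine ⟨u, hu, v⁻¹, inv_mem hv, ?_⟩
  rw [mrep, rrep, h', h, mul_inv_rev, inv_inv]

theorem mrep_mul {I J : Finset (Fin 3)} {u v : W} (hu : u ∈ parabolic I) (hv : v ∈ parabolic J)
    (w : W) : mrep I J (u * w * v) = mrep I J w := by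
  have h1 : ∀ w, mrep I J (u * w) = mrep I J w := by
    intro w
    rw [mrep, lrep_mul hu, mrep]
  rw [mul_assoc, h1]
  clear h1 hu
  have : ∀ v ∈ parabolic J, ∀ w, mrep I J (w * v) = mrep I J w := by
    intro v hv
    induction hv using par_induction with
    | hone => intro w; rw [mul_one]
    | hmul i hi v _ _ ih => intro w; rw [← mul_assoc, ih, mrep_mul_simple hi]
  exact this v hv w

theorem mrep_biMin (I J : Finset (Fin 3)) (w : W) : BiMin I J (mrep I J w) := by
  have key : ∀ u ∈ parabolic I, ∀ v ∈ parabolic J,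
      invs (mrep I J w) ≤ invs (u * mrep I J w * v) := by
    intro u hu v hv
    obtain ⟨a, ha, b, hb, h⟩ := mrep_spec I J w
    have e : mrep I J (u * mrep I J w * v) = mrep I J w := by
      rw [mrep_mul hu hv]
      conv_lhs => rw [h]
      rw [mrep_mul ha hb]
    -- Only the length identity is wanted, so the lemma is applied to the zero map.
    obtain ⟨k, hk, -⟩ := map_T_mrep (N := H) (I := I) (J := J) 0
      (fun i _ a => (smul_zero _).symm) (fun i _ a => (smul_zero _).symm) (u * mrep I J w * v)
    rw [e] at hk
    omega
  constructor
  · intro i hi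
    have h1 := key _ (simple_mem_parabolic hi) 1 (one_mem _)
    rw [mul_one] at h1
    have := invs_simple_mul i (mrep I J w)
    omega
  · intro j hj
    have h1 := key 1 (one_mem _) _ (simple_mem_parabolic hj)
    rw [one_mul, ← invs_inv (mrep I J w * _), mul_inv_rev, simple_inv,
      ← invs_inv (mrep I J w)] at h1
    have := invs_simple_mul j (mrep I J w)⁻¹
    omega

theorem ext_of_biMin {I J : Finset (Fin 3)} {a b : H} (ha : LInv I a) (ha' : RInv J a)
    (hb : LInv I b) (hb' : RInv J b) (h : ∀ d, BiMin I J d → coord a d = coord b d) : a = b := by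
  refine coord_injective fun w => ?_
  obtain ⟨u, hu, v, hv, e⟩ := mrep_spec I J w
  have := h _ (mrep_biMin I J w)
  rwa [e, ha'.coord_mul hv, hb'.coord_mul hv, ha.coord_mul hu, hb.coord_mul hu] at this

/-- The double coset of `d` is free. -/
def IsFree (I J : Finset (Fin 3)) (d : W) : Prop := ∀ u, InPar I u → LMin J (d⁻¹ * u)

instance (I J : Finset (Fin 3)) (d : W) : Decidable (IsFree I J d) :=
  inferInstanceAs (Decidable (∀ u, InPar I u → LMin J (d⁻¹ * u)))

theorem coord_mul_x (J : Finset (Fin 3)) (d : W) (a : H) :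
    coord (a * x J) d = coord (x J * flip a) d⁻¹ := by
  rw [← flip_x, ← flip_flip a, ← flip_mul, coord_flip, flip_flip, flip_x]

/-- For a free double coset every u⁻¹ d with u ∈ W_I is minimal in its right W_J-coset. The
coordinate of T_d x_J at u⁻¹ d is therefore that of T_d, which vanishes unless u = 1. No Poincaré
factor arises. -/
theorem coord_x_T_x {I J : Finset (Fin 3)} {d : W} (hd : BiMin I J d) (hf : IsFree I J d) :
    coord (x I * T d * x J) d = 1 := by
  classical
  rw [mul_assoc, coord_x_mul hd.1, Finset.sum_eq_single 1]
  · rw [invs_one, pow_zero, one_mul, inv_one, one_mul, coord_mul_x J d, flip_T,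
      coord_x_mul_of_min _ hd.2, coord_T, Pi.single_eq_same]
    intro w hw
    rw [coord_T, Pi.single_eq_of_ne]
    rintro rfl
    exact hw hd.2
  · intro u hu hu1
    have hu : u ∈ parabolic I := by simpa using hu
    have hm : LMin J (u⁻¹ * d)⁻¹ := by
      rw [mul_inv_rev, inv_inv]
      exact hf u ((mem_parabolic_iff I u).1 hu)
    rw [coord_mul_x J, flip_T, coord_x_mul_of_min _ hm, coord_T, Pi.single_eq_of_ne, mul_zero]
    · intro e
      rw [inv_inj, mul_eq_right, inv_eq_one] at e
      exact hu1 e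
    · intro w hw
      rw [coord_T, Pi.single_eq_of_ne]
      rintro rfl
      exact hw hd.2
  · simp

/-- A two-sided invariant element that vanishes on the double cosets that are not free. -/
theorem eq_x_mul_x {I J : Finset (Fin 3)} {a : H} (hl : LInv I a) (hr : RInv J a)
    (h : ∀ d, BiMin I J d → ¬ IsFree I J d → coord a d = 0) :
    a = x I * restr (BiMin I J) a * x J := by
  refine ext_of_biMin hl hr (by rw [mul_assoc]; exact (x_LInv I).mul_right _)
    ((x_RInv J).mul_left _) fun d hd => ?_
  -- Each double coset contains one element minimal on both sides; cutting down to it is compatible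
  -- with multiplication by x_I and x_J.
  have e : restr (fun w => mrep I J w = d) (restr (BiMin I J) a) = coord a d • T d := by
    refine coord_injective fun w => ?_
    rw [coord_restr, coord_restr, map_smul, Pi.smul_apply, coord_T, smul_eq_mul]
    by_cases hw : w = d
    · subst hw
      rw [if_pos hd.mrep_eq, if_pos hd, Pi.single_eq_same, mul_one]
    · rw [Pi.single_eq_of_ne hw, mul_zero]
      by_cases hb : BiMin I J w
      · rw [if_neg]
        rwa [hb.mrep_eq]
      · rw [if_neg hb, ite_self]
  have e2 := x_mul_restr_mul_x (I := I) (J := J) (p := fun w => mrep I J w = d)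
    (fun i hi w => by rw [mrep_simple_mul hi]) (fun j hj w => by rw [mrep_mul_simple hj])
    (restr (BiMin I J) a)
  have e3 := congrFun (congrArg coord e2) d
  rw [coord_restr, if_pos hd.mrep_eq] at e3
  rw [← e3, e, mul_smul_comm, smul_mul_assoc, map_smul, Pi.smul_apply, smul_eq_mul]
  by_cases hf : IsFree I J d
  · rw [coord_x_T_x hd hf, mul_one]
  · rw [h d hd hf, zero_mul]

/-- Conjugation by w⁻¹ carries W_{I'} into W_J. After x_{I'} is split off from x_I, the remaining
factor is right J-invariant, so its coordinates are constant on W_{I'} w, and x_{I'} sums them to a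
multiple of π(I'). -/
theorem poincare_dvd_coord {I I' J : Finset (Fin 3)} (hI : I' ⊆ I) {w : W} (hw : LMin I' w)
    (hc : ∀ i ∈ I', ∃ j ∈ J, simple i * w = w * simple j) (a : H) :
    poincare I' ∣ coord (x I * a * x J) w := by
  classical
  have hL : LInv I' (x I) := fun i hi => x_LInv I i (hI hi)
  have hconj : ∀ u ∈ parabolic I', w⁻¹ * u * w ∈ parabolic J := by
    intro u hu
    induction hu using par_induction with
    | hone => simp
    | hmul i hi v _ _ ih =>
      obtain ⟨j, hj, e⟩ := hc i hi
      have : w⁻¹ * (simple i * v) * w = simple j * (w⁻¹ * v * w) := by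
        have e' : w⁻¹ * simple i = simple j * w⁻¹ := by
          rw [inv_mul_eq_iff_eq_mul, ← mul_assoc, ← e, mul_inv_cancel_right]
        rw [← mul_assoc, e']
        simp only [mul_assoc]
      rw [this]
      exact mul_mem (simple_mem_parabolic hj) ih
  rw [hL.eq_x_mul, mul_assoc, mul_assoc, coord_x_mul hw]
  refine ⟨coord (restr (LMin I') (x I) * (a * x J)) w, ?_⟩
  rw [poincare, Finset.sum_mul]
  refine Finset.sum_congr rfl fun u hu => ?_
  have hu : u ∈ parabolic I' := by simpa using hu
  rw [len_eq]
  congr 1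
  have hR : RInv J (restr (LMin I') (x I) * (a * x J)) := by
    rw [← mul_assoc]
    exact (x_RInv J).mul_left _
  have := hR.coord_mul (hconj _ (inv_mem hu)) w
  rw [← this]
  group

end HeckeS4
end

noncomputable section
namespace HeckeS4

/-! ## Explicit Poincaré polynomials and coset sums -/

/-- `c` counts the elements of W_I of length 0, 1, 2, …, padded by zeros. The longest element of S₄
has length 6, hence the range 7. -/
theorem poincare_of_card (I : Finset (Fin 3)) (c : List ℕ)
    (hc : ∀ k ∈ Finset.range 7, (Finset.univ.filter fun w : W => InPar I w ∧ invs w = k).card =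
      c.getD k 0) : poincare I = ∑ k ∈ Finset.range 7, (c.getD k 0 : ℤ[X]) * X ^ k := by
  have hr : ∀ w : W, invs w ∈ Finset.range 7 := by decide +kernel
  rw [poincare, ← Finset.sum_fiberwise_of_maps_to (fun w _ => hr w)]
  refine Finset.sum_congr rfl fun k hk => ?_
  rw [← hc k hk, Finset.filter_filter, ← nsmul_eq_mul, ← Finset.sum_const]
  refine Finset.sum_congr ?_ ?_
  · ext w
    simp [mem_parabolic_iff]
  · intro w hw
    rw [len_eq, (Finset.mem_filter.1 hw).2.2]

theorem poincare_empty : poincare ∅ = 1 := by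
  rw [poincare_of_card ∅ [1] (by decide +kernel)]
  simp [Finset.sum_range_succ]

theorem poincare_single (s : Fin 3) : poincare {s} = 1 + X := by
  rw [poincare_of_card {s} [1, 1] (by revert s; decide +kernel)]
  simp [Finset.sum_range_succ]

theorem poincare_compl_one : poincare {1}ᶜ = (1 + X) * (1 + X) := by
  rw [poincare_of_card {1}ᶜ [1, 2, 1] (by decide +kernel)]
  simp [Finset.sum_range_succ]
  ring

theorem poincare_compl {t : Fin 3} (ht : t ≠ 1) : poincare {t}ᶜ = (1 + X) * (1 + X + X ^ 2) := by
  rw [poincare_of_card {t}ᶜ [1, 2, 2, 1] (by revert t; decide +kernel)]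
  simp [Finset.sum_range_succ]
  ring

theorem poincare_univ : poincare Finset.univ = (1 + X) * (1 + X + X ^ 2) * (1 + X + X ^ 2 + X ^ 3) := by
  rw [poincare_of_card Finset.univ [1, 3, 5, 6, 5, 3, 1] (by decide +kernel)]
  simp [Finset.sum_range_succ]
  ring

theorem poincare_monic (I : Finset (Fin 3)) : (poincare I).Monic := by
  have m1 : (1 + X : ℤ[X]).Monic := by
    rw [add_comm]; exact monic_X_add_C 1
  have m2 : (1 + X + X ^ 2 : ℤ[X]).Monic := by
    have : (1 + X + X ^ 2 : ℤ[X]) = X ^ 2 + (C 1 * X + C 1) := by simp; ring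
    rw [this]
    exact monic_X_pow_add (degree_linear_lt)
  have m3 : (1 + X + X ^ 2 + X ^ 3 : ℤ[X]).Monic := by
    have : (1 + X + X ^ 2 + X ^ 3 : ℤ[X]) = X ^ 3 + (C 1 * X ^ 2 + C 1 * X + C 1) := by simp; ring
    rw [this]
    exact monic_X_pow_add (degree_quadratic_lt)
  have : ∀ I : Finset (Fin 3), I = ∅ ∨ (∃ s, I = {s}) ∨ (∃ t, I = {t}ᶜ) ∨ I = Finset.univ := by
    decide
  rcases this I with rfl | ⟨s, rfl⟩ | ⟨t, rfl⟩ | rfl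
  · rw [poincare_empty]; exact monic_one
  · rw [poincare_single]; exact m1
  · by_cases ht : t = 1
    · rw [ht, poincare_compl_one]; exact m1.mul m1
    · rw [poincare_compl ht]; exact m1.mul m2
  · rw [poincare_univ]; exact (m1.mul m2).mul m3

/-- The augmentation of h_{J,I} x_I = x_J. It shows that the polynomial division in the
quasi-idempotent relations is exact. -/
theorem aug_h_mul {I J : Finset (Fin 3)} (hIJ : I ⊆ J) : poincare I * aug (h J I) = poincare J := by
  rw [mul_comm, ← aug_x, ← map_mul, h_mul_x hIJ, aug_x]

theorem poincare_div {I J : Finset (Fin 3)} (hIJ : I ⊆ J) :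
    poincare J /ₘ poincare I = aug (h J I) := by
  rw [← aug_h_mul hIJ, mul_divByMonic_cancel_left _ (poincare_monic I)]

theorem LInv.h_mul {I J : Finset (Fin 3)} {z : H} (hz : LInv J z) : h J I * z = aug (h J I) • z := by
  classical
  rw [h, Finset.sum_mul, map_sum, Finset.sum_smul]
  refine Finset.sum_congr rfl fun w hw => ?_
  rw [aug_T, hz.T_mul]
  have := (Finset.mem_filter.1 hw).2.1
  exact this

theorem h_eq_sum {I J : Finset (Fin 3)} (L : List (List (Fin 3))) (hnd : (L.map wordProd).Nodup)
    (hred : ∀ l ∈ L, l.length = invs (wordProd l))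
    (hmem : ∀ w, w ∈ L.map wordProd ↔ InPar J w ∧ LMin I w⁻¹) :
    h J I = (L.map genProd).sum := by
  classical
  have e : (Finset.univ.filter fun w : W => w ∈ parabolic J ∧ w⁻¹ ∈ shortestReps I) =
      (L.map wordProd).toFinset := by
    ext w
    rw [List.mem_toFinset, hmem, Finset.mem_filter, mem_parabolic_iff, mem_shortestReps_iff]
    simp
  have e2 : h J I = ∑ w ∈ (L.map wordProd).toFinset, T w := by
    rw [← e, h]
  rw [e2, List.sum_toFinset _ hnd, List.map_map]
  congr 1
  exact List.map_congr_left fun l hl => T_eq_genProd l (hred l hl)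

theorem h_single (s : Fin 3) : h {s} ∅ = 1 + gen s := by
  rw [h_eq_sum [[], [s]] (by revert s; decide +kernel) (by revert s; decide +kernel)
    (by revert s; decide +kernel)]
  simp [genProd]

theorem h_comm {a c : Fin 3} (ha : a ≠ 1) (hc : c ≠ 1) (hac : a ≠ c) : h {1}ᶜ {a} = 1 + gen c := by
  rw [h_eq_sum [[], [c]] (by revert a c; decide +kernel) (by revert a c; decide +kernel)
    (by revert a c; decide +kernel)]
  simp [genProd]

theorem h_adj {r s t : Fin 3} (hr : r ≠ 1) (hrs : r ≠ s) (hrt : r ≠ t) (hst : s ≠ t) :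
    h {r}ᶜ {s} = 1 + (gen t + gen s * gen t) := by
  rw [h_eq_sum [[], [t], [s, t]] (by revert r s t; decide +kernel) (by revert r s t; decide +kernel)
    (by revert r s t; decide +kernel)]
  simp [genProd]

theorem h_univ_compl {a c : Fin 3} (ha : a ≠ 1) (hc : c ≠ 1) (hac : a ≠ c) :
    h Finset.univ {c}ᶜ = 1 + (gen c + (gen 1 * gen c + gen a * (gen 1 * gen c))) := by
  rw [h_eq_sum [[], [c], [1, c], [a, 1, c]] (by revert a c; decide +kernel)
    (by revert a c; decide +kernel) (by revert a c; decide +kernel)]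
  simp [genProd]

theorem h_univ_compl_one {a c : Fin 3} (ha : a ≠ 1) (hc : c ≠ 1) (hac : a ≠ c) :
    h Finset.univ {1}ᶜ = 1 + (gen 1 + (gen a * gen 1 + (gen c * gen 1 + (gen a * (gen c * gen 1) +
      gen 1 * (gen a * (gen c * gen 1)))))) := by
  rw [h_eq_sum [[], [1], [a, 1], [c, 1], [a, c, 1], [1, a, c, 1]] (by revert a c; decide +kernel)
    (by revert a c; decide +kernel) (by revert a c; decide +kernel)]
  simp [genProd]

theorem gen_comm' {a c : Fin 3} (ha : a ≠ 1) (hc : c ≠ 1) : gen a * gen c = gen c * gen a := by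
  fin_cases a <;> fin_cases c <;> first | rfl | exact gen_comm | exact gen_comm.symm | simp at ha hc

theorem gen_braid' {a : Fin 3} (ha : a ≠ 1) : gen a * gen 1 * gen a = gen 1 * gen a * gen 1 := by
  fin_cases a
  · exact gen_braid₁
  · rfl
  · exact gen_braid₂.symm

/-! ## The torsion relations in the Hecke algebra -/

/-- Subsets of size two are written as complements throughout: r is the end node outside the
adjacent pair, so {s, t} = {r}ᶜ. -/
theorem torsion₁ {r s t : Fin 3} (hr : r ≠ 1) (hrs : r ≠ s) (hrt : r ≠ t) (hst : s ≠ t) {z : H}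
    (hz : LInv {s} z) : h {s} ∅ * (h {t} ∅ * z) = h {r}ᶜ {s} * z + (X : ℤ[X]) • z := by
  rw [h_single, h_single, h_adj hr hrs hrt hst]
  have h1 := hz s (by simp)
  simp only [add_mul, mul_add, one_mul, mul_assoc, h1]
  abel

theorem torsion₂ {a c : Fin 3} (ha : a ≠ 1) (hc : c ≠ 1) (hac : a ≠ c) :
    h {a} ∅ = h {1}ᶜ {c} := by
  rw [h_single, h_comm hc ha hac.symm]

theorem torsion₃ {a c : Fin 3} (ha : a ≠ 1) (hc : c ≠ 1) (hac : a ≠ c) {z : H}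
    (hz : LInv {c}ᶜ z) : h {c}ᶜ {a} * (h {1}ᶜ {a} * z) =
      h Finset.univ {c}ᶜ * z + (X * (X + 1) : ℤ[X]) • z := by
  rw [h_adj hc hac.symm hc ha, h_comm ha hc hac, h_univ_compl ha hc hac]
  have h1 := hz a (by simpa using hac)
  have h2 := hz 1 (by simpa using hc.symm)
  simp only [add_mul, mul_add, one_mul, mul_assoc, h1, h2, mul_smul_comm]
  module

theorem torsion₄ {a c : Fin 3} (ha : a ≠ 1) (hc : c ≠ 1) (hac : a ≠ c) {z : H}
    (hz : LInv {1}ᶜ z) : h {c}ᶜ {1} * (h {a}ᶜ {c} * z) =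
      h Finset.univ {1}ᶜ * z + (X : ℤ[X]) • (h {c}ᶜ {a} * z) := by
  rw [h_adj hc hc hac.symm ha.symm, h_adj ha hac ha hc, h_univ_compl_one ha hc hac,
    h_adj hc hac.symm hc ha]
  have h1 := hz a (by simpa using ha)
  have h2 := hz c (by simpa using hc)
  -- The braid relation moves T_a next to z, where it acts as q.
  have h3 : gen 1 * (gen a * (gen 1 * z)) = (X : ℤ[X]) • (gen a * (gen 1 * z)) := by
    have := congrArg (· * z) (gen_braid' ha)
    simp only [mul_assoc, h1, mul_smul_comm] at this
    exact this.symm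
  simp only [add_mul, mul_add, one_mul, mul_assoc, h1, mul_smul_comm, h3, smul_add]
  abel

theorem torsion₄' {a c : Fin 3} (ha : a ≠ 1) (hc : c ≠ 1) (hac : a ≠ c) {z : H}
    (hz : LInv {c}ᶜ z) : h {1}ᶜ {c} * (h {a}ᶜ {1} * z) =
      h Finset.univ {c}ᶜ * z + (X : ℤ[X]) • (h {1}ᶜ {a} * z) := by
  rw [h_comm hc ha hac.symm, h_adj ha ha hac hc.symm, h_univ_compl ha hc hac, h_comm ha hc hac]
  have h1 := hz a (by simpa using hac)
  have h3 : gen a * (gen c * z) = (X : ℤ[X]) • (gen c * z) := by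
    rw [← mul_assoc, gen_comm' ha hc, mul_assoc, h1, mul_smul_comm]
  simp only [add_mul, mul_add, one_mul, mul_assoc, h1, h3, smul_add]
  abel

end HeckeS4
end

noncomputable section
namespace HeckeS4

/-! ## Algebras with the generators and relations of the Hasse quiver -/

/-- The quotient of the Poincaré polynomials of `S ∖ {t}` and of `{s}`. -/
def ratio₂ (t : Fin 3) : ℤ[X] := if t = 1 then 1 + X else 1 + X + X ^ 2

/-- The quotient of the Poincaré polynomials of `S` and of `S ∖ {t}`. -/
def ratio₃ (t : Fin 3) : ℤ[X] :=
  if t = 1 then (1 + X + X ^ 2) * (1 + X ^ 2) else 1 + X + X ^ 2 + X ^ 3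

/-- An algebra generated by idempotents `e I` and by elements `u₁ s`, `u₂ s t`, `u₃ t` and
`d₁ s`, `d₂ t s`, `d₃ t`, in the roles of the arrows `υ` and `δ` between `∅`, `{s}`, `S ∖ {t}` and
`S`, that satisfy the relations of the Hasse quiver. -/
structure HasseAlg (B : Type) [Ring B] [Algebra ℤ[X] B] where
  e : Finset (Fin 3) → B
  u₁ : Fin 3 → B
  d₁ : Fin 3 → B
  u₂ : Fin 3 → Fin 3 → B
  d₂ : Fin 3 → Fin 3 → B
  u₃ : Fin 3 → B
  d₃ : Fin 3 → B
  idem : ∀ I, e I * e I = e I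
  orth : ∀ I J, I ≠ J → e I * e J = 0
  e_sum : ∑ I, e I = 1
  u₁_left : ∀ s, e ∅ * u₁ s = u₁ s
  u₁_right : ∀ s, u₁ s * e {s} = u₁ s
  d₁_left : ∀ s, e {s} * d₁ s = d₁ s
  d₁_right : ∀ s, d₁ s * e ∅ = d₁ s
  u₂_left : ∀ s t, e {s} * u₂ s t = u₂ s t
  u₂_right : ∀ s t, u₂ s t * e {t}ᶜ = u₂ s t
  d₂_left : ∀ t s, e {t}ᶜ * d₂ t s = d₂ t s
  d₂_right : ∀ t s, d₂ t s * e {s} = d₂ t s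
  u₃_left : ∀ t, e {t}ᶜ * u₃ t = u₃ t
  u₃_right : ∀ t, u₃ t * e Finset.univ = u₃ t
  d₃_left : ∀ t, e Finset.univ * d₃ t = d₃ t
  d₃_right : ∀ t, d₃ t * e {t}ᶜ = d₃ t
  quasi₁ : ∀ s, d₁ s * u₁ s = (1 + X : ℤ[X]) • e {s}
  quasi₂ : ∀ t s, s ≠ t → d₂ t s * u₂ s t = ratio₂ t • e {t}ᶜ
  quasi₃ : ∀ t, d₃ t * u₃ t = ratio₃ t • e Finset.univ
  sand_u₁ : ∀ r s t, r ≠ t → s ≠ t → u₁ r * u₂ r t = u₁ s * u₂ s t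
  sand_d₁ : ∀ r s t, r ≠ t → s ≠ t → d₂ t r * d₁ r = d₂ t s * d₁ s
  sand_u₂ : ∀ s r t, s ≠ r → s ≠ t → u₂ s r * u₃ r = u₂ s t * u₃ t
  sand_d₂ : ∀ s r t, s ≠ r → s ≠ t → d₃ r * d₂ r s = d₃ t * d₂ t s
  tors₁ : ∀ r s t, r ≠ 1 → r ≠ s → r ≠ t → s ≠ t →
    d₁ s * (u₁ t * (d₁ t * u₁ s)) = u₂ s r * d₂ r s + (X : ℤ[X]) • e {s}
  tors₂ : ∀ a c, a ≠ 1 → c ≠ 1 → a ≠ c → d₁ a * u₁ c = u₂ a 1 * d₂ 1 c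
  tors₃ : ∀ a c, a ≠ 1 → c ≠ 1 → a ≠ c → d₂ c a * (u₂ a 1 * (d₂ 1 a * u₂ a c)) =
    u₃ c * d₃ c + (X * (X + 1) : ℤ[X]) • e {c}ᶜ
  tors₄ : ∀ a c, a ≠ 1 → c ≠ 1 → a ≠ c → d₂ c 1 * (u₂ 1 a * (d₂ a c * u₂ c 1)) =
    u₃ c * d₃ 1 + (X : ℤ[X]) • (d₂ c a * u₂ a 1)
  tors₄' : ∀ a c, a ≠ 1 → c ≠ 1 → a ≠ c → d₂ 1 c * (u₂ c a * (d₂ a 1 * u₂ 1 c)) =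
    u₃ 1 * d₃ c + (X : ℤ[X]) • (d₂ 1 a * u₂ a c)
  adjoin_eq : Algebra.adjoin ℤ[X] (Set.range e ∪ (Set.range u₁ ∪ Set.range d₁) ∪
    {b | ∃ s t, s ≠ t ∧ (b = u₂ s t ∨ b = d₂ t s)} ∪ (Set.range u₃ ∪ Set.range d₃)) = ⊤

namespace HasseAlg

variable {B : Type} [Ring B] [Algebra ℤ[X] B] (P : HasseAlg B)

theorem adjoin_induction {Q : B → Prop} (b : B) (hC : ∀ c : ℤ[X], Q (algebraMap _ _ c))
    (hadd : ∀ a b, Q a → Q b → Q (a + b)) (hmul : ∀ a b, Q a → Q b → Q (a * b))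
    (he : ∀ I, Q (P.e I)) (hu₁ : ∀ s, Q (P.u₁ s)) (hd₁ : ∀ s, Q (P.d₁ s))
    (hu₂ : ∀ s t, s ≠ t → Q (P.u₂ s t)) (hd₂ : ∀ t s, s ≠ t → Q (P.d₂ t s))
    (hu₃ : ∀ t, Q (P.u₃ t)) (hd₃ : ∀ t, Q (P.d₃ t)) : Q b := by
  have hb : b ∈ (⊤ : Subalgebra ℤ[X] B) := trivial
  rw [← P.adjoin_eq] at hb
  induction hb using Algebra.adjoin_induction with
  | mem x hx =>
    rcases hx with ((⟨I, rfl⟩ | ⟨s, rfl⟩ | ⟨s, rfl⟩) | ⟨s, t, hst, rfl | rfl⟩) | ⟨s, rfl⟩ | ⟨s, rfl⟩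
    · exact he I
    · exact hu₁ s
    · exact hd₁ s
    · exact hu₂ s t hst
    · exact hd₂ t s hst
    · exact hu₃ s
    · exact hd₃ s
  | algebraMap r => exact hC r
  | add x y _ _ hx hy => exact hadd x y hx hy
  | mul x y _ _ hx hy => exact hmul x y hx hy

/-- A family of submodules that is stable under the generators contains the left ideal generated
by an idempotent. -/
theorem e_mul_mem {F : Finset (Fin 3) → Submodule ℤ[X] B} {K : Finset (Fin 3)} (hK : P.e K ∈ F K)
    (hu₁ : ∀ s, ∀ y ∈ F {s}, P.u₁ s * y ∈ F ∅) (hd₁ : ∀ s, ∀ y ∈ F ∅, P.d₁ s * y ∈ F {s})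
    (hu₂ : ∀ s t, s ≠ t → ∀ y ∈ F {t}ᶜ, P.u₂ s t * y ∈ F {s})
    (hd₂ : ∀ t s, s ≠ t → ∀ y ∈ F {s}, P.d₂ t s * y ∈ F {t}ᶜ)
    (hu₃ : ∀ t, ∀ y ∈ F Finset.univ, P.u₃ t * y ∈ F {t}ᶜ)
    (hd₃ : ∀ t, ∀ y ∈ F {t}ᶜ, P.d₃ t * y ∈ F Finset.univ) (b : B) (I : Finset (Fin 3)) :
    P.e I * (b * P.e K) ∈ F I := by
  have arrow : ∀ (α : B) (I J : Finset (Fin 3)), P.e I * α = α → α * P.e J = α →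
      (∀ y ∈ F J, α * y ∈ F I) → ∀ y, (∀ L, P.e L * y ∈ F L) → ∀ L, P.e L * (α * y) ∈ F L := by
    intro α I J hI hJ hα y hy L
    by_cases hL : L = I
    · subst hL
      rw [← mul_assoc, hI, ← hJ, mul_assoc]
      exact hα _ (hy J)
    · rw [← hI, ← mul_assoc, ← mul_assoc, P.orth L I hL, zero_mul, zero_mul]
      exact zero_mem _
  have key : ∀ y, (∀ L, P.e L * y ∈ F L) → ∀ L, P.e L * (b * y) ∈ F L := by
    induction b using P.adjoin_induction with
    | hC c =>
      intro y hy L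
      rw [Algebra.algebraMap_eq_smul_one, smul_mul_assoc, one_mul, mul_smul_comm]
      exact Submodule.smul_mem _ _ (hy L)
    | hadd a b ha hb =>
      intro y hy L
      rw [add_mul, mul_add]
      exact add_mem (ha y hy L) (hb y hy L)
    | hmul a b ha hb =>
      intro y hy L
      rw [mul_assoc]
      exact ha _ (hb y hy) L
    | he I =>
      intro y hy L
      by_cases hL : L = I
      · rw [← mul_assoc, hL, P.idem]
        exact hy I
      · rw [← mul_assoc, P.orth L I hL, zero_mul]
        exact zero_mem _
    | hu₁ s => exact arrow _ _ _ (P.u₁_left s) (P.u₁_right s) (hu₁ s)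
    | hd₁ s => exact arrow _ _ _ (P.d₁_left s) (P.d₁_right s) (hd₁ s)
    | hu₂ s t h => exact arrow _ _ _ (P.u₂_left s t) (P.u₂_right s t) (hu₂ s t h)
    | hd₂ t s h => exact arrow _ _ _ (P.d₂_left t s) (P.d₂_right t s) (hd₂ t s h)
    | hu₃ t => exact arrow _ _ _ (P.u₃_left t) (P.u₃_right t) (hu₃ t)
    | hd₃ t => exact arrow _ _ _ (P.d₃_left t) (P.d₃_right t) (hd₃ t)
  refine key _ (fun L => ?_) I
  by_cases hL : L = K
  · rw [hL, P.idem]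
    exact hK
  · rw [P.orth L K hL]
    exact zero_mem _

open MulOpposite in
/-- The anti-involution exchanging `υ` and `δ`. -/
def opp : HasseAlg Bᵐᵒᵖ where
  e I := op (P.e I)
  u₁ s := op (P.d₁ s)
  d₁ s := op (P.u₁ s)
  u₂ s t := op (P.d₂ t s)
  d₂ t s := op (P.u₂ s t)
  u₃ t := op (P.d₃ t)
  d₃ t := op (P.u₃ t)
  idem I := congrArg op (P.idem I)
  orth I J h := congrArg op (P.orth J I h.symm)
  e_sum := by rw [← Finset.op_sum, P.e_sum, op_one]
  u₁_left s := congrArg op (P.d₁_right s)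
  u₁_right s := congrArg op (P.d₁_left s)
  d₁_left s := congrArg op (P.u₁_right s)
  d₁_right s := congrArg op (P.u₁_left s)
  u₂_left s t := congrArg op (P.d₂_right t s)
  u₂_right s t := congrArg op (P.d₂_left t s)
  d₂_left t s := congrArg op (P.u₂_right s t)
  d₂_right t s := congrArg op (P.u₂_left s t)
  u₃_left t := congrArg op (P.d₃_right t)
  u₃_right t := congrArg op (P.d₃_left t)
  d₃_left t := congrArg op (P.u₃_right t)
  d₃_right t := congrArg op (P.u₃_left t)
  quasi₁ s := congrArg op (P.quasi₁ s)
  quasi₂ t s h := congrArg op (P.quasi₂ t s h)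
  quasi₃ t := congrArg op (P.quasi₃ t)
  sand_u₁ r s t h h' := congrArg op (P.sand_d₁ r s t h h')
  sand_d₁ r s t h h' := congrArg op (P.sand_u₁ r s t h h')
  sand_u₂ s r t h h' := congrArg op (P.sand_d₂ s r t h h')
  sand_d₂ s r t h h' := congrArg op (P.sand_u₂ s r t h h')
  tors₁ r s t h1 h2 h3 h4 := by
    have := P.tors₁ r s t h1 h2 h3 h4
    simp only [← mul_assoc] at this
    exact congrArg op this
  tors₂ a c ha hc hac := congrArg op (P.tors₂ c a hc ha hac.symm)
  tors₃ a c ha hc hac := by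
    have := P.tors₃ a c ha hc hac
    simp only [← mul_assoc] at this
    exact congrArg op this
  tors₄ a c ha hc hac := by
    have := P.tors₄' a c ha hc hac
    simp only [← mul_assoc] at this
    exact congrArg op this
  tors₄' a c ha hc hac := by
    have := P.tors₄ a c ha hc hac
    simp only [← mul_assoc] at this
    exact congrArg op this
  adjoin_eq := by
    rw [eq_top_iff]
    rintro b -
    obtain ⟨b, rfl⟩ := op_surjective b
    induction b using P.adjoin_induction with
    | hC c => exact Subalgebra.algebraMap_mem _ c
    | hadd a b ha hb => exact add_mem ha hb
    | hmul a b ha hb => exact mul_mem hb ha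
    | he I => exact Algebra.subset_adjoin (.inl (.inl (.inl ⟨I, rfl⟩)))
    | hu₁ s => exact Algebra.subset_adjoin (.inl (.inl (.inr (.inr ⟨s, rfl⟩))))
    | hd₁ s => exact Algebra.subset_adjoin (.inl (.inl (.inr (.inl ⟨s, rfl⟩))))
    | hu₂ s t h => exact Algebra.subset_adjoin (.inl (.inr ⟨s, t, h, .inr rfl⟩))
    | hd₂ t s h => exact Algebra.subset_adjoin (.inl (.inr ⟨s, t, h, .inl rfl⟩))
    | hu₃ t => exact Algebra.subset_adjoin (.inr (.inr ⟨t, rfl⟩))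
    | hd₃ t => exact Algebra.subset_adjoin (.inr (.inl ⟨t, rfl⟩))

/-! ### The Hecke algebra in the corner of the empty set -/

/-- The element `χ_s`. -/
def chi (s : Fin 3) : B := P.u₁ s * P.d₁ s

theorem e_mul_chi (s : Fin 3) : P.e ∅ * P.chi s = P.chi s := by
  rw [chi, ← mul_assoc, P.u₁_left]

theorem chi_mul_e (s : Fin 3) : P.chi s * P.e ∅ = P.chi s := by
  rw [chi, mul_assoc, P.d₁_right]

theorem d₁_mul_chi (s : Fin 3) : P.d₁ s * P.chi s = (1 + X : ℤ[X]) • P.d₁ s := by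
  rw [chi, ← mul_assoc, P.quasi₁, smul_mul_assoc, P.d₁_left]

theorem chi_mul_chi (s : Fin 3) : P.chi s * P.chi s = (1 + X : ℤ[X]) • P.chi s := by
  have h := congrArg (P.u₁ s * ·) (P.d₁_mul_chi s)
  simpa only [mul_smul_comm, ← mul_assoc, chi] using h

/-- (T2) turns the middle of χ_a χ_c into a passage through S ∖ {1}; by the sandwich relations the
resulting path no longer depends on the order of a and c. -/
theorem chi_comm {a c : Fin 3} (ha : a ≠ 1) (hc : c ≠ 1) (hac : a ≠ c) :
    P.chi a * P.chi c = P.chi c * P.chi a := by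
  have key : ∀ a c : Fin 3, a ≠ 1 → c ≠ 1 → a ≠ c →
      P.chi a * P.chi c = P.u₁ a * P.u₂ a 1 * (P.d₂ 1 c * P.d₁ c) := by
    intro a c ha hc hac
    rw [chi, chi, mul_assoc, ← mul_assoc (P.d₁ a), P.tors₂ a c ha hc hac]
    simp only [mul_assoc]
  rw [key a c ha hc hac, key c a hc ha hac.symm, P.sand_u₁ a c 1 ha hc, P.sand_d₁ a c 1 ha hc]

/-- By (T1) the left side is the path from ∅ to {s, t} and back through {s}; the sandwich relations
allow {t} in place of {s}. -/
theorem chi_braid {r s t : Fin 3} (hr : r ≠ 1) (hrs : r ≠ s) (hrt : r ≠ t) (hst : s ≠ t) :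
    P.chi s * (P.chi t * P.chi s) - (X : ℤ[X]) • P.chi s =
      P.chi t * (P.chi s * P.chi t) - (X : ℤ[X]) • P.chi t := by
  have key : ∀ r s t : Fin 3, r ≠ 1 → r ≠ s → r ≠ t → s ≠ t →
      P.chi s * (P.chi t * P.chi s) - (X : ℤ[X]) • P.chi s =
        P.u₁ s * P.u₂ s r * (P.d₂ r s * P.d₁ s) := by
    intro r s t hr hrs hrt hst
    have h := congrArg (fun z => P.u₁ s * (z * P.d₁ s)) (P.tors₁ r s t hr hrs hrt hst)
    simp only [add_mul, mul_add, smul_mul_assoc, mul_smul_comm, P.d₁_left, mul_assoc] at h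
    simp only [chi, mul_assoc, h, add_sub_cancel_right]
  rw [key r s t hr hrs hrt hst, key r t s hr hrt hrs hst.symm, P.sand_u₁ s t r hrs.symm hrt.symm,
    P.sand_d₁ s t r hrs.symm hrt.symm]

/-- The image of `T_s`: it acts as `χ_s - 1` on the vertex `∅` and as `q` on the others. -/
def tgen (s : Fin 3) : B := P.chi s - P.e ∅ + (X : ℤ[X]) • (1 - P.e ∅)

theorem tgen_braid {r s t : Fin 3} (hr : r ≠ 1) (hrs : r ≠ s) (hrt : r ≠ t) (hst : s ≠ t) :
    P.tgen s * P.tgen t * P.tgen s = P.tgen t * P.tgen s * P.tgen t := by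
  have h := P.chi_braid hr hrs hrt hst
  rw [sub_eq_iff_eq_add] at h
  simp only [tgen, mul_add, add_mul, mul_sub, sub_mul, smul_mul_assoc, mul_smul_comm, mul_one,
    one_mul, P.idem, P.e_mul_chi, P.chi_mul_e, mul_assoc, smul_sub, smul_add, P.chi_mul_chi, h]
  module

/-- The homomorphism from the Hecke algebra. -/
def theta : H →ₐ[ℤ[X]] B :=
  Hlift P.tgen
    (fun s => by
      simp only [tgen, mul_add, add_mul, mul_sub, sub_mul, smul_mul_assoc, mul_smul_comm, mul_one,
        one_mul, P.idem, P.e_mul_chi, P.chi_mul_e, smul_sub, smul_add, P.chi_mul_chi]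
      module)
    (by
      simp only [tgen, mul_add, add_mul, mul_sub, sub_mul, smul_mul_assoc, mul_smul_comm, mul_one,
        one_mul, P.idem, P.e_mul_chi, P.chi_mul_e, smul_sub, smul_add,
        P.chi_comm (a := 0) (c := 2) (by decide) (by decide) (by decide)]
      module)
    (P.tgen_braid (r := 2) (by decide) (by decide) (by decide) (by decide))
    (P.tgen_braid (r := 0) (by decide) (by decide) (by decide) (by decide))

theorem theta_gen (s : Fin 3) : P.theta (gen s) = P.tgen s := Hlift_gen _ _ _ _ _ s

theorem e_mul_theta_gen (s : Fin 3) : P.e ∅ * P.theta (gen s) = P.chi s - P.e ∅ := by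
  rw [theta_gen, tgen, mul_add, mul_sub, mul_smul_comm, mul_sub, mul_one, P.idem, P.e_mul_chi,
    sub_self, smul_zero, add_zero]

/-- The path from `∅` to `I`. -/
def D (I : Finset (Fin 3)) : B :=
  if I = ∅ then P.e ∅ else if I.card = 1 then ∑ s ∈ I, P.d₁ s
  else if I.card = 2 then ∑ t ∈ Iᶜ, P.d₂ t (t + 1) * P.d₁ (t + 1)
  else P.d₃ 0 * (P.d₂ 0 1 * P.d₁ 1)

theorem D_empty : P.D ∅ = P.e ∅ := if_pos rfl

theorem D_single (s : Fin 3) : P.D {s} = P.d₁ s := by simp [D]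

/-- The sandwich relations make the path from ∅ independent of the intermediate vertices. -/
theorem D_compl {s t : Fin 3} (h : s ≠ t) : P.D {t}ᶜ = P.d₂ t s * P.d₁ s := by
  have h1 : ({t}ᶜ : Finset (Fin 3)) ≠ ∅ := by clear h; revert t; decide
  have h2 : ({t}ᶜ : Finset (Fin 3)).card = 2 := by clear h h1; revert t; decide
  have h3 : t + 1 ≠ t := by clear h h1 h2; revert t; decide
  rw [D, if_neg h1, h2, if_neg (by decide), if_pos rfl, compl_compl, Finset.sum_singleton,
    P.sand_d₁ _ _ _ h3 h]

theorem D_univ (t : Fin 3) : P.D Finset.univ = P.d₃ t * P.D {t}ᶜ := by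
  have h0 : P.D Finset.univ = P.d₃ 0 * (P.d₂ 0 1 * P.d₁ 1) := by
    rw [D, if_neg (by decide), if_neg (by decide), if_neg (by decide)]
  rw [h0, ← P.D_compl (by decide)]
  by_cases ht : t = 0
  · rw [ht]
  obtain ⟨s, hs, hst⟩ : ∃ s : Fin 3, s ≠ 0 ∧ s ≠ t := by revert t; decide
  rw [P.D_compl hs, P.D_compl hst, ← mul_assoc, ← mul_assoc, P.sand_d₂ s 0 t hs hst]

theorem D_mul_e (I : Finset (Fin 3)) : P.D I * P.e ∅ = P.D I := by
  rw [D]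
  split_ifs
  · exact P.idem ∅
  · simp only [Finset.sum_mul, P.d₁_right]
  · simp only [Finset.sum_mul, mul_assoc, P.d₁_right]
  · simp only [mul_assoc, P.d₁_right]

/-- The linear map `h ↦ D_I θ(h)`. -/
def Dtheta (I : Finset (Fin 3)) : H →ₗ[ℤ[X]] B :=
  LinearMap.mulLeft ℤ[X] (P.D I) ∘ₗ P.theta.toLinearMap

theorem Dtheta_apply (I : Finset (Fin 3)) (h : H) : P.Dtheta I h = P.D I * P.theta h := rfl

theorem D_mul_chi (I : Finset (Fin 3)) (s : Fin 3) (h : H) :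
    P.D I * (P.chi s * P.theta h) = P.Dtheta I ((1 + gen s) * h) := by
  rw [Dtheta_apply, map_mul, map_add, map_one, ← P.D_mul_e, mul_assoc, mul_assoc,
    ← mul_assoc (P.e ∅) (1 + _), mul_add, mul_one, e_mul_theta_gen, add_sub_cancel,
    ← mul_assoc (P.e ∅), e_mul_chi]

/-- If t = 1, (T2) rewrites the passage from {r} through {t}ᶜ to {s} as d₁ u₁ through ∅. Otherwise
(T1) rewrites the loop at {s} through {t}ᶜ as d₁ χ_r u₁ − q. In both cases D_{s} is followed on its
right by elements of the Hecke algebra. -/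
theorem u₂_mul_mem {s t : Fin 3} (hst : s ≠ t) (h : H) :
    P.u₂ s t * P.Dtheta {t}ᶜ h ∈ LinearMap.range (P.Dtheta {s}) := by
  obtain ⟨r, hrs, hrt⟩ : ∃ r : Fin 3, r ≠ s ∧ r ≠ t := by revert s t; decide
  by_cases ht : t = 1
  · subst ht
    refine ⟨(1 + gen r) * h, ?_⟩
    rw [← D_mul_chi, Dtheta_apply, P.D_compl hrt, P.D_single, chi]
    have := P.tors₂ s r hst hrt hrs.symm
    simp only [← mul_assoc, this]
  · have h1 := congrArg (fun z => z * (P.d₁ s * P.theta h))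
      (P.tors₁ t s r ht hst.symm hrt.symm hrs.symm)
    simp only [add_mul, smul_mul_assoc, mul_assoc] at h1
    rw [← mul_assoc (P.e {s}), P.d₁_left] at h1
    refine ⟨(1 + gen r) * ((1 + gen s) * h) + (-X : ℤ[X]) • h, ?_⟩
    rw [map_add, map_smul, neg_smul, ← sub_eq_add_neg, ← D_mul_chi, map_mul, map_add, map_one, ← P.D_mul_e, mul_assoc,
      ← mul_assoc (P.e ∅) (P.chi r), e_mul_chi, ← P.chi_mul_e, mul_assoc (P.chi r),
      ← mul_assoc (P.e ∅), mul_add, mul_one, e_mul_theta_gen, add_sub_cancel, Dtheta_apply,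
      Dtheta_apply, P.D_single, P.D_compl hst, chi, chi]
    simp only [mul_assoc]
    rw [h1, add_sub_cancel_right]

theorem d₂_mul_mem {s t : Fin 3} (hst : s ≠ t) (h : H) :
    P.d₂ t s * P.Dtheta {s} h = P.Dtheta {t}ᶜ h := by
  rw [Dtheta_apply, Dtheta_apply, P.D_compl hst, P.D_single, mul_assoc]

/-- The left ideal of the vertex `∅`. -/
theorem e_mul_mul_e_empty (b : B) (I : Finset (Fin 3)) :
    P.e I * (b * P.e ∅) ∈ LinearMap.range (P.Dtheta I) := by
  have hu₂ : ∀ s t, s ≠ t → ∀ y ∈ LinearMap.range (P.Dtheta {t}ᶜ),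
      P.u₂ s t * y ∈ LinearMap.range (P.Dtheta {s}) := by
    rintro s t hst _ ⟨h, rfl⟩
    exact P.u₂_mul_mem hst h
  have hd₂ : ∀ t s, s ≠ t → ∀ y ∈ LinearMap.range (P.Dtheta {s}),
      P.d₂ t s * y ∈ LinearMap.range (P.Dtheta {t}ᶜ) := by
    rintro t s hst _ ⟨h, rfl⟩
    exact ⟨h, (P.d₂_mul_mem hst h).symm⟩
  refine P.e_mul_mem (F := fun I => LinearMap.range (P.Dtheta I)) ?_ ?_ ?_ hu₂ hd₂ ?_ ?_ b I
  · exact ⟨1, by rw [Dtheta_apply, map_one, mul_one, D_empty]⟩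
  · rintro s _ ⟨h, rfl⟩
    refine ⟨(1 + gen s) * h, ?_⟩
    rw [← D_mul_chi, D_empty, ← mul_assoc, e_mul_chi, chi, Dtheta_apply, D_single, mul_assoc]
  · rintro s _ ⟨h, rfl⟩
    exact ⟨h, by rw [Dtheta_apply, Dtheta_apply, D_single, D_empty, ← mul_assoc, d₁_right]⟩
  -- Arrows leaving S are eliminated: D_S ends with some d₃, and (T4′) for t = 1 or (T3) for the end
  -- nodes expresses u₃ d₃ by paths that avoid S.
  · intro t y hy
    by_cases ht : t = 1
    · subst ht
      obtain ⟨h, rfl⟩ := hy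
      have h1 := congrArg (fun z => z * P.Dtheta {2}ᶜ h)
        (P.tors₄' 0 2 (by decide) (by decide) (by decide))
      simp only [add_mul, smul_mul_assoc, mul_assoc] at h1
      rw [Dtheta_apply, P.D_univ 2, mul_assoc, ← Dtheta_apply, ← sub_eq_iff_eq_add.2 h1]
      refine sub_mem ?_ (Submodule.smul_mem _ _ ?_)
      · exact hd₂ _ _ (by decide) _ (hu₂ _ _ (by decide) _ (hd₂ _ _ (by decide) _
          (hu₂ _ _ (by decide) _ ⟨h, rfl⟩)))
      · exact hd₂ _ _ (by decide) _ (hu₂ _ _ (by decide) _ ⟨h, rfl⟩)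
    · obtain ⟨h, rfl⟩ := hy
      obtain ⟨a, ha, hat⟩ : ∃ a : Fin 3, a ≠ 1 ∧ a ≠ t := by revert t; decide
      have h1 := congrArg (fun z => z * P.Dtheta {t}ᶜ h) (P.tors₃ a t ha ht hat)
      simp only [add_mul, smul_mul_assoc, mul_assoc] at h1
      rw [Dtheta_apply, P.D_univ t, mul_assoc, ← Dtheta_apply, ← sub_eq_iff_eq_add.2 h1]
      refine sub_mem ?_ (Submodule.smul_mem _ _ ?_)
      · exact hd₂ _ _ hat _ (hu₂ _ _ ha _ (hd₂ _ _ ha _ (hu₂ _ _ hat _ ⟨h, rfl⟩)))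
      · refine ⟨h, ?_⟩
        rw [Dtheta_apply, P.D_compl hat]
        simp only [← mul_assoc, P.d₂_left]
  · rintro t _ ⟨h, rfl⟩
    exact ⟨h, by rw [Dtheta_apply, Dtheta_apply, P.D_univ t, mul_assoc]⟩

end HasseAlg
end HeckeS4
end

noncomputable section
namespace HeckeS4
namespace HasseAlg

theorem mul_tail {A : Type*} [Semigroup A] {x y w : A} (h : x * y = w) (z : A) :
    x * (y * z) = w * z := by
  rw [← mul_assoc, h]

variable {B : Type} [Ring B] [Algebra ℤ[X] B] (P : HasseAlg B)

/-! ### The quotient by the ideal of the vertex `∅` -/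

theorem mul_mem_of_mem_span_pair {F : Submodule ℤ[X] B} {α x₁ x₂ : B} (h₁ : α * x₁ ∈ F)
    (h₂ : α * x₂ ∈ F) : ∀ y ∈ Submodule.span ℤ[X] {x₁, x₂}, α * y ∈ F := by
  intro y hy
  obtain ⟨p, q, rfl⟩ := Submodule.mem_span_pair.1 hy
  rw [mul_add, mul_smul_comm, mul_smul_comm]
  exact add_mem (Submodule.smul_mem _ _ h₁) (Submodule.smul_mem _ _ h₂)

theorem label_cases {a c : Fin 3} (ha : a ≠ 1) (hc : c ≠ 1) (hac : a ≠ c) :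
    a = 0 ∧ c = 2 ∨ a = 2 ∧ c = 0 := by
  revert a c; decide

theorem u₁_eq_zero (h0 : P.e ∅ = 0) (s : Fin 3) : P.u₁ s = 0 := by
  rw [← P.u₁_left, h0, zero_mul]

theorem d₁_eq_zero (h0 : P.e ∅ = 0) (s : Fin 3) : P.d₁ s = 0 := by
  rw [← P.d₁_right, h0, mul_zero]

/-- The form of `e_mul_mem` for the quotient in which the vertex ∅ has disappeared: one submodule
for each of the seven other vertices, named by its elements with b standing for the middle node 1,
and one hypothesis for each of the eighteen remaining arrows. -/
theorem e_mul_mem_of_label (h0 : P.e ∅ = 0) {a c : Fin 3} (ha : a ≠ 1) (hc : c ≠ 1) (hac : a ≠ c)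
    {Fa Fb Fc Fab Fbc Fac Fs : Submodule ℤ[X] B} {K : Finset (Fin 3)}
    (hK : K = {a} ∧ P.e {a} ∈ Fa ∨ K = {c}ᶜ ∧ P.e {c}ᶜ ∈ Fab ∨ K = {1}ᶜ ∧ P.e {1}ᶜ ∈ Fac)
    (h1 : ∀ y ∈ Fa, P.d₂ c a * y ∈ Fab) (h2 : ∀ y ∈ Fa, P.d₂ 1 a * y ∈ Fac)
    (h3 : ∀ y ∈ Fb, P.d₂ c 1 * y ∈ Fab) (h4 : ∀ y ∈ Fb, P.d₂ a 1 * y ∈ Fbc)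
    (h5 : ∀ y ∈ Fc, P.d₂ a c * y ∈ Fbc) (h6 : ∀ y ∈ Fc, P.d₂ 1 c * y ∈ Fac)
    (h7 : ∀ y ∈ Fab, P.u₂ a c * y ∈ Fa) (h8 : ∀ y ∈ Fab, P.u₂ 1 c * y ∈ Fb)
    (h9 : ∀ y ∈ Fbc, P.u₂ 1 a * y ∈ Fb) (h10 : ∀ y ∈ Fbc, P.u₂ c a * y ∈ Fc)
    (h11 : ∀ y ∈ Fac, P.u₂ a 1 * y ∈ Fa) (h12 : ∀ y ∈ Fac, P.u₂ c 1 * y ∈ Fc)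
    (h13 : ∀ y ∈ Fab, P.d₃ c * y ∈ Fs) (h14 : ∀ y ∈ Fbc, P.d₃ a * y ∈ Fs)
    (h15 : ∀ y ∈ Fac, P.d₃ 1 * y ∈ Fs)
    (h16 : ∀ y ∈ Fs, P.u₃ c * y ∈ Fab) (h17 : ∀ y ∈ Fs, P.u₃ a * y ∈ Fbc)
    (h18 : ∀ y ∈ Fs, P.u₃ 1 * y ∈ Fac) (b : B) :
    P.e {a} * (b * P.e K) ∈ Fa ∧ P.e {c}ᶜ * (b * P.e K) ∈ Fab ∧
      P.e {a}ᶜ * (b * P.e K) ∈ Fbc ∧ P.e {1}ᶜ * (b * P.e K) ∈ Fac := by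
  let F : Finset (Fin 3) → Submodule ℤ[X] B := fun I =>
    if I = {a} then Fa else if I = {1} then Fb else if I = {c} then Fc else if I = {c}ᶜ then Fab
    else if I = {a}ᶜ then Fbc else if I = {1}ᶜ then Fac else if I = Finset.univ then Fs else ⊥
  have hF : F {a} = Fa ∧ F {1} = Fb ∧ F {c} = Fc ∧ F {c}ᶜ = Fab ∧ F {a}ᶜ = Fbc ∧ F {1}ᶜ = Fac ∧
      F Finset.univ = Fs := by
    dsimp only [F]
    rcases label_cases ha hc hac with ⟨rfl, rfl⟩ | ⟨rfl, rfl⟩ <;> refine ⟨?_, ?_, ?_, ?_, ?_, ?_, ?_⟩ <;>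
    repeat (first | rw [if_pos rfl] | rw [if_neg (by decide)])
  clear_value F
  obtain ⟨ea, eb, ec, eab, ebc, eac, es⟩ := hF
  have hs : ∀ s : Fin 3, s = a ∨ s = 1 ∨ s = c := by
    clear * - ha hc hac
    revert a c; decide
  have key := P.e_mul_mem (F := F) (K := K)
    (by
      rcases hK with ⟨rfl, hK⟩ | ⟨rfl, hK⟩ | ⟨rfl, hK⟩
      · rw [ea]; exact hK
      · rw [eab]; exact hK
      · rw [eac]; exact hK)
    (fun s y _ => by rw [P.u₁_eq_zero h0, zero_mul]; exact zero_mem _)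
    (fun s y _ => by rw [P.d₁_eq_zero h0, zero_mul]; exact zero_mem _)
    (by
      intro s t hst
      rcases hs s with rfl | rfl | rfl <;> rcases hs t with rfl | rfl | rfl <;>
        simp only [ea, eb, ec, eab, ebc, eac] <;> first | assumption | exact absurd rfl hst)
    (by
      intro t s hst
      rcases hs s with rfl | rfl | rfl <;> rcases hs t with rfl | rfl | rfl <;>
        simp only [ea, eb, ec, eab, ebc, eac] <;> first | assumption | exact absurd rfl hst)
    (by
      intro t
      rcases hs t with rfl | rfl | rfl <;> simp only [es, eab, ebc, eac] <;> assumption)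
    (by
      intro t
      rcases hs t with rfl | rfl | rfl <;> simp only [es, eab, ebc, eac] <;> assumption) b
  refine ⟨?_, ?_, ?_, ?_⟩
  · rw [← ea]; exact key _
  · rw [← eab]; exact key _
  · rw [← ebc]; exact key _
  · rw [← eac]; exact key _

/-- (1 + q) e_{s} = d₁ u₁ factors through ∅. So in the quotient q acts as −1 on everything that
starts at a singleton, and 1 + q + q² acts as 1. -/
theorem one_add_X_smul (h0 : P.e ∅ = 0) {s : Fin 3} {y : B} (hy : y * P.e {s} = y) :
    (1 + X : ℤ[X]) • y = 0 := by
  rw [← hy, ← mul_smul_comm, ← P.quasi₁, P.u₁_eq_zero h0, mul_zero, mul_zero]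

theorem X_smul (h0 : P.e ∅ = 0) {s : Fin 3} {y : B} (hy : y * P.e {s} = y) :
    (X : ℤ[X]) • y = -y := by
  have := P.one_add_X_smul h0 hy
  rw [add_smul, one_smul, add_comm] at this
  exact eq_neg_of_add_eq_zero_left this

theorem ratio₂_smul (h0 : P.e ∅ = 0) {s t : Fin 3} (ht : t ≠ 1) {y : B} (hy : y * P.e {s} = y) :
    ratio₂ t • y = y := by
  have h := P.one_add_X_smul h0 hy
  have e : ratio₂ t = 1 + X * (1 + X) := by
    rw [ratio₂, if_neg ht]
    ring
  rw [e, add_smul, one_smul, mul_smul, h, smul_zero, add_zero]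

/-- The left side of (T1) passes through ∅ and vanishes, and −q acts as 1 at {s}. -/
theorem u₂_mul_d₂ (h0 : P.e ∅ = 0) {r s : Fin 3} (hr : r ≠ 1) (hrs : r ≠ s) :
    P.u₂ s r * P.d₂ r s = P.e {s} := by
  obtain ⟨t, hrt, hst⟩ : ∃ t : Fin 3, r ≠ t ∧ s ≠ t := by
    clear * - hrs
    revert r s; decide
  have := P.tors₁ r s t hr hrs hrt hst
  rw [P.d₁_eq_zero h0, zero_mul, P.X_smul h0 (P.idem {s})] at this
  exact (eq_neg_of_add_eq_zero_left this.symm).trans (neg_neg _)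

theorem u₂_one_mul_d₂_one (h0 : P.e ∅ = 0) {a c : Fin 3} (ha : a ≠ 1) (hc : c ≠ 1) (hac : a ≠ c) :
    P.u₂ a 1 * P.d₂ 1 c = 0 := by
  rw [← P.tors₂ a c ha hc hac, P.d₁_eq_zero h0, zero_mul]

theorem d₂_u₂_tail {t s : Fin 3} (hst : s ≠ t) {z : B} (hz : P.e {t}ᶜ * z = z) :
    P.d₂ t s * (P.u₂ s t * z) = ratio₂ t • z := by
  rw [mul_tail (P.quasi₂ t s hst), smul_mul_assoc, hz]

/-- The endomorphism `υ δ` of `{a}` through `{a, c}`. -/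
def loop (a : Fin 3) : B := P.u₂ a 1 * P.d₂ 1 a

/-- The path from `{a}` to `{1}` through `{a, 1} = S ∖ {c}`. -/
def step (a c : Fin 3) : B := P.u₂ 1 c * P.d₂ c a

/-- The path from `{a}` to `{c}` through `{1}`. -/
def walk (a c : Fin 3) : B := P.u₂ c a * (P.d₂ a 1 * P.step a c)

theorem loop_right (a : Fin 3) : P.loop a * P.e {a} = P.loop a := by
  rw [loop, mul_assoc, P.d₂_right]

theorem loop_left (a : Fin 3) : P.e {a} * P.loop a = P.loop a := by
  rw [loop, ← mul_assoc, P.u₂_left]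

theorem step_right (a c : Fin 3) : P.step a c * P.e {a} = P.step a c := by
  rw [step, mul_assoc, P.d₂_right]

theorem step_left (a c : Fin 3) : P.e {1} * P.step a c = P.step a c := by
  rw [step, ← mul_assoc, P.u₂_left]

section

variable (h0 : P.e ∅ = 0) {a c : Fin 3} (ha : a ≠ 1) (hc : c ≠ 1) (hac : a ≠ c)

include h0

theorem d₂_one_mul_loop {a : Fin 3} (ha : a ≠ 1) : P.d₂ 1 a * P.loop a = 0 := by
  rw [loop, P.d₂_u₂_tail ha (P.d₂_left _ _), ratio₂, if_pos rfl]
  exact P.one_add_X_smul h0 (P.d₂_right _ _)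

theorem d₂_mul_step {a c : Fin 3} (hc : c ≠ 1) : P.d₂ c 1 * P.step a c = P.d₂ c a := by
  rw [step, P.d₂_u₂_tail hc.symm (P.d₂_left _ _), P.ratio₂_smul h0 hc (P.d₂_right _ _)]

theorem d₂_mul_walk {a c : Fin 3} (ha : a ≠ 1) (hac : a ≠ c) : P.d₂ a c * P.walk a c = P.d₂ a 1 * P.step a c := by
  rw [walk, P.d₂_u₂_tail hac.symm, P.ratio₂_smul h0 ha (s := a)]
  · rw [mul_assoc, P.step_right]
  · rw [← mul_assoc, P.d₂_left]

include ha hc hac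

/-- Both sides equal the path from {a} to {c} through S. This comes from (T4) and (T4′) with arrows
attached on both sides: their q-terms die by (T2), and the sandwich relations identify the two paths
through S. -/
theorem walk_mul_loop : P.walk a c * P.loop a = P.loop c * P.walk a c := by
  have h1 := congrArg (fun z => P.u₂ c 1 * (z * P.d₂ c a)) (P.tors₄' a c ha hc hac)
  have h2 := congrArg (fun z => P.u₂ c a * (z * P.d₂ 1 a)) (P.tors₄ c a hc ha hac.symm)
  simp only [add_mul, mul_add, smul_mul_assoc, mul_smul_comm, mul_assoc] at h1 h2
  rw [mul_tail (P.u₂_one_mul_d₂_one h0 hc ha hac.symm), zero_mul, smul_zero, add_zero] at h1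
  rw [P.u₂_one_mul_d₂_one h0 hc ha hac.symm, mul_zero, mul_zero, smul_zero, add_zero] at h2
  rw [mul_tail (P.sand_u₂ c a 1 hac.symm hc), P.sand_d₂ a 1 c ha hac, mul_assoc, ← h1] at h2
  simp only [walk, step, loop, mul_assoc]
  exact h2

theorem d₂_one_mul_walk_mul_loop : P.d₂ 1 c * (P.walk a c * P.loop a) = 0 := by
  rw [P.walk_mul_loop h0 ha hc hac, ← mul_assoc, P.d₂_one_mul_loop h0 hc, zero_mul]

theorem d₃_mul_d₂_mul_step : P.d₃ a * (P.d₂ a 1 * P.step a c) = P.d₃ 1 * P.d₂ 1 a := by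
  rw [mul_tail (P.sand_d₂ 1 a c ha.symm hc.symm), mul_assoc, P.d₂_mul_step h0 hc,
    P.sand_d₂ a c 1 hac ha]

/-- (T3) at the vertex S ∖ {a}, applied to a path that starts at {a}. The scalar q(q + 1) vanishes
there, and `walk_mul_loop` moves the loop to the start of the path. -/
theorem d₂_mul_step_mul_loop :
    P.d₂ a 1 * P.step a c * P.loop a = P.u₃ a * (P.d₃ 1 * P.d₂ 1 a) := by
  have h1 := congrArg (fun z => z * (P.d₂ a 1 * P.step a c)) (P.tors₃ c a hc ha hac.symm)
  have hr : P.d₂ a 1 * P.step a c * P.e {a} = P.d₂ a 1 * P.step a c := by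
    rw [mul_assoc, P.step_right]
  simp only [add_mul, smul_mul_assoc, mul_assoc] at h1
  rw [mul_tail (P.d₂_left _ _), mul_comm X, mul_smul, P.X_smul h0 hr,
    smul_neg, add_comm X, P.one_add_X_smul h0 hr, neg_zero, add_zero,
    P.d₃_mul_d₂_mul_step h0 ha hc hac] at h1
  have h2 : P.u₂ c 1 * (P.d₂ 1 c * P.walk a c) = P.walk a c * P.loop a := by
    rw [← mul_assoc]
    exact (P.walk_mul_loop h0 ha hc hac).symm
  rw [← h1]
  change _ = P.d₂ a c * (P.u₂ c 1 * (P.d₂ 1 c * P.walk a c))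
  rw [h2, mul_tail (P.d₂_mul_walk h0 ha hac)]

/-- The left ideal of the vertex `{a}`, modulo the ideal of the vertex `∅`. -/
theorem e_mul_mul_e_single (b : B) :
    P.e {a} * (b * P.e {a}) ∈ Submodule.span ℤ[X] {P.e {a}, P.loop a} := by
  have mem₁ : ∀ x y : B, x ∈ Submodule.span ℤ[X] {x, y} := fun x y =>
    Submodule.subset_span (Set.mem_insert _ _)
  have mem₂ : ∀ x y : B, y ∈ Submodule.span ℤ[X] {x, y} := fun x y =>
    Submodule.subset_span (Set.mem_insert_of_mem _ rfl)
  have hdd : P.d₃ c * P.d₂ c a = P.d₃ 1 * P.d₂ 1 a := P.sand_d₂ a c 1 hac ha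
  -- Each family is generated by the images of e_{a} and of the loop along chosen paths; only at S ∖
  -- {1} does the second generator come from `walk` instead, since the loop dies there. The zero in
  -- `Fs` is padding: a single element suffices at S.
  refine (P.e_mul_mem_of_label h0 ha hc hac
    (Fab := Submodule.span ℤ[X] {P.d₂ c a, P.d₂ c a * P.loop a})
    (Fbc := Submodule.span ℤ[X] {P.d₂ a 1 * P.step a c, P.d₂ a 1 * P.step a c * P.loop a})
    (Fac := Submodule.span ℤ[X] {P.d₂ 1 a, P.d₂ 1 c * P.walk a c})
    (Fb := Submodule.span ℤ[X] {P.step a c, P.step a c * P.loop a})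
    (Fc := Submodule.span ℤ[X] {P.walk a c, P.walk a c * P.loop a})
    (Fs := Submodule.span ℤ[X] {P.d₃ 1 * P.d₂ 1 a, 0})
    (.inl ⟨rfl, mem₁ _ _⟩) (mul_mem_of_mem_span_pair ?_ ?_) (mul_mem_of_mem_span_pair ?_ ?_)
    (mul_mem_of_mem_span_pair ?_ ?_) (mul_mem_of_mem_span_pair ?_ ?_)
    (mul_mem_of_mem_span_pair ?_ ?_) (mul_mem_of_mem_span_pair ?_ ?_)
    (mul_mem_of_mem_span_pair ?_ ?_) (mul_mem_of_mem_span_pair ?_ ?_)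
    (mul_mem_of_mem_span_pair ?_ ?_) (mul_mem_of_mem_span_pair ?_ ?_)
    (mul_mem_of_mem_span_pair ?_ ?_) (mul_mem_of_mem_span_pair ?_ ?_)
    (mul_mem_of_mem_span_pair ?_ ?_) (mul_mem_of_mem_span_pair ?_ ?_)
    (mul_mem_of_mem_span_pair ?_ ?_) (mul_mem_of_mem_span_pair ?_ ?_)
    (mul_mem_of_mem_span_pair ?_ ?_) (mul_mem_of_mem_span_pair ?_ ?_) b).1
  · rw [P.d₂_right]; exact mem₁ _ _
  · exact mem₂ _ _
  · rw [P.d₂_right]; exact mem₁ _ _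
  · rw [P.d₂_one_mul_loop h0 ha]; exact zero_mem _
  · rw [P.d₂_mul_step h0 hc]; exact mem₁ _ _
  · rw [mul_tail (P.d₂_mul_step h0 hc)]; exact mem₂ _ _
  · exact mem₁ _ _
  · rw [← mul_assoc]; exact mem₂ _ _
  · rw [P.d₂_mul_walk h0 ha hac]; exact mem₁ _ _
  · rw [mul_tail (P.d₂_mul_walk h0 ha hac)]; exact mem₂ _ _
  · exact mem₂ _ _
  · rw [P.d₂_one_mul_walk_mul_loop h0 ha hc hac]; exact zero_mem _
  · rw [P.u₂_mul_d₂ h0 hc hac.symm]; exact mem₁ _ _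
  · rw [mul_tail (P.u₂_mul_d₂ h0 hc hac.symm), P.loop_left]; exact mem₂ _ _
  · exact mem₁ _ _
  · rw [← mul_assoc]; exact mem₂ _ _
  · rw [mul_tail (P.u₂_mul_d₂ h0 ha ha), P.step_left]; exact mem₁ _ _
  · rw [← mul_assoc, mul_tail (P.u₂_mul_d₂ h0 ha ha), P.step_left]; exact mem₂ _ _
  · exact mem₁ _ _
  · rw [← mul_assoc]; exact mem₂ _ _
  · exact mem₂ _ _
  · rw [mul_tail (P.u₂_one_mul_d₂_one h0 ha hc hac), zero_mul]; exact zero_mem _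
  · rw [P.u₂_one_mul_d₂_one h0 hc ha hac.symm]; exact zero_mem _
  · rw [← mul_assoc]
    exact P.walk_mul_loop h0 ha hc hac ▸ mem₂ _ _
  · rw [hdd]; exact mem₁ _ _
  · rw [mul_tail hdd, mul_assoc, P.d₂_one_mul_loop h0 ha, mul_zero]; exact zero_mem _
  · rw [P.d₃_mul_d₂_mul_step h0 ha hc hac]; exact mem₁ _ _
  · rw [mul_tail (P.d₃_mul_d₂_mul_step h0 ha hc hac), mul_assoc, P.d₂_one_mul_loop h0 ha, mul_zero]
    exact zero_mem _
  · exact mem₁ _ _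
  · rw [mul_tail (P.sand_d₂ c 1 a hc hac.symm), mul_assoc, P.d₂_mul_walk h0 ha hac,
      P.d₃_mul_d₂_mul_step h0 ha hc hac]
    exact mem₁ _ _
  · have h1 := congrArg (fun z => z * P.d₂ c a) (P.tors₃ a c ha hc hac)
    simp only [add_mul, smul_mul_assoc, mul_assoc, P.d₂_left] at h1
    rw [P.u₂_mul_d₂ h0 hc hac.symm, P.d₂_right, mul_comm X, mul_smul, P.X_smul h0 (P.d₂_right _ _),
      smul_neg, add_comm X, P.one_add_X_smul h0 (P.d₂_right _ _), neg_zero, add_zero, hdd] at h1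
    rw [← h1]
    exact mem₂ _ _
  · rw [mul_zero]; exact zero_mem _
  · rw [← P.d₂_mul_step_mul_loop h0 ha hc hac]
    exact mem₂ _ _
  · rw [mul_zero]; exact zero_mem _
  · have h1 := congrArg (fun z => z * P.d₂ c a) (P.tors₄' a c ha hc hac)
    simp only [add_mul, smul_mul_assoc, mul_assoc] at h1
    rw [P.u₂_mul_d₂ h0 hc hac.symm, P.d₂_right, P.X_smul h0 (P.d₂_right _ _), hdd] at h1
    have h2 : P.u₃ 1 * (P.d₃ 1 * P.d₂ 1 a) = P.d₂ 1 a + P.d₂ 1 c * P.walk a c := by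
      rw [walk, step, h1]
      abel
    rw [h2]
    exact add_mem (mem₁ _ _) (mem₂ _ _)
  · rw [mul_zero]; exact zero_mem _

end

end HasseAlg
end HeckeS4
end

/-! ### Realizations by invariant elements, and injectivity on the ideal of the vertex ∅. -/

noncomputable section
namespace HeckeS4

theorem x_empty : x ∅ = 1 := by
  have h : ∀ w : W, w ∈ parabolic ∅ ↔ w = 1 := fun w => by simp [parabolic, Subgroup.mem_bot]
  rw [x, ← T_one]
  refine (Finset.sum_congr (s₂ := {1}) ?_ fun _ _ => rfl).trans (Finset.sum_singleton _ _)
  ext w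
  simp [h]

theorem finset_cases (I : Finset (Fin 3)) :
    I = ∅ ∨ (∃ s, I = {s}) ∨ (∃ t, I = {t}ᶜ) ∨ I = Finset.univ := by
  revert I; decide

namespace HasseAlg

variable {B : Type} [Ring B] [Algebra ℤ[X] B]

/-- A realization of an algebra with the generators and relations of the Hasse quiver by
right-linear maps between the modules `x_J H`: the map of the component at `(I, J)` is recorded by
the image of `x_J`. -/
structure Realization (P : HasseAlg B) where
  ev : Finset (Fin 3) → Finset (Fin 3) → B →ₗ[ℤ[X]] H
  linv : ∀ I J b, LInv I (ev I J b)
  rinv : ∀ I J b, RInv J (ev I J b)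
  ev_e : ∀ I, ev I I (P.e I) = x I
  e_mul : ∀ I J b, ev I J (P.e I * b) = ev I J b
  mul_e : ∀ I J b, ev I J (b * P.e J) = ev I J b
  u₁_mul : ∀ K s b, ev ∅ K (P.u₁ s * b) = ev {s} K b
  d₁_mul : ∀ K s b, ev {s} K (P.d₁ s * b) = h {s} ∅ * ev ∅ K b
  u₂_mul : ∀ K s t, s ≠ t → ∀ b, ev {s} K (P.u₂ s t * b) = ev {t}ᶜ K b
  d₂_mul : ∀ K t s, s ≠ t → ∀ b, ev {t}ᶜ K (P.d₂ t s * b) = h {t}ᶜ {s} * ev {s} K b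
  u₃_mul : ∀ K t b, ev {t}ᶜ K (P.u₃ t * b) = ev Finset.univ K b
  d₃_mul : ∀ K t b, ev Finset.univ K (P.d₃ t * b) = h Finset.univ {t}ᶜ * ev {t}ᶜ K b
  mul_d₁ : ∀ I s b, ev I ∅ (b * P.d₁ s) = ev I {s} b
  mul_u₁ : ∀ I s b, ev I {s} (b * P.u₁ s) = ev I ∅ b * flip (h {s} ∅)
  mul_d₂ : ∀ I t s, s ≠ t → ∀ b, ev I {s} (b * P.d₂ t s) = ev I {t}ᶜ b
  mul_u₂ : ∀ I s t, s ≠ t → ∀ b, ev I {t}ᶜ (b * P.u₂ s t) = ev I {s} b * flip (h {t}ᶜ {s})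
  mul_d₃ : ∀ I t b, ev I {t}ᶜ (b * P.d₃ t) = ev I Finset.univ b
  mul_u₃ : ∀ I t b, ev I Finset.univ (b * P.u₃ t) = ev I {t}ᶜ b * flip (h Finset.univ {t}ᶜ)

variable {P : HasseAlg B}

open MulOpposite in
/-- The realization of the opposite algebra. -/
def Realization.opp (R : P.Realization) : P.opp.Realization where
  ev I J := flip ∘ₗ R.ev J I ∘ₗ (MulOpposite.opLinearEquiv ℤ[X]).symm.toLinearMap
  linv I J b := (R.rinv J I _).flip
  rinv I J b := (R.linv J I _).flip
  ev_e I := (congrArg flip (R.ev_e I)).trans (flip_x I)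
  e_mul I J b := congrArg flip (R.mul_e J I (unop b))
  mul_e I J b := congrArg flip (R.e_mul J I (unop b))
  u₁_mul K s b := congrArg flip (R.mul_d₁ K s (unop b))
  d₁_mul K s b := (congrArg flip (R.mul_u₁ K s (unop b))).trans (by rw [flip_mul, flip_flip]; rfl)
  u₂_mul K s t h b := congrArg flip (R.mul_d₂ K t s h (unop b))
  d₂_mul K t s h b :=
    (congrArg flip (R.mul_u₂ K s t h (unop b))).trans (by rw [flip_mul, flip_flip]; rfl)
  u₃_mul K t b := congrArg flip (R.mul_d₃ K t (unop b))
  d₃_mul K t b := (congrArg flip (R.mul_u₃ K t (unop b))).trans (by rw [flip_mul, flip_flip]; rfl)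
  mul_d₁ I s b := congrArg flip (R.u₁_mul I s (unop b))
  mul_u₁ I s b := (congrArg flip (R.d₁_mul I s (unop b))).trans (by rw [flip_mul]; rfl)
  mul_d₂ I t s h b := congrArg flip (R.u₂_mul I s t h (unop b))
  mul_u₂ I s t h b := (congrArg flip (R.d₂_mul I t s h (unop b))).trans (by rw [flip_mul]; rfl)
  mul_d₃ I t b := congrArg flip (R.u₃_mul I t (unop b))
  mul_u₃ I t b := (congrArg flip (R.d₃_mul I t (unop b))).trans (by rw [flip_mul]; rfl)

/-- The realization is bijective on the component at `(I, J)`. -/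
def Realization.Bij (R : P.Realization) (I J : Finset (Fin 3)) : Prop :=
  (∀ b, P.e I * b = b → b * P.e J = b → R.ev I J b = 0 → b = 0) ∧
    ∀ z, LInv I z → RInv J z → ∃ b, R.ev I J b = z

open MulOpposite in
theorem Realization.Bij.of_opp {R : P.Realization} {I J : Finset (Fin 3)} (hR : R.opp.Bij J I) :
    R.Bij I J := by
  refine ⟨fun b h₁ h₂ h₃ => ?_, fun z h₁ h₂ => ?_⟩
  · refine op_injective (hR.1 (op b) (congrArg op h₂) (congrArg op h₁) ?_)
    exact (congrArg flip h₃).trans (map_zero _)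
  · obtain ⟨b, hb⟩ := hR.2 (flip z) h₂.flip h₁.flip
    exact ⟨unop b, by rw [← flip_flip (R.ev I J _), ← flip_flip z]; exact congrArg flip hb⟩

/-! ### The ideal of the vertex `∅` -/

variable (P)

open MulOpposite

/-- The path from `J` to `∅`. -/
def U (J : Finset (Fin 3)) : B := unop (P.opp.D J)

/-- Passing to the opposite algebra corresponds to `flip` on the Hecke algebra; this turns results
about left ideals into results about right ideals. -/
theorem unop_theta_opp (h : H) : unop (P.opp.theta h) = P.theta (flip h) := by
  induction h using H_induction with
  | hone => rw [map_one, flip_one, map_one, unop_one]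
  | hadd a b ha hb => rw [map_add, map_add, map_add, unop_add, ha, hb]
  | hsmul c a ha => rw [map_smul, map_smul, map_smul, unop_smul, ha]
  | hgen i a ha =>
    rw [map_mul, unop_mul, ha, flip_mul, flip_gen, map_mul, theta_gen, theta_gen]
    rfl

theorem e_mul_U (J : Finset (Fin 3)) : P.e ∅ * P.U J = P.U J :=
  congrArg unop (P.opp.D_mul_e J)

theorem e_empty_mul_mul_e (b : B) (J : Finset (Fin 3)) :
    ∃ h, P.e ∅ * b * P.e J = P.theta h * P.U J := by
  obtain ⟨h, hh⟩ := P.opp.e_mul_mul_e_empty (op b) J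
  refine ⟨flip h, ?_⟩
  rw [← unop_theta_opp]
  exact congrArg unop hh.symm

/-- The linear map `h ↦ D_I θ(h) U_J`. -/
def cell (I J : Finset (Fin 3)) : H →ₗ[ℤ[X]] B := LinearMap.mulRight ℤ[X] (P.U J) ∘ₗ P.Dtheta I

theorem cell_apply (I J : Finset (Fin 3)) (h : H) : P.cell I J h = P.D I * P.theta h * P.U J := rfl

/-- The ideal is additively generated by products u e_∅ v, and e_I u e_∅ lies in D_I θ(H) while e_∅
v e_J lies in θ(H) U_J. -/
theorem mem_cell {f : B} (hf : f ∈ TwoSidedIdeal.span {P.e ∅}) (I J : Finset (Fin 3)) :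
    P.e I * f * P.e J ∈ LinearMap.range (P.cell I J) := by
  rw [TwoSidedIdeal.mem_span_iff_mem_addSubgroup_closure] at hf
  induction hf using AddSubgroup.closure_induction with
  | mem f hf =>
    obtain ⟨f, ⟨u, -, _, rfl, rfl⟩, v, -, rfl⟩ := hf
    obtain ⟨h₁, hh₁⟩ := P.e_mul_mul_e_empty u I
    obtain ⟨h₂, hh₂⟩ := P.e_empty_mul_mul_e v J
    refine ⟨h₁ * h₂, ?_⟩
    rw [cell_apply, map_mul, ← mul_assoc, mul_assoc, ← hh₂, ← Dtheta_apply, hh₁]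
    simp only [mul_assoc]
    rw [mul_tail (P.idem ∅)]
  | zero => rw [mul_zero, zero_mul]; exact zero_mem _
  | add a b _ _ ha hb => rw [mul_add, add_mul]; exact add_mem ha hb
  | neg a _ ha => rw [mul_neg, neg_mul]; exact neg_mem ha

theorem D_eq_mul {I : Finset (Fin 3)} {i : Fin 3} (hi : i ∈ I) : ∃ z, P.D I = z * P.d₁ i := by
  rcases finset_cases I with rfl | ⟨s, rfl⟩ | ⟨t, rfl⟩ | rfl
  · simp at hi
  · rw [Finset.mem_singleton] at hi
    subst hi
    exact ⟨P.e {i}, by rw [D_single, d₁_left]⟩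
  · exact ⟨P.d₂ t i, P.D_compl (by simpa using hi)⟩
  · obtain ⟨t, ht⟩ : ∃ t, i ≠ t := by revert i; decide
    exact ⟨P.d₃ t * P.d₂ t i, by rw [P.D_univ t, P.D_compl ht, mul_assoc]⟩

/-- The path D_I can be chosen to begin with d₁ i, and d₁ χ_i = (1 + q) d₁. -/
theorem D_mul_theta_gen {I : Finset (Fin 3)} {i : Fin 3} (hi : i ∈ I) :
    P.D I * P.theta (gen i) = (X : ℤ[X]) • P.D I := by
  obtain ⟨z, hz⟩ := P.D_eq_mul hi
  have h1 : P.D I * P.chi i = (1 + X : ℤ[X]) • P.D I := by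
    rw [hz, mul_assoc, d₁_mul_chi, mul_smul_comm]
  rw [← D_mul_e, mul_assoc, e_mul_theta_gen, mul_sub, h1, D_mul_e, add_smul, one_smul,
    add_sub_cancel_left]

theorem theta_gen_mul_U {J : Finset (Fin 3)} {j : Fin 3} (hj : j ∈ J) :
    P.theta (gen j) * P.U J = (X : ℤ[X]) • P.U J := by
  have := congrArg unop (P.opp.D_mul_theta_gen hj)
  rw [unop_mul, unop_theta_opp, flip_gen] at this
  exact this

/-- The map h ↦ D_I θ(h) U_J is q-equivariant on both sides. As `ev_cell` sends its values to x_I h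
x_J, this is the injectivity of `ev` on the ideal of ∅. -/
theorem cell_eq_zero {I J : Finset (Fin 3)} {h : H} (hh : x I * h * x J = 0) :
    P.cell I J h = 0 := by
  refine map_eq_zero_of_x_mul_x (P.cell I J) (fun i hi a => ?_) (fun j hj a => ?_) hh
  · rw [cell_apply, map_mul, ← mul_assoc, P.D_mul_theta_gen hi, smul_mul_assoc, smul_mul_assoc]
    rfl
  · rw [cell_apply, map_mul, ← mul_assoc, mul_assoc, P.theta_gen_mul_U hj, mul_smul_comm]
    rfl

variable {P} (R : P.Realization)

namespace Realization

/-- On the vertex ∅, θ(T_s) is χ_s − 1, and χ_s acts as left multiplication by h_{s,∅} = 1 + T_s. -/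
theorem ev_theta_mul (K : Finset (Fin 3)) (h : H) (b : B) :
    R.ev ∅ K (P.theta h * b) = h * R.ev ∅ K b := by
  induction h using H_induction generalizing b with
  | hone => rw [map_one, one_mul, one_mul]
  | hadd a c ha hb => rw [map_add, add_mul, add_mul, map_add, ha, hb]
  | hsmul c a ha => rw [map_smul, smul_mul_assoc, smul_mul_assoc, map_smul, ha]
  | hgen i a ha =>
    have h1 := congrArg (fun z => R.ev ∅ K (z * (P.theta a * b)))
      (sub_eq_iff_eq_add.1 (P.e_mul_theta_gen i).symm)
    simp only [add_mul, map_add] at h1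
    rw [R.e_mul, mul_assoc, R.e_mul, chi, mul_assoc, R.u₁_mul, R.d₁_mul, h_single, add_mul,
      one_mul, add_comm] at h1
    have h2 := congrArg (· + (-1 : ℤ[X]) • R.ev ∅ K (P.theta a * b)) h1
    rw [map_mul P.theta, mul_assoc, mul_assoc, ← ha]
    refine Eq.trans ?_ (h2.symm.trans ?_) <;> module

theorem ev_D_mul (I K : Finset (Fin 3)) (b : B) : R.ev I K (P.D I * b) = x I * R.ev ∅ K b := by
  have hs : ∀ s, h {s} ∅ = x {s} := fun s => by
    rw [← h_mul_x (Finset.empty_subset {s}), x_empty, mul_one]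
  have hc : ∀ s t : Fin 3, s ≠ t → R.ev {t}ᶜ K (P.D {t}ᶜ * b) = x {t}ᶜ * R.ev ∅ K b := by
    intro s t hst
    rw [P.D_compl hst, mul_assoc, R.d₂_mul _ _ _ hst, R.d₁_mul, hs, ← mul_assoc,
      h_mul_x (by simpa using hst.symm)]
  rcases finset_cases I with rfl | ⟨s, rfl⟩ | ⟨t, rfl⟩ | rfl
  · rw [D_empty, R.e_mul, x_empty, one_mul]
  · rw [D_single, R.d₁_mul, hs]
  · obtain ⟨s, hst⟩ : ∃ s, s ≠ t := by revert t; decide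
    exact hc s t hst
  · rw [P.D_univ 0, mul_assoc, R.d₃_mul, hc 1 0 (by decide), ← mul_assoc,
      h_mul_x (Finset.subset_univ _)]

theorem ev_mul_U (I J : Finset (Fin 3)) (b : B) : R.ev I J (b * P.U J) = R.ev I ∅ b * x J := by
  have := congrArg flip (R.opp.ev_D_mul J I (op b))
  rw [flip_mul, flip_x] at this
  refine Eq.trans ?_ (this.trans ?_)
  · exact (flip_flip _).symm
  · exact congrArg (· * x J) (flip_flip _)

theorem ev_cell (I J : Finset (Fin 3)) (h : H) : R.ev I J (P.cell I J h) = x I * h * x J := by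
  rw [cell_apply, mul_assoc, ev_D_mul, ev_theta_mul, ← P.e_mul_U, ev_mul_U, R.ev_e, x_empty,
    one_mul, mul_assoc]

theorem eq_zero_of_mem_cell {I J : Finset (Fin 3)} {b : B} (hb : b ∈ LinearMap.range (P.cell I J))
    (h0 : R.ev I J b = 0) : b = 0 := by
  obtain ⟨h, rfl⟩ := hb
  rw [ev_cell] at h0
  exact P.cell_eq_zero h0

theorem eq_zero_of_mem_span {I J : Finset (Fin 3)} {b : B} (hI : P.e I * b = b)
    (hJ : b * P.e J = b) (hb : b ∈ TwoSidedIdeal.span {P.e ∅}) (h0 : R.ev I J b = 0) : b = 0 := by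
  have := P.mem_cell hb I J
  rw [hI, hJ] at this
  exact R.eq_zero_of_mem_cell this h0

theorem bij_empty_right (I : Finset (Fin 3)) : R.Bij I ∅ := by
  refine ⟨fun b h₁ h₂ h₃ => ?_, fun z h₁ h₂ => ?_⟩
  · refine R.eq_zero_of_mem_span h₁ h₂ ?_ h₃
    rw [← h₂]
    exact TwoSidedIdeal.mul_mem_left _ _ _ (TwoSidedIdeal.subset_span rfl)
  · refine ⟨P.cell I ∅ (restr (LMin I) z), ?_⟩
    rw [ev_cell, x_empty, mul_one, ← h₁.eq_x_mul]

theorem bij_empty_left (J : Finset (Fin 3)) : R.Bij ∅ J := (R.opp.bij_empty_right J).of_opp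

/-- The bijectivity on a component that is generated by two elements besides the ideal of the
vertex `∅`. -/
theorem bij_of_two {I J : Finset (Fin 3)} {y₁ y₂ : B} {w₁ w₂ : W} {n₁ n₂ : ℤ[X]}
    (hspan : ∀ b, P.e I * b = b → b * P.e J = b →
      ∃ a₁ a₂ : ℤ[X], b - (a₁ • y₁ + a₂ • y₂) ∈ LinearMap.range (P.cell I J))
    (hn₁ : n₁ • y₁ ∈ LinearMap.range (P.cell I J)) (hn₂ : n₂ • y₂ ∈ LinearMap.range (P.cell I J))
    (h₁₁ : coord (R.ev I J y₁) w₁ = 1) (h₁₂ : coord (R.ev I J y₁) w₂ = 0)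
    (h₂₂ : coord (R.ev I J y₂) w₂ = 1) (hd₁ : ∀ h, n₁ ∣ coord (x I * h * x J) w₁)
    (hd₂ : ∀ h, n₂ ∣ coord (x I * h * x J) w₂)
    (hfree : ∀ d, BiMin I J d → ¬ IsFree I J d → d = w₁ ∨ d = w₂) : R.Bij I J := by
  refine ⟨fun b h₁ h₂ h₃ => ?_, fun z h₁ h₂ => ?_⟩
  · obtain ⟨a₁, a₂, h, hh⟩ := hspan b h₁ h₂
    rw [eq_sub_iff_add_eq] at hh
    have key : ∀ w, coord (x I * h * x J) w +
        (a₁ * coord (R.ev I J y₁) w + a₂ * coord (R.ev I J y₂) w) = 0 := by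
      intro w
      have := congrFun (congrArg coord h₃) w
      rw [← hh, map_add, map_add, ev_cell, map_add, map_add, map_smul, map_smul, map_smul, map_smul, map_zero] at this
      simpa using this
    -- Triangular elimination. At w₂ only a₂ contributes besides x_I h x_J, so n₂ divides a₂ and a₂
    -- y₂ lies in the cell; after it is absorbed into h, the coordinate at w₁ does the same for a₁.
    -- Hence b itself lies in the cell, where `ev` is injective.
    have e₂ := key w₂
    rw [h₁₂, h₂₂, mul_zero, zero_add, mul_one] at e₂
    obtain ⟨k₂, hk₂⟩ := hd₂ h
    rw [hk₂] at e₂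
    have m₂ : a₂ • y₂ ∈ LinearMap.range (P.cell I J) := by
      rw [eq_neg_of_add_eq_zero_right e₂, neg_smul, mul_comm, mul_smul]
      exact neg_mem (Submodule.smul_mem _ _ hn₂)
    obtain ⟨g, hg⟩ := m₂
    have hg' := congrArg (R.ev I J) hg
    rw [ev_cell, map_smul] at hg'
    have e₁ := key w₁
    obtain ⟨k, hk⟩ := hd₁ (h + g)
    have e₁' : coord (x I * (h + g) * x J) w₁ + a₁ = 0 := by
      rw [mul_add, add_mul, hg', map_add, map_smul]
      rw [h₁₁] at e₁
      simp only [Pi.add_apply, Pi.smul_apply, smul_eq_mul]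
      linear_combination e₁
    rw [hk] at e₁'
    refine R.eq_zero_of_mem_cell ?_ h₃
    rw [← hh, ← hg, eq_neg_of_add_eq_zero_right e₁', neg_smul, mul_comm, mul_smul]
    exact add_mem ⟨h, rfl⟩ (add_mem (neg_mem (Submodule.smul_mem _ _ hn₁)) ⟨g, rfl⟩)
  -- c₁ and c₂ are chosen so that z minus the image of c₁ y₁ + c₂ y₂ vanishes at w₁ and w₂. The
  -- difference then vanishes on all non-free double cosets and is of the form x_I h x_J.
  · set c₂ := coord z w₂ with hc₂
    set c₁ := coord z w₁ - c₂ * coord (R.ev I J y₂) w₁ with hc₁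
    have hl : LInv I (z + R.ev I J ((-c₁) • y₁ + (-c₂) • y₂)) := fun i hi => by
      rw [mul_add, h₁ i hi, R.linv _ _ _ i hi, smul_add]
    have hr : RInv J (z + R.ev I J ((-c₁) • y₁ + (-c₂) • y₂)) := fun i hi => by
      rw [add_mul, h₂ i hi, R.rinv _ _ _ i hi, smul_add]
    have := eq_x_mul_x hl hr (fun d hd hf => by
      rw [map_add, map_add, map_smul, map_smul, map_add, map_smul, map_smul]
      simp only [Pi.add_apply, Pi.smul_apply, smul_eq_mul]
      rcases hfree d hd hf with rfl | rfl
      · rw [h₁₁, hc₁]; ring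
      · rw [h₁₂, h₂₂]; ring)
    refine ⟨P.cell I J (restr (BiMin I J) (z + R.ev I J ((-c₁) • y₁ + (-c₂) • y₂))) +
      (c₁ • y₁ + c₂ • y₂), ?_⟩
    rw [map_add, ev_cell, ← this, add_assoc, ← map_add]
    have e : ((-c₁) • y₁ + (-c₂) • y₂ + (c₁ • y₁ + c₂ • y₂) : B) = 0 := by module
    rw [e, map_zero, add_zero]

end Realization
end HasseAlg
end HeckeS4
end

/-! ### The quotient by the ideal of the vertex ∅, and lifting from it. -/

noncomputable section
namespace HeckeS4
namespace HasseAlg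

variable {B : Type} [Ring B] [Algebra ℤ[X] B] (P : HasseAlg B)

/-- The image under a surjective homomorphism. -/
def map {B' : Type} [Ring B'] [Algebra ℤ[X] B'] (f : B →ₐ[ℤ[X]] B')
    (hf : Function.Surjective f) : HasseAlg B' where
  e I := f (P.e I)
  u₁ s := f (P.u₁ s)
  d₁ s := f (P.d₁ s)
  u₂ s t := f (P.u₂ s t)
  d₂ t s := f (P.d₂ t s)
  u₃ t := f (P.u₃ t)
  d₃ t := f (P.d₃ t)
  idem I := by rw [← map_mul, P.idem]
  orth I J h := by rw [← map_mul, P.orth I J h, map_zero]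
  e_sum := by rw [← map_sum, P.e_sum, map_one]
  u₁_left s := by rw [← map_mul, P.u₁_left]
  u₁_right s := by rw [← map_mul, P.u₁_right]
  d₁_left s := by rw [← map_mul, P.d₁_left]
  d₁_right s := by rw [← map_mul, P.d₁_right]
  u₂_left s t := by rw [← map_mul, P.u₂_left]
  u₂_right s t := by rw [← map_mul, P.u₂_right]
  d₂_left t s := by rw [← map_mul, P.d₂_left]
  d₂_right t s := by rw [← map_mul, P.d₂_right]
  u₃_left t := by rw [← map_mul, P.u₃_left]
  u₃_right t := by rw [← map_mul, P.u₃_right]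
  d₃_left t := by rw [← map_mul, P.d₃_left]
  d₃_right t := by rw [← map_mul, P.d₃_right]
  quasi₁ s := by rw [← map_mul, P.quasi₁, map_smul]
  quasi₂ t s h := by rw [← map_mul, P.quasi₂ t s h, map_smul]
  quasi₃ t := by rw [← map_mul, P.quasi₃, map_smul]
  sand_u₁ r s t h h' := by rw [← map_mul, P.sand_u₁ r s t h h', map_mul]
  sand_d₁ r s t h h' := by rw [← map_mul, P.sand_d₁ r s t h h', map_mul]
  sand_u₂ s r t h h' := by rw [← map_mul, P.sand_u₂ s r t h h', map_mul]
  sand_d₂ s r t h h' := by rw [← map_mul, P.sand_d₂ s r t h h', map_mul]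
  tors₁ r s t h1 h2 h3 h4 := by
    simp only [← map_mul, ← map_smul, ← map_add, P.tors₁ r s t h1 h2 h3 h4]
  tors₂ a c ha hc hac := by rw [← map_mul, P.tors₂ a c ha hc hac, map_mul]
  tors₃ a c ha hc hac := by
    simp only [← map_mul, ← map_smul, ← map_add, P.tors₃ a c ha hc hac]
  tors₄ a c ha hc hac := by
    simp only [← map_mul, ← map_smul, ← map_add, P.tors₄ a c ha hc hac]
  tors₄' a c ha hc hac := by
    simp only [← map_mul, ← map_smul, ← map_add, P.tors₄' a c ha hc hac]
  adjoin_eq := by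
    rw [eq_top_iff]
    rintro b -
    obtain ⟨b, rfl⟩ := hf b
    induction b using P.adjoin_induction with
    | hC c => rw [AlgHom.commutes]; exact Subalgebra.algebraMap_mem _ c
    | hadd a b ha hb => rw [map_add]; exact add_mem ha hb
    | hmul a b ha hb => rw [map_mul]; exact mul_mem ha hb
    | he I => exact Algebra.subset_adjoin (.inl (.inl (.inl ⟨I, rfl⟩)))
    | hu₁ s => exact Algebra.subset_adjoin (.inl (.inl (.inr (.inl ⟨s, rfl⟩))))
    | hd₁ s => exact Algebra.subset_adjoin (.inl (.inl (.inr (.inr ⟨s, rfl⟩))))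
    | hu₂ s t h => exact Algebra.subset_adjoin (.inl (.inr ⟨s, t, h, .inl rfl⟩))
    | hd₂ t s h => exact Algebra.subset_adjoin (.inl (.inr ⟨s, t, h, .inr rfl⟩))
    | hu₃ t => exact Algebra.subset_adjoin (.inr (.inl ⟨t, rfl⟩))
    | hd₃ t => exact Algebra.subset_adjoin (.inr (.inr ⟨t, rfl⟩))

/-- The quotient by the ideal of the vertex `∅`. -/
abbrev Quot : Type := (TwoSidedIdeal.span {P.e ∅}).ringCon.Quotient

def toQuot : B →ₐ[ℤ[X]] P.Quot := RingCon.mkₐ ℤ[X] _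

theorem toQuot_surjective : Function.Surjective P.toQuot := RingCon.mkₐ_surjective _

/-- The generators and relations in the quotient by the ideal of the vertex `∅`. -/
def quot : HasseAlg P.Quot := P.map P.toQuot P.toQuot_surjective

theorem mem_of_toQuot_eq_zero {b : B} (hb : P.toQuot b = 0) : b ∈ TwoSidedIdeal.span {P.e ∅} := by
  rw [TwoSidedIdeal.mem_iff]
  exact (RingCon.eq _).1 (hb.trans (map_zero P.toQuot).symm)

theorem quot_e_empty : P.quot.e ∅ = 0 := by
  have : P.e ∅ ∈ TwoSidedIdeal.span {P.e ∅} := TwoSidedIdeal.subset_span rfl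
  rw [TwoSidedIdeal.mem_iff] at this
  exact ((RingCon.eq _).2 this).trans (map_zero P.toQuot)

/-- Lifts a spanning pair from the quotient: the error lies in the ideal of ∅, and its component at
(I, J) lies in the cell. -/
theorem exists_sub_mem_cell {I J : Finset (Fin 3)} {y₁ y₂ : B} (h₁ : P.e I * y₁ = y₁)
    (h₁' : y₁ * P.e J = y₁) (h₂ : P.e I * y₂ = y₂) (h₂' : y₂ * P.e J = y₂)
    (hs : ∀ b, P.quot.e I * (b * P.quot.e J) ∈ Submodule.span ℤ[X] {P.toQuot y₁, P.toQuot y₂})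
    (b : B) (hI : P.e I * b = b) (hJ : b * P.e J = b) :
    ∃ a₁ a₂ : ℤ[X], b - (a₁ • y₁ + a₂ • y₂) ∈ LinearMap.range (P.cell I J) := by
  obtain ⟨a₁, a₂, h⟩ := Submodule.mem_span_pair.1 (hs (P.toQuot b))
  refine ⟨a₁, a₂, ?_⟩
  have h3 : P.toQuot (b - (a₁ • y₁ + a₂ • y₂)) = 0 := by
    rw [map_sub, map_add, map_smul, map_smul, h]
    change _ - P.toQuot (P.e I) * (P.toQuot b * P.toQuot (P.e J)) = 0
    rw [← map_mul, ← map_mul, hJ, hI, sub_self]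
  have := P.mem_cell (P.mem_of_toQuot_eq_zero h3) I J
  rwa [mul_sub, mul_add, mul_smul_comm, mul_smul_comm, hI, h₁, h₂, sub_mul, add_mul,
    smul_mul_assoc, smul_mul_assoc, hJ, h₁', h₂'] at this

/-- By the quasi-idempotent relations π(I) e_I is a path through ∅. This supplies the multiples n₁
y₁ and n₂ y₂ required by `bij_of_two`. -/
theorem poincare_smul_e_mem_single (s : Fin 3) :
    poincare {s} • P.e {s} ∈ TwoSidedIdeal.span {P.e ∅} := by
  rw [poincare_single, ← P.quasi₁, ← P.d₁_right, mul_assoc]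
  exact TwoSidedIdeal.mul_mem_left _ _ _
    (TwoSidedIdeal.mul_mem_right _ _ _ (TwoSidedIdeal.subset_span rfl))

theorem poincare_smul_e_mem_compl (t : Fin 3) :
    poincare {t}ᶜ • P.e {t}ᶜ ∈ TwoSidedIdeal.span {P.e ∅} := by
  obtain ⟨s, hst⟩ : ∃ s, s ≠ t := by revert t; decide
  have h1 : poincare {t}ᶜ = poincare {s} * ratio₂ t := by
    rw [poincare_single, ratio₂]
    split_ifs with ht
    · rw [ht, poincare_compl_one]
    · rw [poincare_compl ht]
  rw [h1, mul_smul, ← P.quasi₂ t s hst, ← P.d₂_right, mul_assoc, ← mul_smul_comm, ← smul_mul_assoc]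
  exact TwoSidedIdeal.mul_mem_left _ _ _
    (TwoSidedIdeal.mul_mem_right _ _ _ (P.poincare_smul_e_mem_single s))

theorem smul_mem_cell {I J K : Finset (Fin 3)} {n : ℤ[X]} {y z z' : B}
    (hK : n • P.e K ∈ TwoSidedIdeal.span {P.e ∅}) (hI : P.e I * y = y) (hJ : y * P.e J = y)
    (hy : z * (P.e K * z') = y) : n • y ∈ LinearMap.range (P.cell I J) := by
  have h1 : n • y ∈ TwoSidedIdeal.span {P.e ∅} := by
    rw [← hy, ← mul_smul_comm, ← smul_mul_assoc]
    exact TwoSidedIdeal.mul_mem_left _ _ _ (TwoSidedIdeal.mul_mem_right _ _ _ hK)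
  have := P.mem_cell h1 I J
  rwa [mul_smul_comm, smul_mul_assoc, hI, hJ] at this

end HasseAlg
end HeckeS4
end

/-! ### Left ideals of the vertices of size two, modulo the ideal of ∅. -/

noncomputable section
namespace HeckeS4
namespace HasseAlg

variable {B : Type} [Ring B] [Algebra ℤ[X] B] (P : HasseAlg B)

theorem ratio₂_smul_left (h0 : P.e ∅ = 0) {s t : Fin 3} (ht : t ≠ 1) {y : B}
    (hy : P.e {s} * y = y) : ratio₂ t • y = y := by
  rw [← hy, ← smul_mul_assoc, P.ratio₂_smul h0 ht (P.idem {s})]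

theorem d₃_u₃_tail (t : Fin 3) {z : B} (hz : P.e Finset.univ * z = z) :
    P.d₃ t * (P.u₃ t * z) = ratio₃ t • z := by
  rw [mul_tail (P.quasi₃ t), smul_mul_assoc, hz]

section

variable (h0 : P.e ∅ = 0) {a c : Fin 3} (ha : a ≠ 1) (hc : c ≠ 1) (hac : a ≠ c)

include h0 ha hc hac

/-- The left ideal of the vertex `S ∖ {1}`, modulo the ideal of the vertex `∅`. -/
theorem e_mul_mul_e_compl_one (b : B) :
    P.e {a} * (b * P.e {1}ᶜ) ∈
      Submodule.span ℤ[X] {P.u₂ a 1, P.u₂ a 1 * (P.u₃ 1 * P.d₃ 1)} ∧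
    P.e {1}ᶜ * (b * P.e {1}ᶜ) ∈ Submodule.span ℤ[X] {P.e {1}ᶜ, P.u₃ 1 * P.d₃ 1} := by
  have mem₁ : ∀ x y : B, x ∈ Submodule.span ℤ[X] {x, y} := fun x y =>
    Submodule.subset_span (Set.mem_insert _ _)
  have mem₂ : ∀ x y : B, y ∈ Submodule.span ℤ[X] {x, y} := fun x y =>
    Submodule.subset_span (Set.mem_insert_of_mem _ rfl)
  have hu : ∀ t, P.e {t}ᶜ * (P.u₃ t * P.d₃ 1) = P.u₃ t * P.d₃ 1 := fun t => by
    rw [← mul_assoc, P.u₃_left]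
  -- Each vertex other than S receives one path that avoids S and one that passes through S; at S
  -- the single element d₃ suffices and 0 is padding.
  have key := P.e_mul_mem_of_label h0 ha hc hac
    (Fa := Submodule.span ℤ[X] {P.u₂ a 1, P.u₂ a 1 * (P.u₃ 1 * P.d₃ 1)})
    (Fb := Submodule.span ℤ[X] {P.step a c * P.u₂ a 1, P.u₂ 1 c * (P.u₃ c * P.d₃ 1)})
    (Fc := Submodule.span ℤ[X] {P.u₂ c 1, P.u₂ c 1 * (P.u₃ 1 * P.d₃ 1)})
    (Fab := Submodule.span ℤ[X] {P.d₂ c a * P.u₂ a 1, P.u₃ c * P.d₃ 1})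
    (Fbc := Submodule.span ℤ[X] {P.d₂ a c * P.u₂ c 1, P.u₃ a * P.d₃ 1})
    (Fac := Submodule.span ℤ[X] {P.e {1}ᶜ, P.u₃ 1 * P.d₃ 1})
    (Fs := Submodule.span ℤ[X] {P.d₃ 1, 0})
    (.inr (.inr ⟨rfl, mem₁ _ _⟩)) (mul_mem_of_mem_span_pair ?_ ?_) (mul_mem_of_mem_span_pair ?_ ?_)
    (mul_mem_of_mem_span_pair ?_ ?_) (mul_mem_of_mem_span_pair ?_ ?_)
    (mul_mem_of_mem_span_pair ?_ ?_) (mul_mem_of_mem_span_pair ?_ ?_)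
    (mul_mem_of_mem_span_pair ?_ ?_) (mul_mem_of_mem_span_pair ?_ ?_)
    (mul_mem_of_mem_span_pair ?_ ?_) (mul_mem_of_mem_span_pair ?_ ?_)
    (mul_mem_of_mem_span_pair ?_ ?_) (mul_mem_of_mem_span_pair ?_ ?_)
    (mul_mem_of_mem_span_pair ?_ ?_) (mul_mem_of_mem_span_pair ?_ ?_)
    (mul_mem_of_mem_span_pair ?_ ?_) (mul_mem_of_mem_span_pair ?_ ?_)
    (mul_mem_of_mem_span_pair ?_ ?_) (mul_mem_of_mem_span_pair ?_ ?_) b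
  · exact ⟨key.1, key.2.2.2⟩
  · exact mem₁ _ _
  · rw [mul_tail (P.sand_u₂ a 1 c ha hac), mul_assoc, P.d₂_u₂_tail hac (hu c)]
    exact Submodule.smul_mem _ _ (mem₂ _ _)
  · rw [P.quasi₂ 1 a ha]
    exact Submodule.smul_mem _ _ (mem₁ _ _)
  · rw [P.d₂_u₂_tail ha (hu 1)]
    exact Submodule.smul_mem _ _ (mem₂ _ _)
  · rw [mul_tail (P.d₂_mul_step h0 hc)]
    exact mem₁ _ _
  · rw [P.d₂_u₂_tail hc.symm (hu c)]
    exact Submodule.smul_mem _ _ (mem₂ _ _)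
  · rw [step, mul_assoc (P.u₂ 1 c), P.tors₄ c a hc ha hac.symm]
    exact add_mem (mem₂ _ _) (Submodule.smul_mem _ _ (mem₁ _ _))
  · rw [mul_tail (P.sand_u₂ 1 c a hc.symm ha.symm), mul_assoc, P.d₂_u₂_tail ha.symm (hu a)]
    exact Submodule.smul_mem _ _ (mem₂ _ _)
  · exact mem₁ _ _
  · rw [mul_tail (P.sand_u₂ c 1 a hc hac.symm), mul_assoc, P.d₂_u₂_tail hac.symm (hu a)]
    exact Submodule.smul_mem _ _ (mem₂ _ _)
  · rw [P.quasi₂ 1 c hc]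
    exact Submodule.smul_mem _ _ (mem₁ _ _)
  · rw [P.d₂_u₂_tail hc (hu 1)]
    exact Submodule.smul_mem _ _ (mem₂ _ _)
  · rw [mul_tail (P.u₂_mul_d₂ h0 hc hac.symm), P.u₂_left]
    exact mem₁ _ _
  · rw [mul_tail (P.sand_u₂ a c 1 hac ha), mul_assoc]
    exact mem₂ _ _
  · rw [step, mul_assoc (P.u₂ 1 c) (P.d₂ c a)]
    exact mem₁ _ _
  · exact mem₂ _ _
  · have h1 := congrArg (P.u₂ 1 c * ·) (P.tors₄ a c ha hc hac)
    simp only [mul_add, mul_smul_comm] at h1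
    rw [mul_tail (P.u₂_mul_d₂ h0 hc hc), mul_tail (P.u₂_left _ _), ← mul_assoc _ (P.d₂ c a)] at h1
    rw [h1]
    exact add_mem (mem₂ _ _) (Submodule.smul_mem _ _ (mem₁ _ _))
  · rw [mul_tail (P.sand_u₂ 1 a c ha.symm hc.symm), mul_assoc]
    exact mem₂ _ _
  · rw [mul_tail (P.u₂_mul_d₂ h0 ha hac), P.u₂_left]
    exact mem₁ _ _
  · rw [mul_tail (P.sand_u₂ c a 1 hac.symm hc), mul_assoc]
    exact mem₂ _ _
  · rw [P.u₂_right]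
    exact mem₁ _ _
  · exact mem₂ _ _
  · rw [P.u₂_right]
    exact mem₁ _ _
  · exact mem₂ _ _
  · rw [mul_tail (P.sand_d₂ a c 1 hac ha), mul_assoc, P.quasi₂ 1 a ha, mul_smul_comm, P.d₃_right]
    exact Submodule.smul_mem _ _ (mem₁ _ _)
  · rw [P.d₃_u₃_tail c (P.d₃_left 1)]
    exact Submodule.smul_mem _ _ (mem₁ _ _)
  · rw [mul_tail (P.sand_d₂ c a 1 hac.symm hc), mul_assoc, P.quasi₂ 1 c hc, mul_smul_comm,
      P.d₃_right]
    exact Submodule.smul_mem _ _ (mem₁ _ _)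
  · rw [P.d₃_u₃_tail a (P.d₃_left 1)]
    exact Submodule.smul_mem _ _ (mem₁ _ _)
  · rw [P.d₃_right]
    exact mem₁ _ _
  · rw [P.d₃_u₃_tail 1 (P.d₃_left 1)]
    exact Submodule.smul_mem _ _ (mem₁ _ _)
  · exact mem₂ _ _
  · rw [mul_zero]; exact zero_mem _
  · exact mem₂ _ _
  · rw [mul_zero]; exact zero_mem _
  · exact mem₂ _ _
  · rw [mul_zero]; exact zero_mem _

/-- The left ideal of the vertex `S ∖ {c}`, modulo the ideal of the vertex `∅`. -/
theorem e_mul_mul_e_compl (b : B) :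
    P.e {c}ᶜ * (b * P.e {c}ᶜ) ∈
      Submodule.span ℤ[X] {P.e {c}ᶜ, P.d₂ c a * (P.loop a * P.u₂ a c)} ∧
    P.e {a}ᶜ * (b * P.e {c}ᶜ) ∈ Submodule.span ℤ[X] {P.d₂ a 1 * P.u₂ 1 c, P.u₃ a * P.d₃ c} := by
  have mem₁ : ∀ x y : B, x ∈ Submodule.span ℤ[X] {x, y} := fun x y =>
    Submodule.subset_span (Set.mem_insert _ _)
  have mem₂ : ∀ x y : B, y ∈ Submodule.span ℤ[X] {x, y} := fun x y =>
    Submodule.subset_span (Set.mem_insert_of_mem _ rfl)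
  -- Z is the path S ∖ {c} → {1} → S ∖ {a} → {c}.
  obtain ⟨Z, hZ⟩ : ∃ Z, Z = P.u₂ c a * (P.d₂ a 1 * P.u₂ 1 c) := ⟨_, rfl⟩
  have hst : P.step a c * P.u₂ a c = P.u₂ 1 c := by
    rw [step, mul_assoc, P.quasi₂ c a hac, mul_smul_comm, P.u₂_right,
      P.ratio₂_smul_left h0 hc (P.u₂_left _ _)]
  have hwalk : P.walk a c * P.u₂ a c = Z := by
    rw [walk, mul_assoc, mul_assoc, hst, hZ]
  have hloop : P.loop c * Z = P.walk a c * (P.loop a * P.u₂ a c) := by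
    rw [← hwalk, ← mul_assoc, ← mul_assoc, P.walk_mul_loop h0 ha hc hac]
  have hU : P.d₃ 1 * (P.d₂ 1 a * P.u₂ a c) = ratio₂ c • P.d₃ c := by
    rw [mul_tail (P.sand_d₂ a 1 c ha hac), mul_assoc, P.quasi₂ c a hac, mul_smul_comm, P.d₃_right]
  have hB : P.d₂ a 1 * (P.step a c * (P.loop a * P.u₂ a c)) = ratio₂ c • (P.u₃ a * P.d₃ c) := by
    rw [← mul_assoc, ← mul_assoc, P.d₂_mul_step_mul_loop h0 ha hc hac]
    simp only [mul_assoc]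
    rw [hU, mul_smul_comm]
  have hY : P.d₂ c a * (P.loop a * P.u₂ a c) =
      P.u₃ c * P.d₃ c + (X * (X + 1) : ℤ[X]) • P.e {c}ᶜ := by
    rw [loop, mul_assoc (P.u₂ a 1)]
    exact P.tors₃ a c ha hc hac
  have hW : P.d₂ 1 c * Z = P.u₃ 1 * P.d₃ c + (X : ℤ[X]) • (P.d₂ 1 a * P.u₂ a c) := by
    rw [hZ]
    exact P.tors₄' a c ha hc hac
  -- Where a path through S is not itself a generator, (T3) and (T4′), in the forms `hY` and `hW`,
  -- trade it for the listed ones.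
  have key := P.e_mul_mem_of_label h0 ha hc hac
    (Fa := Submodule.span ℤ[X] {P.u₂ a c, P.loop a * P.u₂ a c})
    (Fb := Submodule.span ℤ[X] {P.u₂ 1 c, P.step a c * (P.loop a * P.u₂ a c)})
    (Fc := Submodule.span ℤ[X] {Z, P.loop c * Z})
    (Fab := Submodule.span ℤ[X] {P.e {c}ᶜ, P.d₂ c a * (P.loop a * P.u₂ a c)})
    (Fbc := Submodule.span ℤ[X] {P.d₂ a 1 * P.u₂ 1 c, P.u₃ a * P.d₃ c})
    (Fac := Submodule.span ℤ[X] {P.d₂ 1 a * P.u₂ a c, P.d₂ 1 c * Z})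
    (Fs := Submodule.span ℤ[X] {P.d₃ c, 0})
    (.inr (.inl ⟨rfl, mem₁ _ _⟩)) (mul_mem_of_mem_span_pair ?_ ?_) (mul_mem_of_mem_span_pair ?_ ?_)
    (mul_mem_of_mem_span_pair ?_ ?_) (mul_mem_of_mem_span_pair ?_ ?_)
    (mul_mem_of_mem_span_pair ?_ ?_) (mul_mem_of_mem_span_pair ?_ ?_)
    (mul_mem_of_mem_span_pair ?_ ?_) (mul_mem_of_mem_span_pair ?_ ?_)
    (mul_mem_of_mem_span_pair ?_ ?_) (mul_mem_of_mem_span_pair ?_ ?_)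
    (mul_mem_of_mem_span_pair ?_ ?_) (mul_mem_of_mem_span_pair ?_ ?_)
    (mul_mem_of_mem_span_pair ?_ ?_) (mul_mem_of_mem_span_pair ?_ ?_)
    (mul_mem_of_mem_span_pair ?_ ?_) (mul_mem_of_mem_span_pair ?_ ?_)
    (mul_mem_of_mem_span_pair ?_ ?_) (mul_mem_of_mem_span_pair ?_ ?_) b
  · exact ⟨key.2.1, key.2.2.1⟩
  · rw [P.quasi₂ c a hac]
    exact Submodule.smul_mem _ _ (mem₁ _ _)
  · exact mem₂ _ _
  · exact mem₁ _ _
  · rw [mul_tail (P.d₂_one_mul_loop h0 ha), zero_mul]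
    exact zero_mem _
  · rw [P.quasi₂ c 1 hc.symm]
    exact Submodule.smul_mem _ _ (mem₁ _ _)
  · rw [mul_tail (P.d₂_mul_step h0 hc)]
    exact mem₂ _ _
  · exact mem₁ _ _
  · rw [hB]
    exact Submodule.smul_mem _ _ (mem₂ _ _)
  · rw [hZ, P.d₂_u₂_tail hac.symm (by rw [← mul_assoc, P.d₂_left])]
    exact Submodule.smul_mem _ _ (mem₁ _ _)
  · rw [hloop, mul_tail (P.d₂_mul_walk h0 ha hac), mul_assoc, hB]
    exact Submodule.smul_mem _ _ (mem₂ _ _)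
  · exact mem₂ _ _
  · rw [mul_tail (P.d₂_one_mul_loop h0 hc), zero_mul]
    exact zero_mem _
  · rw [P.u₂_right]
    exact mem₁ _ _
  · rw [mul_tail (P.u₂_mul_d₂ h0 hc hac.symm), mul_tail (P.loop_left a)]
    exact mem₂ _ _
  · rw [P.u₂_right]
    exact mem₁ _ _
  · rw [step, mul_assoc (P.u₂ 1 c) (P.d₂ c a)]
    exact mem₂ _ _
  · rw [mul_tail (P.u₂_mul_d₂ h0 ha ha), P.u₂_left]
    exact mem₁ _ _
  · have h1 := congrArg (P.u₂ 1 c * ·) hY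
    rw [mul_add, mul_smul_comm, P.u₂_right, ← mul_assoc] at h1
    rw [mul_tail (P.sand_u₂ 1 a c ha.symm hc.symm), mul_assoc]
    exact (Submodule.add_mem_iff_left _ (Submodule.smul_mem _ (X * (X + 1)) (mem₁ _ _))).1
      (by rw [← h1]; exact mem₂ _ _)
  · rw [← hZ]
    exact mem₁ _ _
  · have h1 := congrArg (P.u₂ c 1 * ·) hW
    simp only [mul_add, mul_smul_comm] at h1
    rw [mul_tail (P.u₂_one_mul_d₂_one h0 hc ha hac.symm), zero_mul, smul_zero, add_zero,
      ← mul_assoc] at h1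
    rw [mul_tail (P.sand_u₂ c a 1 hac.symm hc), mul_assoc, ← h1]
    exact mem₂ _ _
  · rw [← mul_assoc]
    exact mem₂ _ _
  · rw [mul_tail (P.u₂_one_mul_d₂_one h0 ha hc hac), zero_mul]
    exact zero_mem _
  · rw [mul_tail (P.u₂_one_mul_d₂_one h0 hc ha hac.symm), zero_mul]
    exact zero_mem _
  · rw [← mul_assoc]
    exact mem₂ _ _
  · rw [P.d₃_right]
    exact mem₁ _ _
  · rw [mul_tail (P.sand_d₂ a c 1 hac ha), mul_assoc, mul_tail (P.d₂_one_mul_loop h0 ha), zero_mul,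
      mul_zero]
    exact zero_mem _
  · rw [mul_tail (P.sand_d₂ 1 a c ha.symm hc.symm), mul_assoc, P.quasi₂ c 1 hc.symm, mul_smul_comm,
      P.d₃_right]
    exact Submodule.smul_mem _ _ (mem₁ _ _)
  · rw [P.d₃_u₃_tail a (P.d₃_left c)]
    exact Submodule.smul_mem _ _ (mem₁ _ _)
  · rw [hU]
    exact Submodule.smul_mem _ _ (mem₁ _ _)
  · rw [hW, mul_add, mul_smul_comm, hU, P.d₃_u₃_tail 1 (P.d₃_left c)]
    exact add_mem (Submodule.smul_mem _ _ (mem₁ _ _))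
      (Submodule.smul_mem _ _ (Submodule.smul_mem _ _ (mem₁ _ _)))
  · exact (Submodule.add_mem_iff_left _ (Submodule.smul_mem _ (X * (X + 1)) (mem₁ _ _))).1
      (by rw [← hY]; exact mem₂ _ _)
  · rw [mul_zero]; exact zero_mem _
  · exact mem₂ _ _
  · rw [mul_zero]; exact zero_mem _
  · exact (Submodule.add_mem_iff_left _ (Submodule.smul_mem _ X (mem₁ _ _))).1
      (by rw [← hW]; exact mem₂ _ _)
  · rw [mul_zero]; exact zero_mem _

end

end HasseAlg
end HeckeS4
end

/-! ### Bijectivity on the components with two non-free double cosets. -/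

noncomputable section
namespace HeckeS4
namespace HasseAlg

variable {B : Type} [Ring B] [Algebra ℤ[X] B] {P : HasseAlg B} (R : P.Realization)

namespace Realization

theorem coord_ev_e {I : Finset (Fin 3)} {w : W} (hw : InPar I w) :
    coord (R.ev I I (P.e I)) w = 1 := by
  rw [R.ev_e, coord_x, if_pos ((mem_parabolic_iff _ _).2 hw)]

theorem coord_ev_e_of_not {I : Finset (Fin 3)} {w : W} (hw : ¬ InPar I w) :
    coord (R.ev I I (P.e I)) w = 0 := by
  rw [R.ev_e, coord_x, if_neg (fun h => hw ((mem_parabolic_iff _ _).1 h))]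

theorem ev_u₃_mul_d₃ (s t : Fin 3) : R.ev {s}ᶜ {t}ᶜ (P.u₃ s * P.d₃ t) = x Finset.univ := by
  rw [R.u₃_mul, ← P.d₃_left, R.mul_d₃, R.ev_e]

theorem coord_x_univ (w : W) : coord (x Finset.univ) w = 1 := by
  rw [coord_x, if_pos ((mem_parabolic_iff _ _).2 fun i hi => absurd (Finset.mem_univ i) hi)]

/-- In each application of `bij_of_two`, w₁ and w₂ represent the non-free double cosets, and n_i is
the Poincaré polynomial of a parabolic subgroup of W_I that conjugation by w_i⁻¹ carries into W_J.
Here s_c commutes with s_a, so W_{a} itself serves for both. -/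
theorem bij_single {a c : Fin 3} (ha : a ≠ 1) (hc : c ≠ 1) (hac : a ≠ c) : R.Bij {a} {a} := by
  refine R.bij_of_two (w₁ := 1) (w₂ := simple c) (n₁ := poincare {a}) (n₂ := poincare {a})
    (P.exists_sub_mem_cell (y₁ := P.e {a}) (y₂ := P.loop a) (P.idem _) (P.idem _) (P.loop_left a)
      (P.loop_right a)
      fun b => P.quot.e_mul_mul_e_single P.quot_e_empty ha hc hac b) ?_ ?_ ?_ ?_ ?_ ?_ ?_ ?_
  · exact P.smul_mem_cell (P.poincare_smul_e_mem_single a) (P.idem _) (P.idem _)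
      (by rw [P.idem, P.idem])
  · exact P.smul_mem_cell (P.poincare_smul_e_mem_single a) (P.loop_left _) (P.loop_right _)
      (by rw [P.loop_left, P.loop_left])
  · exact R.coord_ev_e (by revert a c; decide +kernel)
  · exact R.coord_ev_e_of_not (by revert a c; decide +kernel)
  · rw [loop, R.u₂_mul _ _ _ ha, ← P.d₂_left, R.mul_d₂ _ _ _ ha]
    exact R.coord_ev_e (by revert a c; decide +kernel)
  · exact poincare_dvd_coord subset_rfl (by revert a c; decide +kernel)
      (by revert a c; decide +kernel)
  · exact poincare_dvd_coord subset_rfl (by revert a c; decide +kernel)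
      (by revert a c; decide +kernel)
  · revert a c; decide +kernel

/-- s_1 s_a s_c s_1 interchanges the two blocks of two letters, so it conjugates s_a into s_c. The
path through S evaluates to x_S, all of whose coordinates are 1. -/
theorem bij_single_compl_one {a c : Fin 3} (ha : a ≠ 1) (hc : c ≠ 1) (hac : a ≠ c) :
    R.Bij {a} {1}ᶜ := by
  have hl : P.e {a} * (P.u₂ a 1 * (P.u₃ 1 * P.d₃ 1)) = P.u₂ a 1 * (P.u₃ 1 * P.d₃ 1) := by
    rw [← mul_assoc, P.u₂_left]
  have hr : P.u₂ a 1 * (P.u₃ 1 * P.d₃ 1) * P.e {1}ᶜ = P.u₂ a 1 * (P.u₃ 1 * P.d₃ 1) := by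
    rw [mul_assoc, mul_assoc, P.d₃_right]
  refine R.bij_of_two (w₁ := 1) (w₂ := simple 1 * (simple a * (simple c * simple 1)))
    (n₁ := poincare {a}) (n₂ := poincare {a})
    (P.exists_sub_mem_cell (y₁ := P.u₂ a 1) (y₂ := P.u₂ a 1 * (P.u₃ 1 * P.d₃ 1)) (P.u₂_left _ _)
      (P.u₂_right _ _) hl hr fun b => ?_) ?_ ?_ ?_ ?_ ?_ ?_ ?_ ?_
  · rw [map_mul, map_mul]
    exact (P.quot.e_mul_mul_e_compl_one P.quot_e_empty ha hc hac b).1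
  · exact P.smul_mem_cell (P.poincare_smul_e_mem_single a) (P.u₂_left _ _) (P.u₂_right _ _)
      (by rw [P.u₂_left, P.u₂_left])
  · exact P.smul_mem_cell (P.poincare_smul_e_mem_single a) hl hr (by rw [hl, hl])
  · rw [← P.u₂_right, R.u₂_mul _ _ _ ha]
    exact R.coord_ev_e (by clear * - ha hc hac; revert a c; decide +kernel)
  · rw [← P.u₂_right, R.u₂_mul _ _ _ ha]
    exact R.coord_ev_e_of_not (by clear * - ha hc hac; revert a c; decide +kernel)
  · rw [R.u₂_mul _ _ _ ha, ev_u₃_mul_d₃, coord_x_univ]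
  · exact poincare_dvd_coord subset_rfl (by clear * - ha hc hac; revert a c; decide +kernel)
      (by clear * - ha hc hac; revert a c; decide +kernel)
  · exact poincare_dvd_coord subset_rfl (by clear * - ha hc hac; revert a c; decide +kernel)
      (by clear * - ha hc hac; revert a c; decide +kernel)
  · clear * - ha hc hac; revert a c; decide +kernel

theorem bij_compl_one : R.Bij {1}ᶜ {1}ᶜ := by
  have hl : P.e {1}ᶜ * (P.u₃ 1 * P.d₃ 1) = P.u₃ 1 * P.d₃ 1 := by rw [← mul_assoc, P.u₃_left]
  have hr : P.u₃ 1 * P.d₃ 1 * P.e {1}ᶜ = P.u₃ 1 * P.d₃ 1 := by rw [mul_assoc, P.d₃_right]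
  refine R.bij_of_two (w₁ := 1) (w₂ := simple 1 * (simple 0 * (simple 2 * simple 1)))
    (n₁ := poincare {1}ᶜ) (n₂ := poincare {1}ᶜ)
    (P.exists_sub_mem_cell (y₁ := P.e {1}ᶜ) (y₂ := P.u₃ 1 * P.d₃ 1) (P.idem _)
      (P.idem _) hl hr fun b => ?_) ?_ ?_ ?_ ?_ ?_ ?_ ?_ ?_
  · rw [map_mul]
    exact (P.quot.e_mul_mul_e_compl_one (a := 0) (c := 2) P.quot_e_empty (by decide) (by decide)
      (by decide) b).2
  · exact P.smul_mem_cell (P.poincare_smul_e_mem_compl 1) (P.idem _) (P.idem _)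
      (by rw [P.idem, P.idem])
  · exact P.smul_mem_cell (P.poincare_smul_e_mem_compl 1) hl hr (by rw [hl, hl])
  · exact R.coord_ev_e (by decide +kernel)
  · exact R.coord_ev_e_of_not (by decide +kernel)
  · rw [ev_u₃_mul_d₃, coord_x_univ]
  · exact poincare_dvd_coord subset_rfl (by decide +kernel) (by decide +kernel)
  · exact poincare_dvd_coord subset_rfl (by decide +kernel) (by decide +kernel)
  · decide +kernel

/-- The double coset of s_c contributes only π({a}), because s_c centralizes s_a. Accordingly the
second generator factors through {a}. -/
theorem bij_compl {a c : Fin 3} (ha : a ≠ 1) (hc : c ≠ 1) (hac : a ≠ c) : R.Bij {c}ᶜ {c}ᶜ := by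
  have hY : P.d₂ c a * (P.loop a * P.u₂ a c) =
      P.u₃ c * P.d₃ c + (X * (X + 1) : ℤ[X]) • P.e {c}ᶜ := by
    rw [loop, mul_assoc (P.u₂ a 1)]
    exact P.tors₃ a c ha hc hac
  have hl : P.e {c}ᶜ * (P.d₂ c a * (P.loop a * P.u₂ a c)) = P.d₂ c a * (P.loop a * P.u₂ a c) := by
    rw [← mul_assoc, P.d₂_left]
  have hr : P.d₂ c a * (P.loop a * P.u₂ a c) * P.e {c}ᶜ = P.d₂ c a * (P.loop a * P.u₂ a c) := by
    rw [mul_assoc, mul_assoc, P.u₂_right]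
  refine R.bij_of_two (w₁ := 1) (w₂ := simple c) (n₁ := poincare {c}ᶜ) (n₂ := poincare {a})
    (P.exists_sub_mem_cell (y₁ := P.e {c}ᶜ) (y₂ := P.d₂ c a * (P.loop a * P.u₂ a c)) (P.idem _)
      (P.idem _) hl hr fun b => ?_) ?_ ?_ ?_ ?_ ?_ ?_ ?_ ?_
  · rw [map_mul, map_mul, loop, map_mul]
    exact (P.quot.e_mul_mul_e_compl P.quot_e_empty ha hc hac b).1
  · exact P.smul_mem_cell (P.poincare_smul_e_mem_compl c) (P.idem _) (P.idem _)
      (by rw [P.idem, P.idem])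
  · exact P.smul_mem_cell (P.poincare_smul_e_mem_single a) hl hr
      (z := P.d₂ c a) (by rw [← mul_assoc, P.d₂_right])
  · exact R.coord_ev_e (by clear * - ha hc hac; revert a c; decide +kernel)
  · exact R.coord_ev_e_of_not (by clear * - ha hc hac; revert a c; decide +kernel)
  · have h0 := R.coord_ev_e_of_not (I := {c}ᶜ) (w := simple c) (by clear * - ha hc hac; revert a c; decide +kernel)
    rw [hY, map_add, map_add, map_smul, map_smul, ev_u₃_mul_d₃, Pi.add_apply, Pi.smul_apply,
      coord_x_univ, h0, smul_zero, add_zero]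
  · exact poincare_dvd_coord subset_rfl (by clear * - ha hc hac; revert a c; decide +kernel)
      (by clear * - ha hc hac; revert a c; decide +kernel)
  · exact poincare_dvd_coord (by simpa using hac.symm) (by clear * - ha hc hac; revert a c; decide +kernel)
      (by clear * - ha hc hac; revert a c; decide +kernel)
  · clear * - ha hc hac; revert a c; decide +kernel

theorem coord_h_mul_x {a c : Fin 3} (ha : a ≠ 1) (hc : c ≠ 1) (hac : a ≠ c) :
    coord (h {a}ᶜ {1} * x {c}ᶜ) 1 = 1 ∧
      coord (h {a}ᶜ {1} * x {c}ᶜ) (simple a * (simple 1 * simple c)) = 0 := by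
  classical
  have key : ∀ w, coord (x {c}ᶜ) w = if InPar {c}ᶜ w then 1 else 0 := fun w => by
    rw [coord_x]
    exact if_congr (mem_parabolic_iff _ _) rfl rfl
  have hw : ∀ w, invs w < invs (simple c * w) → invs w < invs (simple 1 * w) →
      invs (simple 1 * w) < invs (simple c * (simple 1 * w)) → ¬ InPar {c}ᶜ (simple c * w) →
      ¬ InPar {c}ᶜ (simple c * (simple 1 * w)) →
      coord (h {a}ᶜ {1} * x {c}ᶜ) w = if InPar {c}ᶜ w then 1 else 0 := by
    intro w h1 h2 h3 h4 h5
    rw [h_adj ha ha hac hc.symm, add_mul, add_mul, one_mul, mul_assoc, map_add, map_add,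
      Pi.add_apply, Pi.add_apply, coord_gen_mul, coord_gen_mul, coord_gen_mul, key]
    simp only [Lop, LinearMap.coe_mk, AddHom.coe_mk, if_neg (asymm h1), if_neg (asymm h2),
      if_neg (asymm h3), key, if_neg h4, if_neg h5, mul_zero, add_zero]
  refine ⟨(hw 1 ?_ ?_ ?_ ?_ ?_).trans (if_pos ?_), (hw _ ?_ ?_ ?_ ?_ ?_).trans (if_neg ?_)⟩ <;>
    (clear * - ha hc hac; revert a c; decide +kernel)

/-- At the identity the common parabolic subgroup is W_{1}, matching the generator through {1}. The
element s_a s_1 s_c conjugates the whole of one parabolic subgroup of type A₂ into the other,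
matching the generator through S. -/
theorem bij_compl_compl {a c : Fin 3} (ha : a ≠ 1) (hc : c ≠ 1) (hac : a ≠ c) :
    R.Bij {a}ᶜ {c}ᶜ := by
  have hl : P.e {a}ᶜ * (P.u₃ a * P.d₃ c) = P.u₃ a * P.d₃ c := by rw [← mul_assoc, P.u₃_left]
  have hr : P.u₃ a * P.d₃ c * P.e {c}ᶜ = P.u₃ a * P.d₃ c := by rw [mul_assoc, P.d₃_right]
  have hl' : P.e {a}ᶜ * (P.d₂ a 1 * P.u₂ 1 c) = P.d₂ a 1 * P.u₂ 1 c := by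
    rw [← mul_assoc, P.d₂_left]
  have hr' : P.d₂ a 1 * P.u₂ 1 c * P.e {c}ᶜ = P.d₂ a 1 * P.u₂ 1 c := by rw [mul_assoc, P.u₂_right]
  have hy : R.ev {a}ᶜ {c}ᶜ (P.d₂ a 1 * P.u₂ 1 c) = h {a}ᶜ {1} * x {c}ᶜ := by
    rw [R.d₂_mul _ _ _ ha.symm, ← P.u₂_right, R.u₂_mul _ _ _ hc.symm, R.ev_e]
  refine R.bij_of_two (w₁ := 1) (w₂ := simple a * (simple 1 * simple c)) (n₁ := poincare {1})
    (n₂ := poincare {a}ᶜ) (P.exists_sub_mem_cell hl' hr' hl hr fun b => ?_) ?_ ?_ ?_ ?_ ?_ ?_ ?_ ?_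
  · rw [map_mul, map_mul]
    exact (P.quot.e_mul_mul_e_compl P.quot_e_empty ha hc hac b).2
  · exact P.smul_mem_cell (P.poincare_smul_e_mem_single 1) hl' hr'
      (z := P.d₂ a 1) (by rw [← mul_assoc, P.d₂_right])
  · exact P.smul_mem_cell (P.poincare_smul_e_mem_compl a) hl hr (by rw [hl, hl])
  · rw [hy]
    exact (coord_h_mul_x ha hc hac).1
  · rw [hy]
    exact (coord_h_mul_x ha hc hac).2
  · rw [ev_u₃_mul_d₃, coord_x_univ]
  · exact poincare_dvd_coord (by simpa using ha) (by clear * - ha hc hac; revert a c; decide +kernel)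
      (by clear * - ha hc hac; revert a c; decide +kernel)
  · exact poincare_dvd_coord subset_rfl (by clear * - ha hc hac; revert a c; decide +kernel)
      (by clear * - ha hc hac; revert a c; decide +kernel)
  · clear * - ha hc hac; revert a c; decide +kernel

end Realization
end HasseAlg
end HeckeS4
end

noncomputable section
namespace HeckeS4

theorem LInv.mono {I J : Finset (Fin 3)} (hIJ : I ⊆ J) {z : H} (hz : LInv J z) : LInv I z :=
  fun i hi => hz i (hIJ hi)

theorem LInv.linv_h_mul {I J : Finset (Fin 3)} (hIJ : I ⊆ J) {z : H} (hz : LInv I z) :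
    LInv J (h J I * z) := by
  rw [hz.eq_x_mul, ← mul_assoc, h_mul_x hIJ]
  exact (x_LInv J).mul_right _

theorem aug_h_compl {s t : Fin 3} (hst : s ≠ t) : aug (h {t}ᶜ {s}) = ratio₂ t := by
  have h1 := aug_h_mul (I := {s}) (J := {t}ᶜ) (by simpa using hst.symm)
  have h2 : poincare {t}ᶜ = poincare {s} * ratio₂ t := by
    rw [poincare_single, ratio₂]
    split_ifs with ht
    · rw [ht, poincare_compl_one]
    · rw [poincare_compl ht]
  rw [h2] at h1
  exact mul_left_cancel₀ (poincare_ne_zero _) h1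

namespace HasseAlg

variable {B : Type} [Ring B] [Algebra ℤ[X] B] (P : HasseAlg B)

/-! ### The vertex `S` -/

/-- The path from `S` to `I`. -/
def V (I : Finset (Fin 3)) : B :=
  if I = Finset.univ then P.e Finset.univ else if I.card = 2 then ∑ t ∈ Iᶜ, P.u₃ t
  else if I.card = 1 then ∑ s ∈ I, P.u₂ s (s + 1) * P.u₃ (s + 1)
  else P.u₁ 0 * (P.u₂ 0 1 * P.u₃ 1)

theorem V_univ : P.V Finset.univ = P.e Finset.univ := if_pos rfl

theorem V_compl (t : Fin 3) : P.V {t}ᶜ = P.u₃ t := by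
  have h1 : ({t}ᶜ : Finset (Fin 3)) ≠ Finset.univ ∧ ({t}ᶜ : Finset (Fin 3)).card = 2 := by
    revert t; decide
  rw [V, if_neg h1.1, if_pos h1.2, compl_compl, Finset.sum_singleton]

theorem V_single {s t : Fin 3} (hst : s ≠ t) : P.V {s} = P.u₂ s t * P.u₃ t := by
  have h1 : ({s} : Finset (Fin 3)) ≠ Finset.univ := by clear hst; revert s; decide
  rw [V, if_neg h1, Finset.card_singleton, if_neg (by decide), if_pos rfl, Finset.sum_singleton,
    P.sand_u₂ s (s + 1) t (by clear hst h1; revert s; decide) hst]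

theorem V_empty (s : Fin 3) : P.V ∅ = P.u₁ s * P.V {s} := by
  obtain ⟨t, ht, hst⟩ : ∃ t : Fin 3, 0 ≠ t ∧ s ≠ t := by revert s; decide
  have h0 : P.V ∅ = P.u₁ 0 * (P.u₂ 0 1 * P.u₃ 1) := by
    rw [V, if_neg (by decide), if_neg (by decide), if_neg (by decide)]
  rw [h0, P.V_single hst, P.sand_u₂ 0 1 t (by decide) ht, ← mul_assoc, P.sand_u₁ 0 s t ht hst,
    mul_assoc]

/-- By the quasi-idempotent and sandwich relations alone, every arrow sends a path V_J from S to a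
multiple of such a path. -/
theorem e_mul_mul_e_univ (b : B) (I : Finset (Fin 3)) :
    P.e I * (b * P.e Finset.univ) ∈ Submodule.span ℤ[X] {P.V I} := by
  have key : ∀ {I J : Finset (Fin 3)} {α : B} {n : ℤ[X]}, α * P.V J = n • P.V I →
      ∀ y ∈ Submodule.span ℤ[X] {P.V J}, α * y ∈ Submodule.span ℤ[X] {P.V I} := by
    intro I J α n h y hy
    obtain ⟨m, rfl⟩ := Submodule.mem_span_singleton.1 hy
    rw [mul_smul_comm, h]
    exact Submodule.smul_mem _ _ (Submodule.smul_mem _ _ (Submodule.mem_span_singleton_self _))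
  refine P.e_mul_mem (F := fun I => Submodule.span ℤ[X] {P.V I}) ?_ (fun s => key (n := 1) ?_)
    (fun s => key (n := 1 + X) ?_) (fun s t hst => key (n := 1) ?_)
    (fun t s hst => key (n := ratio₂ t) ?_) (fun t => key (n := 1) ?_)
    (fun t => key (n := ratio₃ t) ?_) b I
  · rw [V_univ]
    exact Submodule.mem_span_singleton_self _
  · rw [← V_empty, one_smul]
  · obtain ⟨t, hst⟩ : ∃ t, s ≠ t := by revert s; decide
    rw [P.V_empty s, mul_tail (P.quasi₁ s), smul_mul_assoc, P.V_single hst, ← mul_assoc, P.u₂_left]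
  · rw [P.V_single hst, P.V_compl, one_smul]
  · rw [P.V_single hst, P.V_compl, mul_tail (P.quasi₂ t s hst), smul_mul_assoc, P.u₃_left]
  · rw [V_univ, V_compl, P.u₃_right, one_smul]
  · rw [V_univ, V_compl, P.quasi₃]

variable {P} (R : P.Realization)

namespace Realization

theorem ev_V (I : Finset (Fin 3)) : R.ev I Finset.univ (P.V I) = x Finset.univ := by
  have hc : ∀ t, R.ev {t}ᶜ Finset.univ (P.V {t}ᶜ) = x Finset.univ := fun t => by
    rw [V_compl, ← P.u₃_right, R.u₃_mul, R.ev_e]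
  have hs : ∀ s, R.ev {s} Finset.univ (P.V {s}) = x Finset.univ := fun s => by
    obtain ⟨t, hst⟩ : ∃ t, s ≠ t := by revert s; decide
    rw [P.V_single hst, R.u₂_mul _ _ _ hst, ← V_compl, hc]
  rcases finset_cases I with rfl | ⟨s, rfl⟩ | ⟨t, rfl⟩ | rfl
  · rw [P.V_empty 0, R.u₁_mul, hs]
  · exact hs s
  · exact hc t
  · rw [V_univ, R.ev_e]

/-- An element that is right invariant under all of W has constant coordinates, so it is a multiple
of x_S, the value of V_I. -/
theorem bij_univ_right (I : Finset (Fin 3)) : R.Bij I Finset.univ := by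
  refine ⟨fun b h₁ h₂ h₃ => ?_, fun z h₁ h₂ => ⟨coord z 1 • P.V I, ?_⟩⟩
  · obtain ⟨n, hn⟩ := Submodule.mem_span_singleton.1 (P.e_mul_mul_e_univ b I)
    rw [h₂, h₁] at hn
    rw [← hn, map_smul, ev_V] at h₃
    have := congrFun (congrArg coord h₃) 1
    rw [map_smul, Pi.smul_apply, coord_x_univ, map_zero, smul_eq_mul, mul_one] at this
    rw [← hn, this]
    exact zero_smul _ _
  · rw [map_smul, ev_V]
    refine coord_injective fun w => ?_
    have hw : w ∈ parabolic Finset.univ :=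
      (mem_parabolic_iff _ _).2 fun i hi => absurd (Finset.mem_univ i) hi
    rw [map_smul, Pi.smul_apply, coord_x_univ, smul_eq_mul, mul_one, ← h₂.coord_mul hw, one_mul]

theorem bij_univ_left (J : Finset (Fin 3)) : R.Bij Finset.univ J := (R.opp.bij_univ_right J).of_opp

/-! ### Passing between components -/

theorem mem_range_of_x_mul {I J : Finset (Fin 3)} (a : H) {z : H} (hz : RInv J z) :
    x I * (a * z) ∈ LinearMap.range (R.ev I J) := by
  refine ⟨P.cell I J (a * flip (restr (LMin J) (flip z))), ?_⟩
  rw [ev_cell, mul_assoc, mul_assoc, ← hz.eq_mul_x]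

/-- At {t} both (1 + q) e and, by (T1), q e + u₂ d₂ factor through ∅. The term u₂ d₂ passes through
{r}ᶜ, and multiplied by 1 + q + q² it can be routed through {s}, where bijectivity is known. -/
theorem Bij.transfer {R : P.Realization} {r s t : Fin 3} (hr : r ≠ 1) (hrs : r ≠ s) (hrt : r ≠ t)
    (hst : s ≠ t) {J : Finset (Fin 3)} (hR : R.Bij {s} J) : R.Bij {t} J := by
  -- A Bézout identity between the scalars 1 + q of d₁ u₁ and q(1 + q + q²) of (T1).
  have hX : (1 : ℤ[X]) = (1 + X ^ 2) * (1 + X) - ratio₂ r * X := by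
    rw [ratio₂, if_neg hr]
    ring
  refine ⟨fun b h₁ h₂ h₃ => ?_, fun z h₁ h₂ => ?_⟩
  · have h0 : P.u₂ s r * (P.d₂ r t * b) = 0 := by
      refine hR.1 _ ?_ ?_ ?_
      · rw [← mul_assoc, P.u₂_left]
      · rw [mul_assoc, mul_assoc, h₂]
      · rw [R.u₂_mul _ _ _ hrs.symm, R.d₂_mul _ _ _ hrt.symm, h₃, mul_zero]
    have h1 := congrArg (fun y => P.u₂ t r * (P.d₂ r s * y)) h0
    simp only [mul_zero] at h1
    rw [P.d₂_u₂_tail hrs.symm (by rw [← mul_assoc, P.d₂_left]), mul_smul_comm] at h1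
    have h2 := congrArg (· * b) (P.tors₁ r t s hr hrt hrs hst.symm)
    simp only [add_mul, smul_mul_assoc, mul_assoc, h₁] at h2
    have h3 := congrArg (· * b) (P.quasi₁ t)
    simp only [smul_mul_assoc, h₁, mul_assoc] at h3
    -- The coefficients are those of `hX`, the extra term u₂ d₂ b being killed by 1 + q + q². Thus b
    -- lies in the ideal of ∅, where `ev` is injective.
    have h4 : b = (1 + X ^ 2 : ℤ[X]) • (P.d₁ t * (P.u₁ t * b)) +
        (-ratio₂ r) • (P.d₁ t * (P.u₁ s * (P.d₁ s * (P.u₁ t * b)))) := by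
      rw [h2, h3, smul_add, neg_smul, h1, neg_zero, zero_add, neg_smul, ← sub_eq_add_neg, smul_smul,
        smul_smul, ← sub_smul, ← hX, one_smul]
    have hm : ∀ y, P.d₁ t * y ∈ TwoSidedIdeal.span {P.e ∅} := fun y => by
      rw [← P.d₁_right, mul_assoc]
      exact TwoSidedIdeal.mul_mem_left _ _ _
        (TwoSidedIdeal.mul_mem_right _ _ _ (TwoSidedIdeal.subset_span rfl))
    refine R.eq_zero_of_mem_span h₁ h₂ ?_ h₃
    rw [h4, ← mul_smul_comm, ← mul_smul_comm (-ratio₂ r)]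
    exact add_mem (hm _) (hm _)
  · have hx : ∀ s, h {s} ∅ = x {s} := fun s => by
      rw [← h_mul_x (Finset.empty_subset {s}), x_empty, mul_one]
    have hy : LInv {r}ᶜ (h {r}ᶜ {t} * z) := h₁.linv_h_mul (by simpa using hrt)
    obtain ⟨b, hb⟩ := hR.2 _ (hy.mono (by simpa using hrs)) (h₂.mul_left _)
    have m₁ : ratio₂ r • (h {r}ᶜ {t} * z) ∈ LinearMap.range (R.ev {t} J) := by
      refine ⟨P.u₂ t r * (P.d₂ r s * b), ?_⟩
      rw [R.u₂_mul _ _ _ hrt.symm, R.d₂_mul _ _ _ hrs.symm, hb, hy.h_mul, aug_h_compl hrs.symm]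
    have m₂ : (1 + X : ℤ[X]) • z ∈ LinearMap.range (R.ev {t} J) := by
      rw [← poincare_single t, ← h₁.x_mul, ← one_mul z]
      exact R.mem_range_of_x_mul 1 h₂
    have m₃ := R.mem_range_of_x_mul (I := {t}) (x {s}) h₂
    have h3 := torsion₁ hr hrt hrs hst.symm h₁
    rw [hx, hx] at h3
    rw [h3] at m₃
    have h4 : z = (1 + X ^ 2 : ℤ[X]) • (1 + X : ℤ[X]) • z +
        ((-ratio₂ r) • (h {r}ᶜ {t} * z + (X : ℤ[X]) • z) + ratio₂ r • (h {r}ᶜ {t} * z)) := by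
      conv_lhs => rw [← one_smul ℤ[X] z, hX]
      module
    change z ∈ LinearMap.range (R.ev {t} J)
    rw [h4]
    exact add_mem (Submodule.smul_mem _ _ m₂) (add_mem (Submodule.smul_mem _ _ m₃) m₁)

open MulOpposite in
theorem Bij.opp {R : P.Realization} {I J : Finset (Fin 3)} (hR : R.Bij I J) : R.opp.Bij J I := by
  refine ⟨fun b h₁ h₂ h₃ => ?_, fun z h₁ h₂ => ?_⟩
  · refine unop_injective (hR.1 (unop b) (congrArg unop h₂) (congrArg unop h₁) ?_)
    exact (flip_flip _).symm.trans ((congrArg flip h₃).trans (map_zero _))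
  · obtain ⟨b, hb⟩ := hR.2 (flip z) h₂.flip h₁.flip
    exact ⟨op b, by rw [← flip_flip z]; exact congrArg flip hb⟩

/-- Bijectivity on the component at `(I, J)` up to multiplication by `n`. -/
def BijUpTo (R : P.Realization) (n : ℤ[X]) (I J : Finset (Fin 3)) : Prop :=
  (∀ b, P.e I * b = b → b * P.e J = b → R.ev I J b = 0 → n • b = 0) ∧
    ∀ z, LInv I z → RInv J z → ∃ b, R.ev I J b = n • z

open MulOpposite in
theorem BijUpTo.of_opp {R : P.Realization} {n : ℤ[X]} {I J : Finset (Fin 3)}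
    (hR : R.opp.BijUpTo n J I) : R.BijUpTo n I J := by
  refine ⟨fun b h₁ h₂ h₃ => ?_, fun z h₁ h₂ => ?_⟩
  · refine op_injective (hR.1 (op b) (congrArg op h₂) (congrArg op h₁) ?_)
    exact (congrArg flip h₃).trans (map_zero _)
  · obtain ⟨b, hb⟩ := hR.2 (flip z) h₂.flip h₁.flip
    refine ⟨unop b, ?_⟩
    rw [← flip_flip (R.ev I J _), ← flip_flip z, ← map_smul]
    exact congrArg flip hb

theorem Bij.of_coprime {R : P.Realization} {n m : ℤ[X]} (hnm : IsCoprime n m)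
    {I J : Finset (Fin 3)} (hn : R.BijUpTo n I J) (hm : R.BijUpTo m I J) : R.Bij I J := by
  obtain ⟨u, v, huv⟩ := hnm
  refine ⟨fun b h₁ h₂ h₃ => ?_, fun z h₁ h₂ => ?_⟩
  · rw [← one_smul ℤ[X] b, ← huv, add_smul, mul_smul, mul_smul, hn.1 b h₁ h₂ h₃, hm.1 b h₁ h₂ h₃,
      smul_zero, smul_zero, add_zero]
  · obtain ⟨b, hb⟩ := hn.2 z h₁ h₂
    obtain ⟨b', hb'⟩ := hm.2 z h₁ h₂
    refine ⟨u • b + v • b', ?_⟩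
    rw [map_add, map_smul, map_smul, hb, hb', smul_smul, smul_smul, ← add_smul, huv, one_smul]

/-- Going to ∅ by u₁ reduces to the known row, and coming back by d₁ multiplies by 1 + q; similarly
for `Bij.upTo_compl`. -/
theorem Bij.upTo_single {R : P.Realization} (s : Fin 3) {J : Finset (Fin 3)} (hR : R.Bij ∅ J) :
    R.BijUpTo (1 + X) {s} J := by
  refine ⟨fun b h₁ h₂ h₃ => ?_, fun z h₁ h₂ => ?_⟩
  · have h0 : P.u₁ s * b = 0 := hR.1 _ (by rw [← mul_assoc, P.u₁_left]) (by rw [mul_assoc, h₂])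
      (by rw [R.u₁_mul, h₃])
    have h1 := congrArg (P.d₁ s * ·) h0
    simp only [mul_zero] at h1
    rwa [mul_tail (P.quasi₁ s), smul_mul_assoc, h₁] at h1
  · obtain ⟨b, hb⟩ := hR.2 z (h₁.mono (Finset.empty_subset _)) h₂
    refine ⟨P.d₁ s * b, ?_⟩
    rw [R.d₁_mul, hb, h₁.h_mul, h_single, map_add, map_one, aug_gen]

theorem Bij.upTo_compl {R : P.Realization} {s t : Fin 3} (hst : s ≠ t) {J : Finset (Fin 3)}
    (hR : R.Bij {s} J) : R.BijUpTo (ratio₂ t) {t}ᶜ J := by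
  refine ⟨fun b h₁ h₂ h₃ => ?_, fun z h₁ h₂ => ?_⟩
  · have h0 : P.u₂ s t * b = 0 := hR.1 _ (by rw [← mul_assoc, P.u₂_left]) (by rw [mul_assoc, h₂])
      (by rw [R.u₂_mul _ _ _ hst, h₃])
    have h1 := congrArg (P.d₂ t s * ·) h0
    simp only [mul_zero] at h1
    rwa [mul_tail (P.quasi₂ t s hst), smul_mul_assoc, h₁] at h1
  · obtain ⟨b, hb⟩ := hR.2 z (h₁.mono (by simpa using hst.symm)) h₂
    refine ⟨P.d₂ t s * b, ?_⟩
    rw [R.d₂_mul _ _ _ hst, hb, h₁.h_mul, aug_h_compl hst]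

theorem isCoprime_ratio₂ {t : Fin 3} (ht : t ≠ 1) : IsCoprime (ratio₂ t) (1 + X) := by
  refine ⟨1, -X, ?_⟩
  rw [ratio₂, if_neg ht]
  ring

theorem Bij.transfer_all {R : P.Realization} {J : Finset (Fin 3)} (hR : R.Bij {0} J) (s : Fin 3) :
    R.Bij {s} J := by
  have h1 : R.Bij {1} J := hR.transfer (r := 2) (by decide) (by decide) (by decide) (by decide)
  have h2 : R.Bij {2} J := h1.transfer (r := 0) (by decide) (by decide) (by decide) (by decide)
  fin_cases s
  exacts [hR, h1, h2]

theorem bij_single_single (s t : Fin 3) : R.Bij {s} {t} := by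
  have h0 : R.opp.Bij {0} {0} := R.opp.bij_single (c := 2) (by decide) (by decide) (by decide)
  exact (h0.transfer_all t).of_opp.transfer_all s

theorem bij_single_compl_one' (s : Fin 3) : R.Bij {s} {1}ᶜ :=
  (R.bij_single_compl_one (a := 0) (c := 2) (by decide) (by decide) (by decide)).transfer_all s

/-- For an end node t, the row gives the factor 1 + q + q² and the column gives 1 + q, which are
coprime. For t = 1 both factors are 1 + q, so this case comes from a directly computed component. -/
theorem bij_compl_single (t s : Fin 3) : R.Bij {t}ᶜ {s} := by
  by_cases ht : t = 1
  · subst ht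
    exact (R.opp.bij_single_compl_one' s).of_opp
  · exact .of_coprime (isCoprime_ratio₂ ht)
      ((R.bij_single_single 1 s).upTo_compl (Ne.symm ht))
      (.of_opp ((R.opp.bij_empty_left {t}ᶜ).upTo_single s))

theorem bij_compl_compl_one {t : Fin 3} (ht : t ≠ 1) : R.Bij {t}ᶜ {1}ᶜ := by
  have h1 : R.opp.BijUpTo (1 + X) {1}ᶜ {t}ᶜ := by
    have h2 := (R.bij_compl_single t 0).opp.upTo_compl (t := 1) (by decide)
    rwa [ratio₂, if_pos rfl] at h2
  exact .of_coprime (isCoprime_ratio₂ ht) ((R.bij_single_compl_one' 1).upTo_compl (Ne.symm ht))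
    h1.of_opp

/-- A realization is bijective on all components. -/
theorem bij (I J : Finset (Fin 3)) : R.Bij I J := by
  rcases finset_cases I with rfl | ⟨s, rfl⟩ | ⟨s, rfl⟩ | rfl
  · exact R.bij_empty_left J
  · rcases finset_cases J with rfl | ⟨t, rfl⟩ | ⟨t, rfl⟩ | rfl
    · exact R.bij_empty_right _
    · exact R.bij_single_single s t
    · exact (R.opp.bij_compl_single t s).of_opp
    · exact R.bij_univ_right _
  · rcases finset_cases J with rfl | ⟨t, rfl⟩ | ⟨t, rfl⟩ | rfl
    · exact R.bij_empty_right _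
    · exact R.bij_compl_single s t
    · by_cases hs : s = 1
      · subst hs
        by_cases ht : t = 1
        · subst ht
          exact R.bij_compl_one
        · exact (R.opp.bij_compl_compl_one ht).of_opp
      · by_cases ht : t = 1
        · subst ht
          exact R.bij_compl_compl_one hs
        · by_cases hst : s = t
          · subst hst
            obtain ⟨a, ha, has⟩ : ∃ a : Fin 3, a ≠ 1 ∧ a ≠ s := by clear * -; revert s; decide
            exact R.bij_compl ha hs has
          · exact R.bij_compl_compl hs ht hst
    · exact R.bij_univ_right _
  · exact R.bij_univ_left J

end Realization
end HasseAlg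
end HeckeS4
end

/-! ### The universal property of the path algebra and the canonical homomorphism. -/

noncomputable section

namespace QuiverAlg

variable {k V : Type} [CommRing k] [Quiver.{0} V]

theorem ofPath_cons {a b c : V} (p : Quiver.Path a b) (f : b ⟶ c) :
    (ofPath (p.cons f) : PathAlg k V) = ofPath f.toPath * ofPath p := by
  rw [ofPath_mul_comp]
  rfl

variable {A : Type} [Semiring A] [Algebra k A]

/-- The value on a path of the homomorphism with the values `ε` on the trivial paths and `α` on the
arrows. -/
def pathVal (ε : V → A) (α : ∀ {a b : V}, (a ⟶ b) → A) {a : V} : {b : V} → Quiver.Path a b → A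
  | _, .nil => ε a
  | _, .cons p f => α f * pathVal ε α p

variable {ε : V → A} {α : ∀ {a b : V}, (a ⟶ b) → A}

theorem mul_pathVal (h₁ : ∀ v, ε v * ε v = ε v) (h₂ : ∀ {a b : V} (f : a ⟶ b), ε b * α f = α f)
    {a b : V} (p : Quiver.Path a b) : ε b * pathVal ε α p = pathVal ε α p := by
  cases p with
  | nil => exact h₁ a
  | cons p f => rw [pathVal, ← mul_assoc, h₂]

theorem pathVal_mul (h₁ : ∀ v, ε v * ε v = ε v) {a b : V} (p : Quiver.Path a b) :
    pathVal ε α p * ε a = pathVal ε α p := by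
  induction p with
  | nil => exact h₁ a
  | cons p f ih => rw [pathVal, mul_assoc, ih]

theorem pathVal_comp (h₁ : ∀ v, ε v * ε v = ε v) (h₂ : ∀ {a b : V} (f : a ⟶ b), ε b * α f = α f)
    {a b c : V} (p : Quiver.Path a b) (q : Quiver.Path b c) :
    pathVal ε α (p.comp q) = pathVal ε α q * pathVal ε α p := by
  induction q with
  | nil => exact (mul_pathVal h₁ h₂ p).symm
  | cons q f ih => rw [Quiver.Path.comp_cons, pathVal, pathVal, ih, mul_assoc]

/-- The linear map with prescribed values on the basis of paths. -/
def linearLift (F : Paths V → A) : PathAlg k V →ₗ[k] A := Finsupp.lift A k (Paths V) F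

theorem linearLift_ofPath (F : Paths V → A) {a b : V} (p : Quiver.Path a b) :
    linearLift (k := k) F (ofPath p) = F ⟨a, b, p⟩ := by
  have : Finsupp.lift A k (Paths V) F (Finsupp.single (⟨a, b, p⟩ : Paths V) (1 : k)) =
      F ⟨a, b, p⟩ := by
    rw [Finsupp.lift_apply, Finsupp.sum_single_index (by simp), one_smul]
  exact this

variable [Fintype V]

/-- The homomorphism from the path algebra with given values on trivial paths and arrows. -/
def lift (ε : V → A) (α : ∀ {a b : V}, (a ⟶ b) → A) (h₀ : ∑ v, ε v = 1)
    (h₁ : ∀ v, ε v * ε v = ε v) (h₁' : ∀ v w, v ≠ w → ε v * ε w = 0)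
    (h₂ : ∀ {a b : V} (f : a ⟶ b), ε b * α f = α f)  :
    PathAlg k V →ₐ[k] A :=
  AlgHom.ofLinearMap (linearLift fun p => pathVal ε α p.2.2)
    (by
      rw [one_def, map_sum, ← h₀]
      exact Finset.sum_congr rfl fun v _ => linearLift_ofPath _ _)
    (by
      intro f g
      refine induct (P := fun f => linearLift _ (f * g) = linearLift _ f * linearLift _ g) f ?_ ?_ ?_
      · rw [zero_mul, map_zero, zero_mul]
      · intro f f' hf hf'
        rw [add_mul, map_add, map_add, add_mul, hf, hf']
      intro c a b p
      rw [smul_mul_assoc, map_smul, map_smul, smul_mul_assoc]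
      congr 1
      refine induct (P := fun g => linearLift _ (ofPath p * g) = linearLift _ (ofPath p) * linearLift _ g)
        g ?_ ?_ ?_
      · rw [mul_zero, map_zero, mul_zero]
      · intro f f' hf hf'
        rw [mul_add, map_add, map_add, mul_add, hf, hf']
      intro c a' b' p'
      rw [mul_smul_comm, map_smul, map_smul, mul_smul_comm]
      congr 1
      rw [linearLift_ofPath, linearLift_ofPath]
      by_cases h : b' = a
      · subst h
        rw [ofPath_mul_comp, linearLift_ofPath, pathVal_comp h₁ h₂]
      · rw [ofPath_mul_ne _ _ h, map_zero, ← pathVal_mul h₁ p, ← mul_pathVal h₁ h₂ p', mul_assoc,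
          ← mul_assoc (ε a), h₁' _ _ (Ne.symm h), zero_mul, mul_zero])

theorem lift_ofPath {h₀ : ∑ v, ε v = 1}
    {h₁ : ∀ v, ε v * ε v = ε v} {h₁' : ∀ v w, v ≠ w → ε v * ε w = 0}
    {h₂ : ∀ {a b : V} (f : a ⟶ b), ε b * α f = α f} {a b : V} (p : Quiver.Path a b) :
    lift (k := k) ε α h₀ h₁ h₁' h₂ (ofPath p) = pathVal ε α p :=
  linearLift_ofPath _ p

/-- The path algebra is generated by the trivial paths and the arrows. -/
theorem generate {Q : PathAlg k V → Prop} (hadd : ∀ f g, Q f → Q g → Q (f + g))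
    (hsmul : ∀ (c : k) f, Q f → Q (c • f)) (hmul : ∀ f g, Q f → Q g → Q (f * g))
    (hnil : ∀ v : V, Q (ofPath (Quiver.Path.nil : Quiver.Path v v)))
    (harrow : ∀ {a b : V} (f : a ⟶ b), Q (ofPath f.toPath)) (h0 : Q 0) (f : PathAlg k V) : Q f := by
  refine induct f h0 hadd fun c a b p => hsmul c _ ?_
  induction p with
  | nil => exact hnil a
  | cons p f ih => rw [ofPath_cons]; exact hmul _ _ (harrow f) ih

end QuiverAlg

namespace HeckeS4

/-! ## The endomorphism algebra -/

theorem mem_xH_iff {I : Finset (Fin 3)} {z : H} : z ∈ xH I ↔ LInv I z := by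
  rw [Submodule.mem_span_singleton]
  constructor
  · rintro ⟨a, rfl⟩
    exact (x_LInv I).mul_right a.unop
  · intro hz
    exact ⟨MulOpposite.op (restr (LMin I) z), hz.eq_x_mul.symm⟩

/-- The direct sum of the modules `x_I H`. -/
abbrev M : Type := ⨁ I : Finset (Fin 3), xH I

theorem E_ext {f g : E} (h : ∀ (z : M) (L : Finset (Fin 3)), (f z L : H) = (g z L : H)) : f = g :=
  LinearMap.ext fun z => DFinsupp.ext fun L => Subtype.ext (h z L)

theorem coe_of_apply (I L : Finset (Fin 3)) (y : xH I) :
    ((DirectSum.of (fun I => xH I) I y : M) L : H) = if L = I then (y : H) else 0 := by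
  split_ifs with h
  · subst h
    rw [DirectSum.of_eq_same]
  · rw [DirectSum.of_eq_of_ne _ _ _ h]
    rfl

/-- The endomorphism that is `α` on the summand `x_J H`, with values in `x_I H`, and zero on the
other summands. -/
def matrixUnit {I J : Finset (Fin 3)} (α : xH J →ₗ[Hᵐᵒᵖ] xH I) : E :=
  DirectSum.lof Hᵐᵒᵖ _ (fun I => xH I) I ∘ₗ α ∘ₗ DirectSum.component Hᵐᵒᵖ _ (fun I => xH I) J

theorem matrixUnit_apply {I J : Finset (Fin 3)} (α : xH J →ₗ[Hᵐᵒᵖ] xH I) (z : M)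
    (L : Finset (Fin 3)) : (matrixUnit α z L : H) = if L = I then (α (z J) : H) else 0 :=
  coe_of_apply I L _

/-- Left multiplication by an element of the Hecke algebra. -/
def leftMul (a : H) {I J : Finset (Fin 3)} (ha : ∀ z, LInv I z → LInv J (a * z)) :
    xH I →ₗ[Hᵐᵒᵖ] xH J where
  toFun z := ⟨a * z, mem_xH_iff.2 (ha z (mem_xH_iff.1 z.2))⟩
  map_add' y z := Subtype.ext (mul_add a (y : H) z)
  map_smul' c z := Subtype.ext (mul_assoc a (z : H) c.unop).symm

/-- The endomorphism that corresponds to an arrow. -/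
def arrowEnd : {a b : Vertex} → (a ⟶ b) → E
  | _, _, .up (I := I) (J := J) hIJ =>
    matrixUnit (leftMul (I := J) (J := I) 1 fun z hz => by rw [one_mul]; exact hz.mono hIJ.1)
  | _, _, .de (I := I) (J := J) hIJ => matrixUnit (leftMul (h J I) fun _ hz => hz.linv_h_mul hIJ.1)

def vertexEnd (v : Vertex) : E := matrixUnit (LinearMap.id : xH v.set →ₗ[Hᵐᵒᵖ] xH v.set)

theorem vertexEnd_apply (v : Vertex) (z : M) (L : Finset (Fin 3)) :
    (vertexEnd v z L : H) = if L = v.set then (z v.set : H) else 0 := matrixUnit_apply _ z L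

theorem vertexEnd_mul_matrixUnit {I J : Finset (Fin 3)} (α : xH J →ₗ[Hᵐᵒᵖ] xH I) :
    vertexEnd ⟨I⟩ * matrixUnit α = matrixUnit α := by
  refine E_ext fun z L => ?_
  rw [Module.End.mul_apply, vertexEnd_apply, matrixUnit_apply, matrixUnit_apply]
  simp

theorem sum_vertexEnd : ∑ v, vertexEnd v = 1 := by
  refine E_ext fun z L => ?_
  rw [LinearMap.sum_apply, DFinsupp.finsetSum_apply, AddSubmonoidClass.coe_finsetSum]
  simp only [vertexEnd_apply]
  rw [Finset.sum_eq_single ⟨L⟩]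
  · rw [if_pos rfl]; rfl
  · rintro ⟨K⟩ - hK
    exact if_neg fun h => hK (congrArg Vertex.mk h.symm)
  · exact fun h => absurd (Finset.mem_univ _) h

theorem vertexEnd_mul_self (v : Vertex) : vertexEnd v * vertexEnd v = vertexEnd v :=
  vertexEnd_mul_matrixUnit (LinearMap.id : xH v.set →ₗ[Hᵐᵒᵖ] xH v.set)

theorem vertexEnd_mul_of_ne (v w : Vertex) (hvw : v ≠ w) : vertexEnd v * vertexEnd w = 0 :=
  E_ext fun z L => by
    rw [Module.End.mul_apply, vertexEnd_apply, vertexEnd_apply,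
      if_neg (fun h : v.set = w.set => hvw (vertexEquiv.symm.injective h)), ite_self]
    rfl

theorem vertexEnd_mul_arrowEnd {a b : Vertex} (f : a ⟶ b) :
    vertexEnd b * arrowEnd f = arrowEnd f := by
  rcases f with hIJ | hIJ
  · exact vertexEnd_mul_matrixUnit _
  · exact vertexEnd_mul_matrixUnit _

/-- The canonical homomorphism `Φ`. -/
def canonical : Qq →ₐ[ℤ[X]] E :=
  QuiverAlg.lift vertexEnd arrowEnd sum_vertexEnd vertexEnd_mul_self vertexEnd_mul_of_ne
    vertexEnd_mul_arrowEnd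

/-- An arrow is a path of length one built on the trivial path, whose value supplies the factor on
the right. -/
theorem canonical_arrow {a b : Vertex} (f : a ⟶ b) :
    canonical (QuiverAlg.ofPath f.toPath) = arrowEnd f * vertexEnd a :=
  QuiverAlg.lift_ofPath _

theorem isCanonical_canonical : IsCanonical canonical where
  map_e K z L := by
    have : canonical (e K) = vertexEnd ⟨K⟩ := QuiverAlg.lift_ofPath _
    rw [this, vertexEnd_apply]
  map_υ I J hIJ z L := by
    rw [υ, dif_pos hIJ, canonical_arrow, Module.End.mul_apply]
    refine (matrixUnit_apply _ _ L).trans ?_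
    have : ∀ y : M, (leftMul (I := J) (J := I) 1
      (fun z hz => by rw [one_mul]; exact hz.mono hIJ.1) (y J) : H) = y J := fun y => one_mul _
    rw [this, vertexEnd_apply, if_pos rfl]
  map_δ I J hIJ z L := by
    rw [δ, dif_pos hIJ, canonical_arrow, Module.End.mul_apply]
    refine (matrixUnit_apply _ _ L).trans ?_
    have : ∀ y : M, (leftMul (h J I) (fun _ hz => LInv.linv_h_mul hIJ.1 hz) (y I) : H) =
      h J I * y I := fun y => rfl
    rw [this, vertexEnd_apply, if_pos rfl]

theorem generate {Q : Qq → Prop} (hadd : ∀ f g, Q f → Q g → Q (f + g))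
    (hsmul : ∀ (c : ℤ[X]) f, Q f → Q (c • f)) (hmul : ∀ f g, Q f → Q g → Q (f * g)) (h0 : Q 0)
    (he : ∀ I, Q (e I)) (hυ : ∀ I J, Cov I J → Q (υ I J)) (hδ : ∀ I J, Cov I J → Q (δ J I))
    (f : Qq) : Q f := by
  refine QuiverAlg.generate hadd hsmul hmul (fun v => he v.set) ?_ h0 f
  rintro _ _ (hIJ | hIJ)
  · have := hυ _ _ hIJ
    rwa [υ, dif_pos hIJ] at this
  · have := hδ _ _ hIJ
    rwa [δ, dif_pos hIJ] at this

theorem IsCanonical.eq {Φ Φ' : Qq →ₐ[ℤ[X]] E} (hΦ : IsCanonical Φ) (hΦ' : IsCanonical Φ') :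
    Φ = Φ' := by
  refine AlgHom.ext fun f => ?_
  induction f using generate with
  | hadd f g hf hg => rw [map_add, map_add, hf, hg]
  | hsmul c f hf => rw [map_smul, map_smul, hf]
  | hmul f g hf hg => rw [map_mul, map_mul, hf, hg]
  | h0 => rw [map_zero, map_zero]
  | he I => exact E_ext fun z L => by rw [hΦ.map_e, hΦ'.map_e]
  | hυ I J hIJ => exact E_ext fun z L => by rw [hΦ.map_υ I J hIJ, hΦ'.map_υ I J hIJ]
  | hδ I J hIJ => exact E_ext fun z L => by rw [hΦ.map_δ I J hIJ, hΦ'.map_δ I J hIJ]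

end HeckeS4
end

/-! ### The relations in the endomorphism algebra and the presented algebra. -/

noncomputable section
namespace HeckeS4

theorem cov_empty (s : Fin 3) : Cov ∅ {s} := by revert s; decide

theorem cov_single {s t : Fin 3} (hst : s ≠ t) : Cov {s} {t}ᶜ := by revert s t; decide

theorem cov_compl (t : Fin 3) : Cov {t}ᶜ Finset.univ := by revert t; decide

theorem cov_cases {I J : Finset (Fin 3)} : Cov I J → (∃ s, I = ∅ ∧ J = {s}) ∨
    (∃ s t, s ≠ t ∧ I = {s} ∧ J = {t}ᶜ) ∨ ∃ t, I = {t}ᶜ ∧ J = Finset.univ := by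
  revert I J; decide +kernel

theorem IsLabelling.sets {a b c : Fin 3} (h : IsLabelling a b c) : b = 1 ∧ a ≠ 1 ∧ c ≠ 1 ∧ a ≠ c ∧
    ({a, b} : Finset (Fin 3)) = {c}ᶜ ∧ ({b, c} : Finset (Fin 3)) = {a}ᶜ ∧
    ({a, c} : Finset (Fin 3)) = {1}ᶜ := by
  rcases h with ⟨rfl, rfl, rfl⟩ | ⟨rfl, rfl, rfl⟩ <;> decide

theorem isLabelling {a c : Fin 3} (ha : a ≠ 1) (hc : c ≠ 1) (hac : a ≠ c) : IsLabelling a 1 c := by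
  rcases HasseAlg.label_cases ha hc hac with ⟨rfl, rfl⟩ | ⟨rfl, rfl⟩
  · exact .inl ⟨rfl, rfl, rfl⟩
  · exact .inr ⟨rfl, rfl, rfl⟩

theorem pair_eq_compl {r s t : Fin 3} (hrs : r ≠ s) (hrt : r ≠ t) (hst : s ≠ t) :
    ({s, t} : Finset (Fin 3)) = {r}ᶜ := by
  revert r s t; decide

/-- Writing z = x_I y turns both sides into x_K y. -/
theorem LInv.h_mul_h {I J K : Finset (Fin 3)} (hIJ : I ⊆ J) (hJK : J ⊆ K) {z : H}
    (hz : LInv I z) : h K J * (h J I * z) = h K I * z := by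
  rw [hz.eq_x_mul, ← mul_assoc (h J I), h_mul_x hIJ, ← mul_assoc, h_mul_x hJK, ← mul_assoc,
    h_mul_x (hIJ.trans hJK)]

theorem map_sub_eq_zero {A : Type} [Semiring A] [Algebra ℤ[X] A] {B : Type} [Ring B]
    [Algebra ℤ[X] B] (Φ : B →ₐ[ℤ[X]] A) {a b : B} (h : Φ a = Φ b) : Φ (a - b) = 0 := by
  -- The target is only a semiring, so the subtraction is carried out in the source.
  have e : a - b = a + (-1 : ℤ[X]) • b := by module
  have e' : b + (-1 : ℤ[X]) • b = 0 := by module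
  rw [e, map_add, map_smul, h, ← map_smul, ← map_add, e', map_zero]

/-! ### The relations in the endomorphism algebra -/

namespace IsCanonical

variable {Φ : Qq →ₐ[ℤ[X]] E} (hΦ : IsCanonical Φ)

theorem linv_coe (z : M) (I : Finset (Fin 3)) : LInv I (z I : H) := mem_xH_iff.1 (z I).2

theorem apply_add (f g : Qq) (z : M) (L : Finset (Fin 3)) :
    (Φ (f + g) z L : H) = Φ f z L + Φ g z L := by
  rw [map_add]
  rfl

theorem apply_smul (c : ℤ[X]) (f : Qq) (z : M) (L : Finset (Fin 3)) :
    (Φ (c • f) z L : H) = c • (Φ f z L : H) := by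
  rw [map_smul]
  rfl

theorem apply_mul (f g : Qq) (z : M) : Φ (f * g) z = Φ f (Φ g z) := by
  rw [map_mul]
  rfl

include hΦ

theorem map_rel {p : Qq} (hp : Rel p) : Φ p = 0 := by
  induction hp with
  | quasiIdempotent I J hIJ =>
    refine map_sub_eq_zero Φ (E_ext fun z L => ?_)
    rw [apply_mul, apply_smul, hΦ.map_δ I J hIJ, hΦ.map_υ I J hIJ, hΦ.map_e, if_pos rfl,
      poincare_div hIJ.1, (linv_coe z J).h_mul, smul_ite, smul_zero]
  | sandwich_υ I J J' K h₁ h₂ h₃ h₄ =>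
    refine map_sub_eq_zero Φ (E_ext fun z L => ?_)
    rw [apply_mul, apply_mul, hΦ.map_υ I J h₁, hΦ.map_υ J K h₂, hΦ.map_υ I J' h₃, hΦ.map_υ J' K h₄,
      if_pos rfl, if_pos rfl]
  | sandwich_δ I J J' K h₁ h₂ h₃ h₄ =>
    refine map_sub_eq_zero Φ (E_ext fun z L => ?_)
    rw [apply_mul, apply_mul, hΦ.map_δ J K h₂, hΦ.map_δ I J h₁, hΦ.map_δ J' K h₄, hΦ.map_δ I J' h₃,
      if_pos rfl, if_pos rfl, (linv_coe z I).h_mul_h h₁.1 h₂.1, (linv_coe z I).h_mul_h h₃.1 h₄.1]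
  | T1 s t hst =>
    obtain ⟨r, hr, hrs, hrt, hst⟩ : ∃ r : Fin 3, r ≠ 1 ∧ r ≠ s ∧ r ≠ t ∧ s ≠ t := by
      revert s t; decide
    refine map_sub_eq_zero Φ (E_ext fun z L => ?_)
    rw [pair_eq_compl hrs hrt hst, χ]
    simp only [apply_mul, apply_add, apply_smul, hΦ.map_e, hΦ.map_υ _ _ (cov_empty _),
      hΦ.map_δ _ _ (cov_empty _), hΦ.map_υ _ _ (cov_single hrs.symm),
      hΦ.map_δ _ _ (cov_single hrs.symm), if_true]
    split_ifs
    · exact torsion₁ hr hrs hrt hst (linv_coe z _)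
    · rw [smul_zero, add_zero]
  | T2 a b c habc =>
    obtain ⟨rfl, ha, hc, hac, e₁, e₂, e₃⟩ := habc.sets
    refine map_sub_eq_zero Φ (E_ext fun z L => ?_)
    rw [e₃]
    simp only [apply_mul, hΦ.map_υ _ _ (cov_empty _), hΦ.map_δ _ _ (cov_empty _),
      hΦ.map_υ _ _ (cov_single ha), hΦ.map_δ _ _ (cov_single hc), if_true]
    rw [torsion₂ ha hc hac]
  | T3 a b c habc =>
    obtain ⟨rfl, ha, hc, hac, e₁, e₂, e₃⟩ := habc.sets
    refine map_sub_eq_zero Φ (E_ext fun z L => ?_)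
    rw [e₁, e₃]
    simp only [apply_mul, apply_add, apply_smul, hΦ.map_e, hΦ.map_υ _ _ (cov_single ha),
      hΦ.map_δ _ _ (cov_single ha), hΦ.map_υ _ _ (cov_single hac), hΦ.map_δ _ _ (cov_single hac),
      hΦ.map_υ _ _ (cov_compl _), hΦ.map_δ _ _ (cov_compl _), if_true]
    split_ifs
    · exact torsion₃ ha hc hac (linv_coe z _)
    · rw [smul_zero, add_zero]
  | T4 a b c habc =>
    obtain ⟨rfl, ha, hc, hac, e₁, e₂, e₃⟩ := habc.sets
    refine map_sub_eq_zero Φ (E_ext fun z L => ?_)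
    rw [e₁, e₂, e₃]
    simp only [apply_mul, apply_add, apply_smul, hΦ.map_υ _ _ (cov_single ha),
      hΦ.map_υ _ _ (cov_single hc), hΦ.map_υ _ _ (cov_single ha.symm),
      hΦ.map_δ _ _ (cov_single hc.symm), hΦ.map_δ _ _ (cov_single hac.symm),
      hΦ.map_δ _ _ (cov_single hac), hΦ.map_υ _ _ (cov_compl _), hΦ.map_δ _ _ (cov_compl _),
      if_true]
    split_ifs
    · exact torsion₄ ha hc hac (linv_coe z _)
    · rw [smul_zero, add_zero]
  | T4τ a b c habc =>
    obtain ⟨rfl, ha, hc, hac, e₁, e₂, e₃⟩ := habc.sets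
    refine map_sub_eq_zero Φ (E_ext fun z L => ?_)
    rw [e₁, e₂, e₃]
    simp only [apply_mul, apply_add, apply_smul, hΦ.map_υ _ _ (cov_single hac),
      hΦ.map_υ _ _ (cov_single hac.symm), hΦ.map_υ _ _ (cov_single hc.symm),
      hΦ.map_δ _ _ (cov_single hc), hΦ.map_δ _ _ (cov_single ha.symm),
      hΦ.map_δ _ _ (cov_single ha), hΦ.map_υ _ _ (cov_compl _), hΦ.map_δ _ _ (cov_compl _),
      if_true]
    split_ifs
    · exact torsion₄' ha hc hac (linv_coe z _)
    · rw [smul_zero, add_zero]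

theorem map_eq_zero {p : Qq} (hp : p ∈ TwoSidedIdeal.span {p | Rel p}) : Φ p = 0 := by
  rw [TwoSidedIdeal.mem_span_iff_mem_addSubgroup_closure] at hp
  induction hp using AddSubgroup.closure_induction with
  | mem f hf =>
    obtain ⟨f, ⟨u, -, p, hp, rfl⟩, v, -, rfl⟩ := hf
    simp only [map_mul, hΦ.map_rel hp, mul_zero, zero_mul]
  | zero => exact map_zero _
  | add a b _ _ ha hb => rw [map_add, ha, hb, add_zero]
  | neg a _ ha => rw [← neg_one_smul ℤ[X] a, map_smul, ha, smul_zero]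

end IsCanonical

/-! ### The algebra with the given presentation -/

/-- The algebra with the given presentation. -/
abbrev Pres : Type := (TwoSidedIdeal.span {p | Rel p}).ringCon.Quotient

def toPres : Qq →ₐ[ℤ[X]] Pres := RingCon.mkₐ ℤ[X] _

theorem toPres_surjective : Function.Surjective toPres := RingCon.mkₐ_surjective _

theorem toPres_eq_zero_iff {p : Qq} :
    toPres p = 0 ↔ p ∈ TwoSidedIdeal.span {p | Rel p} := by
  rw [TwoSidedIdeal.mem_iff, ← map_zero toPres]
  exact RingCon.eq _

theorem toPres_eq {p p' : Qq} (h : Rel (p - p')) : toPres p = toPres p' := by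
  rw [← sub_eq_zero, ← map_sub, toPres_eq_zero_iff]
  exact TwoSidedIdeal.subset_span h

theorem e_mul_e (I : Finset (Fin 3)) : e I * e I = e I := QuiverAlg.ofPath_mul_comp _ _

theorem e_mul_e_of_ne {I J : Finset (Fin 3)} (h : I ≠ J) : e I * e J = 0 :=
  QuiverAlg.ofPath_mul_ne _ _ fun h' => h (congrArg Vertex.set h').symm

theorem sum_e : ∑ I, e I = 1 := by
  rw [QuiverAlg.one_def]
  exact Fintype.sum_equiv vertexEquiv _ _ fun _ => rfl

theorem e_mul_υ (I J : Finset (Fin 3)) : e I * υ I J = υ I J := by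
  rw [υ]
  split_ifs
  · exact QuiverAlg.ofPath_mul_comp _ _
  · exact mul_zero _

theorem υ_mul_e (I J : Finset (Fin 3)) : υ I J * e J = υ I J := by
  rw [υ]
  split_ifs
  · exact QuiverAlg.ofPath_mul_comp _ _
  · exact zero_mul _

theorem e_mul_δ (I J : Finset (Fin 3)) : e J * δ J I = δ J I := by
  rw [δ]
  split_ifs
  · exact QuiverAlg.ofPath_mul_comp _ _
  · exact mul_zero _

theorem δ_mul_e (I J : Finset (Fin 3)) : δ J I * e I = δ J I := by
  rw [δ]
  split_ifs
  · exact QuiverAlg.ofPath_mul_comp _ _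
  · exact zero_mul _

theorem poincare_univ_div (t : Fin 3) : poincare Finset.univ /ₘ poincare {t}ᶜ = ratio₃ t := by
  rw [poincare_div (Finset.subset_univ _)]
  refine mul_left_cancel₀ (poincare_ne_zero {t}ᶜ) ?_
  rw [aug_h_mul (Finset.subset_univ _), poincare_univ, ratio₃]
  split_ifs with ht
  · rw [ht, poincare_compl_one]
    ring
  · rw [poincare_compl ht]

theorem poincare_single_div (s : Fin 3) : poincare {s} /ₘ poincare ∅ = 1 + X := by
  rw [poincare_div (Finset.empty_subset _), h_single, map_add, map_one, aug_gen]

/-- The generators and relations of the presented algebra. -/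
def presHasseAlg : HasseAlg Pres where
  e I := toPres (e I)
  u₁ s := toPres (υ ∅ {s})
  d₁ s := toPres (δ {s} ∅)
  u₂ s t := toPres (υ {s} {t}ᶜ)
  d₂ t s := toPres (δ {t}ᶜ {s})
  u₃ t := toPres (υ {t}ᶜ Finset.univ)
  d₃ t := toPres (δ Finset.univ {t}ᶜ)
  idem I := by rw [← map_mul, e_mul_e]
  orth I J h := by rw [← map_mul, e_mul_e_of_ne h, map_zero]
  e_sum := by rw [← map_sum, sum_e, map_one]
  u₁_left s := by rw [← map_mul, e_mul_υ]
  u₁_right s := by rw [← map_mul, υ_mul_e]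
  d₁_left s := by rw [← map_mul, e_mul_δ]
  d₁_right s := by rw [← map_mul, δ_mul_e]
  u₂_left s t := by rw [← map_mul, e_mul_υ]
  u₂_right s t := by rw [← map_mul, υ_mul_e]
  d₂_left t s := by rw [← map_mul, e_mul_δ]
  d₂_right t s := by rw [← map_mul, δ_mul_e]
  u₃_left t := by rw [← map_mul, e_mul_υ]
  u₃_right t := by rw [← map_mul, υ_mul_e]
  d₃_left t := by rw [← map_mul, e_mul_δ]
  d₃_right t := by rw [← map_mul, δ_mul_e]
  quasi₁ s := by
    rw [← map_mul, ← map_smul, ← poincare_single_div s]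
    exact toPres_eq (.quasiIdempotent _ _ (cov_empty s))
  quasi₂ t s h := by
    rw [← map_mul, ← map_smul, ← aug_h_compl h, ← poincare_div (cov_single h).1]
    exact toPres_eq (.quasiIdempotent _ _ (cov_single h))
  quasi₃ t := by
    rw [← map_mul, ← map_smul, ← poincare_univ_div t]
    exact toPres_eq (.quasiIdempotent _ _ (cov_compl t))
  sand_u₁ r s t h h' := by
    rw [← map_mul, ← map_mul]
    exact toPres_eq (.sandwich_υ _ _ _ _ (cov_empty r) (cov_single h) (cov_empty s) (cov_single h'))
  sand_d₁ r s t h h' := by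
    rw [← map_mul, ← map_mul]
    exact toPres_eq (.sandwich_δ _ _ _ _ (cov_empty r) (cov_single h) (cov_empty s) (cov_single h'))
  sand_u₂ s r t h h' := by
    rw [← map_mul, ← map_mul]
    exact toPres_eq (.sandwich_υ _ _ _ _ (cov_single h) (cov_compl r) (cov_single h') (cov_compl t))
  sand_d₂ s r t h h' := by
    rw [← map_mul, ← map_mul]
    exact toPres_eq (.sandwich_δ _ _ _ _ (cov_single h) (cov_compl r) (cov_single h') (cov_compl t))
  tors₁ r s t hr hrs hrt hst := by
    have := toPres_eq (.T1 s t (by revert r s t; decide))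
    rw [pair_eq_compl hrs hrt hst] at this
    simpa only [map_mul, map_add, map_smul, χ, mul_assoc] using this
  tors₂ a c ha hc hac := by
    have := toPres_eq (.T2 a 1 c (isLabelling ha hc hac))
    rw [(isLabelling ha hc hac).sets.2.2.2.2.2.2] at this
    simpa only [map_mul] using this
  tors₃ a c ha hc hac := by
    have := toPres_eq (.T3 a 1 c (isLabelling ha hc hac))
    obtain ⟨-, -, -, -, e₁, e₂, e₃⟩ := (isLabelling ha hc hac).sets
    rw [e₁, e₃] at this
    simpa only [map_mul, map_add, map_smul, mul_assoc] using this
  tors₄ a c ha hc hac := by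
    have := toPres_eq (.T4 a 1 c (isLabelling ha hc hac))
    obtain ⟨-, -, -, -, e₁, e₂, e₃⟩ := (isLabelling ha hc hac).sets
    rw [e₁, e₂, e₃] at this
    simpa only [map_mul, map_add, map_smul, mul_assoc] using this
  tors₄' a c ha hc hac := by
    have := toPres_eq (.T4τ a 1 c (isLabelling ha hc hac))
    obtain ⟨-, -, -, -, e₁, e₂, e₃⟩ := (isLabelling ha hc hac).sets
    rw [e₁, e₂, e₃] at this
    simpa only [map_mul, map_add, map_smul, mul_assoc] using this
  adjoin_eq := by
    rw [eq_top_iff]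
    rintro b -
    obtain ⟨f, rfl⟩ := toPres_surjective b
    induction f using generate with
    | hadd f g hf hg => rw [map_add]; exact add_mem hf hg
    | hsmul c f hf => rw [map_smul]; exact Subalgebra.smul_mem _ hf c
    | hmul f g hf hg => rw [map_mul]; exact mul_mem hf hg
    | h0 => rw [map_zero]; exact zero_mem _
    | he I => exact Algebra.subset_adjoin (.inl (.inl (.inl ⟨I, rfl⟩)))
    | hυ I J hIJ =>
      rcases cov_cases hIJ with ⟨s, rfl, rfl⟩ | ⟨s, t, h, rfl, rfl⟩ | ⟨t, rfl, rfl⟩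
      · exact Algebra.subset_adjoin (.inl (.inl (.inr (.inl ⟨s, rfl⟩))))
      · exact Algebra.subset_adjoin (.inl (.inr ⟨s, t, h, .inl rfl⟩))
      · exact Algebra.subset_adjoin (.inr (.inl ⟨t, rfl⟩))
    | hδ I J hIJ =>
      rcases cov_cases hIJ with ⟨s, rfl, rfl⟩ | ⟨s, t, h, rfl, rfl⟩ | ⟨t, rfl, rfl⟩
      · exact Algebra.subset_adjoin (.inl (.inl (.inr (.inr ⟨s, rfl⟩))))
      · exact Algebra.subset_adjoin (.inl (.inr ⟨s, t, h, .inr rfl⟩))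
      · exact Algebra.subset_adjoin (.inr (.inr ⟨t, rfl⟩))

end HeckeS4
end

noncomputable section
namespace HeckeS4

/-! ### The realization by endomorphisms -/

/-- The generator `x_J` of the summand `x_J H`. -/
def gener (J : Finset (Fin 3)) : M :=
  DirectSum.of (fun I => xH I) J ⟨x J, Submodule.mem_span_singleton_self _⟩

theorem coe_gener (J L : Finset (Fin 3)) : (gener J L : H) = if L = J then x J else 0 :=
  coe_of_apply J L _

theorem rinv_apply_gener (f : E) (I J : Finset (Fin 3)) : RInv J (f (gener J) I : H) := by
  intro j hj
  -- The scalar q is written as right multiplication by q · 1, so that right H-linearity of f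
  -- applies to both sides.
  have h1 : MulOpposite.op (gen j) • gener J = MulOpposite.op ((X : ℤ[X]) • (1 : H)) • gener J := by
    refine DFinsupp.ext fun L => Subtype.ext ?_
    change (gener J L : H) * gen j = (gener J L : H) * ((X : ℤ[X]) • (1 : H))
    rw [coe_gener, mul_smul_comm, mul_one]
    split_ifs
    · exact x_RInv J j hj
    · rw [zero_mul, smul_zero]
  have h2 := congrArg (fun z : M => (z I : H)) (congrArg f h1)
  rw [map_smul, map_smul] at h2
  have h3 : (f (gener J) I : H) * gen j = (f (gener J) I : H) * ((X : ℤ[X]) • (1 : H)) := h2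
  rw [h3, mul_smul_comm, mul_one]

theorem E_ext_gener {f g : E} (h : ∀ I J, (f (gener J) I : H) = g (gener J) I) : f = g := by
  refine DirectSum.linearMap_ext _ fun J => LinearMap.ext fun y => ?_
  obtain ⟨a, ha⟩ := Submodule.mem_span_singleton.1 y.2
  have hy : DirectSum.lof Hᵐᵒᵖ _ (fun I => xH I) J y = a • gener J := by
    refine DFinsupp.ext fun L => Subtype.ext ?_
    refine (coe_of_apply J L y).trans ?_
    change _ = a • (gener J L : H)
    rw [coe_gener, ← ha, smul_ite, smul_zero]
  rw [LinearMap.comp_apply, LinearMap.comp_apply, hy, map_smul, map_smul]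
  exact congrArg (a • ·) (DFinsupp.ext fun I => Subtype.ext (h I J))

namespace IsCanonical

variable {Φ : Qq →ₐ[ℤ[X]] E} (hΦ : IsCanonical Φ)

include hΦ

theorem map_e_gener (I : Finset (Fin 3)) : Φ (e I) (gener I) = gener I := by
  refine DFinsupp.ext fun L => Subtype.ext ?_
  rw [hΦ.map_e, coe_gener, coe_gener, if_pos rfl]

theorem map_δ_gener {I J : Finset (Fin 3)} (hIJ : Cov I J) : Φ (δ J I) (gener I) = gener J := by
  refine DFinsupp.ext fun L => Subtype.ext ?_
  rw [hΦ.map_δ I J hIJ, coe_gener, coe_gener, if_pos rfl, h_mul_x hIJ.1]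

/-- The anti-involution applied to h_{J,I} x_I = x_J expresses x_J as a right multiple of x_I. -/
theorem map_υ_gener {I J : Finset (Fin 3)} (hIJ : Cov I J) :
    Φ (υ I J) (gener J) = MulOpposite.op (flip (h J I)) • gener I := by
  refine DFinsupp.ext fun L => Subtype.ext ?_
  rw [hΦ.map_υ I J hIJ, coe_gener, if_pos rfl]
  change _ = (gener I L : H) * flip (h J I)
  rw [coe_gener, ite_mul, zero_mul, ← flip_x I, ← flip_mul, h_mul_x hIJ.1, flip_x]

/-- The homomorphism induced on the presented algebra. -/
def presHom : Pres →ₐ[ℤ[X]] E :=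
  RingCon.liftₐ _ Φ fun x y hxy => by
    have h1 := hΦ.map_eq_zero ((TwoSidedIdeal.rel_iff _ x y).1 hxy)
    have h2 := congrArg (· + Φ y) h1
    rw [← map_add, sub_add_cancel, zero_add] at h2
    exact h2

theorem presHom_mul (b : Pres) (p : Qq) (z : M) :
    hΦ.presHom (b * toPres p) z = hΦ.presHom b (Φ p z) := by
  rw [map_mul]
  rfl

theorem presHom_mul' (b : Pres) (p : Qq) (z : M) :
    hΦ.presHom (toPres p * b) z = Φ p (hΦ.presHom b z) := by
  rw [map_mul]
  rfl

theorem presHom_mul_δ {I J : Finset (Fin 3)} (hIJ : Cov I J) (b : Pres) (L : Finset (Fin 3)) :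
    (hΦ.presHom (b * toPres (δ J I)) (gener I) L : H) = hΦ.presHom b (gener J) L := by
  rw [presHom_mul, hΦ.map_δ_gener hIJ]

theorem presHom_mul_υ {I J : Finset (Fin 3)} (hIJ : Cov I J) (b : Pres) (L : Finset (Fin 3)) :
    (hΦ.presHom (b * toPres (υ I J)) (gener J) L : H) =
      (hΦ.presHom b (gener I) L : H) * flip (h J I) := by
  rw [presHom_mul, hΦ.map_υ_gener hIJ, map_smul]
  rfl

theorem presHom_υ_mul {I J : Finset (Fin 3)} (hIJ : Cov I J) (b : Pres) (z : M) :
    (hΦ.presHom (toPres (υ I J) * b) z I : H) = hΦ.presHom b z J := by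
  rw [presHom_mul', hΦ.map_υ I J hIJ, if_pos rfl]

theorem presHom_δ_mul {I J : Finset (Fin 3)} (hIJ : Cov I J) (b : Pres) (z : M) :
    (hΦ.presHom (toPres (δ J I) * b) z J : H) = h J I * hΦ.presHom b z I := by
  rw [presHom_mul', hΦ.map_δ I J hIJ, if_pos rfl]

/-- The realization of the presented algebra. -/
def realization : presHasseAlg.Realization where
  ev I J :=
    { toFun b := hΦ.presHom b (gener J) I
      map_add' a b := by rw [map_add]; rfl
      map_smul' c b := by rw [map_smul]; rfl }
  linv I J b := linv_coe _ I
  rinv I J b := rinv_apply_gener _ I J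
  ev_e I := (congrArg (fun z : M => (z I : H)) (hΦ.map_e_gener I)).trans
    ((coe_gener I I).trans (if_pos rfl))
  e_mul I J b := by
    change (hΦ.presHom (toPres (e I) * b) (gener J) I : H) = hΦ.presHom b (gener J) I
    rw [presHom_mul', hΦ.map_e, if_pos rfl]
  mul_e I J b := by
    change (hΦ.presHom (b * toPres (e J)) (gener J) I : H) = hΦ.presHom b (gener J) I
    rw [presHom_mul, hΦ.map_e_gener]
  u₁_mul K s b := hΦ.presHom_υ_mul (cov_empty s) b _
  d₁_mul K s b := hΦ.presHom_δ_mul (cov_empty s) b _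
  u₂_mul K s t hst b := hΦ.presHom_υ_mul (cov_single hst) b _
  d₂_mul K t s hst b := hΦ.presHom_δ_mul (cov_single hst) b _
  u₃_mul K t b := hΦ.presHom_υ_mul (cov_compl t) b _
  d₃_mul K t b := hΦ.presHom_δ_mul (cov_compl t) b _
  mul_d₁ I s b := hΦ.presHom_mul_δ (cov_empty s) b I
  mul_u₁ I s b := hΦ.presHom_mul_υ (cov_empty s) b I
  mul_d₂ I t s hst b := hΦ.presHom_mul_δ (cov_single hst) b I
  mul_u₂ I s t hst b := hΦ.presHom_mul_υ (cov_single hst) b I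
  mul_d₃ I t b := hΦ.presHom_mul_δ (cov_compl t) b I
  mul_u₃ I t b := hΦ.presHom_mul_υ (cov_compl t) b I

theorem realization_ev (I J : Finset (Fin 3)) (b : Pres) :
    hΦ.realization.ev I J b = hΦ.presHom b (gener J) I := rfl

/-- The Peirce decomposition a = ∑ e_I a e_J reduces the claim to injectivity on each component. -/
theorem presHom_injective : Function.Injective hΦ.presHom := by
  intro b b' hb
  have h0 := map_sub_eq_zero hΦ.presHom hb
  rw [← sub_eq_zero]
  generalize b - b' = a at h0
  have key : ∀ I J, presHasseAlg.e I * (a * presHasseAlg.e J) = 0 := fun I J => by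
    refine (hΦ.realization.bij I J).1 _ ?_ ?_ ?_
    · rw [← mul_assoc, presHasseAlg.idem]
    · rw [mul_assoc, mul_assoc, presHasseAlg.idem]
    · rw [hΦ.realization.e_mul, hΦ.realization.mul_e, realization_ev, h0]
      rfl
  rw [← one_mul a, ← mul_one a, ← presHasseAlg.e_sum]
  simp only [Finset.mul_sum, Finset.sum_mul, key, Finset.sum_const_zero]

theorem presHom_surjective : Function.Surjective hΦ.presHom := by
  intro f
  -- The matrix entries of f are two-sided invariants; preimages are chosen for each entry and
  -- assembled along the idempotents.
  choose b hb using fun I J => (hΦ.realization.bij I J).2 (f (gener J) I : H) (linv_coe _ I)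
    (rinv_apply_gener f I J)
  refine ⟨∑ I, ∑ J, presHasseAlg.e I * (b I J * presHasseAlg.e J),
    E_ext_gener fun K L => ?_⟩
  rw [← realization_ev, ← hb K L, ← hΦ.realization.e_mul, ← hΦ.realization.mul_e,
    Finset.mul_sum, Finset.sum_mul, Finset.sum_eq_single K]
  · rw [Finset.mul_sum, Finset.sum_mul, Finset.sum_eq_single L]
    · rw [hΦ.realization.mul_e, hΦ.realization.e_mul, hΦ.realization.e_mul, hΦ.realization.mul_e]
    · intro J _ hJ
      rw [mul_assoc, mul_assoc, mul_assoc, presHasseAlg.orth J L hJ, mul_zero, mul_zero, mul_zero]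
    · exact fun h => absurd (Finset.mem_univ _) h
  · intro I _ hI
    rw [Finset.mul_sum, Finset.sum_eq_zero, zero_mul]
    intro J _
    rw [← mul_assoc, presHasseAlg.orth K I (Ne.symm hI), zero_mul]
  · exact fun h => absurd (Finset.mem_univ _) h

end IsCanonical

end HeckeS4
end

theorem theorem8p3 :
    ∃ Φ : HeckeS4.Qq →ₐ[Polynomial ℤ] HeckeS4.E,
      HeckeS4.IsCanonical Φ ∧
      (∀ Φ' : HeckeS4.Qq →ₐ[Polynomial ℤ] HeckeS4.E, HeckeS4.IsCanonical Φ' → Φ' = Φ) ∧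
      Function.Surjective Φ ∧
      TwoSidedIdeal.ker Φ = TwoSidedIdeal.span {p | HeckeS4.Rel p} ∧
      ∃ Ψ : (TwoSidedIdeal.span {p | HeckeS4.Rel p}).ringCon.Quotient ≃ₐ[Polynomial ℤ] HeckeS4.E,
        ∀ p : HeckeS4.Qq, Ψ (RingCon.mk' _ p) = Φ p := by
  have hΦ := HeckeS4.isCanonical_canonical
  refine ⟨HeckeS4.canonical, hΦ, fun Φ' h => h.eq hΦ, fun f => ?_, ?_,
    AlgEquiv.ofBijective hΦ.presHom ⟨hΦ.presHom_injective, hΦ.presHom_surjective⟩, fun _ => rfl⟩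
  · obtain ⟨b, rfl⟩ := hΦ.presHom_surjective f
    obtain ⟨p, rfl⟩ := HeckeS4.toPres_surjective b
    exact ⟨p, rfl⟩
  · refine TwoSidedIdeal.ext fun p => ?_
    rw [TwoSidedIdeal.mem_ker]
    refine ⟨fun hp => HeckeS4.toPres_eq_zero_iff.1 (hΦ.presHom_injective ?_), hΦ.map_eq_zero⟩
    rw [map_zero]
    exact hp
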